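/- **Theorem 4.5.** Let $X$ be a complex Hilbert space, with scalar product $(\cdot,\cdot)$ antilinear in the first and linear in the second argument, and let $\kappa$ be a conjugation on $X$ (an antiunitary involution). Put $X_\kappa=\{x\in X:\kappa x=x\}$. Let ${\rm a}$ be a (possibly unbounded) selfadjoint operator on $X$ with ${\rm a}\ge m>0$ that commutes with $\kappa$ (that is, $\kappa\mathcal D({\rm a})\subset\mathcal D({\rm a})$ and ${\rm a}\kappa x=\kappa {\rm a}x$ for $x\in\mathcal D({\rm a})$), and let $\beta>0$. Put $\sigma={\rm Im}(\cdot,\cdot)$ and $\rho=(e^{\beta {\rm a}}-1)^{-1}$. Let $(\mathcal H_\omega, W_\omega,\Omega)$ be the GNS representation of the quasi-free state $\omega(W(x))=e^{-\frac14(x,(1+2\rho)x)}$ on the Weyl algebra over $X$, whose relations are $W(x)W(y)=e^{-\frac i2\sigma(x,y)}W(x+y)$, $W(x)^*=W(-x)$, $W(0)=1$. Write again $\omega(A)=(\Omega,A\Omega)$ for bounded operators $A$ on $\mathcal H_\omega$. Let $e^{itL}$ be the unitary group on $\mathcal H_\omega$ with $e^{itL}W_\omega(x)\Omega=W_\omega(e^{it{\rm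 a}}x)\Omega$, and let $\tau^\circ_t(A)=e^{itL}Ae^{-itL}$, so that $\tau^\circ_t(W_\omega(x))=W_\omega(e^{it{\rm a}}x)$. Let $\mathcal W$ be the von Neumann algebra on $\mathcal H_\omega$ generated by $\{W_\omega(x):x\in X\}$, and $\mathcal W_\kappa\subset\mathcal W$ the von Neumann algebra generated by $\{W_\omega(x):x\in X_\kappa\}$. Then $(\mathcal W,\mathcal W_\kappa,\tau^\circ,\omega)$ is a stochastically positive $\beta$-KMS system. That is: 1. $\tau^\circ$ is a one-parameter group of $*$-automorphisms of $\mathcal W$, and $\omega$ is a state on $\mathcal W$ such that for all $A,B\in\mathcal W$ there is a function $F$, holomorphic on $\{0<{\rm Im}\,z<\beta\}$ and continuous on its closure, with $F(t)=\omega(A\tau^\circ_t(B))$ and $F(t+i\beta)=\omega(\tau^\circ_t(B)A)$ for all $t\in\mathbb R$. 2. $\mathcal W_\kappa$ is abelian, and $\mathcal W$ is the von Neumann algebra generated by $\bigcup_{t\in\mathbb R}\tau^\circ_t(\mathcal W_\kappa)$. 3. For every $n$ and all positive $A_1,\dots,A_n\in\mathcal W_\kappa$, the Green's function $(t_1,\dots,t_n)\mapsto\omega(\tau^\circ_{t_1}(A_1)\cdots\tau^\circ_{t_n}(A_n))$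 on $\mathbb R^n$ extends to a function $G$ that is holomorphic on $\{z\in\mathbb C^n: {\rm Im}\,z_1<\dots<{\rm Im}\,z_n,\ {\rm Im}\,z_n-{\rm Im}\,z_1<\beta\}$ and continuous on its closure, and the Euclidean Green's function satisfies $G(is_1,\dots,is_n)\ge0$ for all real $s_1\le\dots\le s_n$ with $s_n-s_1\le\beta$. -/

import Mathlib

open scoped InnerProductSpace ComplexOrder

namespace QuasiFree

section OneParticle

variable {X : Type*} [NormedAddCommGroup X] [InnerProductSpace ℂ X] [CompleteSpace X]

/-- `a` is a (possibly unbounded, densely defined) selfadjoint operator with `a ≥ m > 0`. -/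
structure IsSelfAdjointGE (a : X →ₗ.[ℂ] X) (m : ℝ) : Prop where
  isSelfAdjoint : IsSelfAdjoint a
  pos : 0 < m
  ge : ∀ x : a.domain, m * ‖(x : X)‖ ^ 2 ≤ (⟪(x : X), a x⟫_ℂ).re

variable {a : X →ₗ.[ℂ] X} {m : ℝ}

theorem IsSelfAdjointGE.symm_apply (h : IsSelfAdjointGE a m) (x y : a.domain) :
    ⟪a x, (y : X)⟫_ℂ = ⟪(x : X), a y⟫_ℂ := by
  have := LinearPMap.adjoint_isFormalAdjoint (T := a) h.isSelfAdjoint.dense_domain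
  rw [LinearPMap.isSelfAdjoint_def.mp h.isSelfAdjoint] at this
  exact this x y

theorem IsSelfAdjointGE.norm_le (h : IsSelfAdjointGE a m) (x : a.domain) :
    ‖(x : X)‖ ≤ m⁻¹ * ‖a x‖ := by
  have h1 := h.ge x
  have h2 : (⟪(x : X), a x⟫_ℂ).re ≤ ‖(x : X)‖ * ‖a x‖ :=
    (Complex.re_le_norm _).trans (norm_inner_le_norm _ _)
  have hm := h.pos
  rw [inv_mul_eq_div, le_div_iff₀ hm]
  rcases (norm_nonneg (x : X)).eq_or_lt with h0 | h0
  · rw [← h0]; simp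
  · nlinarith

theorem IsSelfAdjointGE.exists_inverse (h : IsSelfAdjointGE a m) :
    ∃ T : X →L[ℂ] X, (∀ x, ∃ hx : T x ∈ a.domain, a ⟨T x, hx⟩ = x) ∧
      ∀ y : a.domain, T (a y) = y := by
  have hcl : IsClosed (a.graph : Set (X × X)) := h.isSelfAdjoint.isClosed
  have : CompleteSpace a.graph := hcl.completeSpace_coe
  let L : a.graph →L[ℂ] X := (ContinuousLinearMap.snd ℂ X X).comp a.graph.subtypeL
  have hbound : ∀ p : a.graph, ‖p‖ ≤ (max m⁻¹ 1).toNNReal * ‖L p‖ := by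
    rintro ⟨⟨x, y⟩, hp⟩
    obtain ⟨z, hz1, hz2⟩ := (LinearPMap.mem_graph_iff a).1 hp
    simp only at hz1 hz2
    subst hz1 hz2
    rw [Real.coe_toNNReal _ (le_max_of_le_right zero_le_one)]
    change max ‖(z : X)‖ ‖a z‖ ≤ _ * ‖a z‖
    refine max_le ((h.norm_le z).trans ?_) ?_
    · gcongr; exact le_max_left _ _
    · exact le_mul_of_one_le_left (norm_nonneg _) (le_max_right _ _)
  have hanti : AntilipschitzWith _ L := L.antilipschitz_of_bound hbound
  have hrc : IsClosed (Set.range L) := hanti.isClosed_range L.uniformContinuous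
  have hort : (LinearMap.range L.toLinearMap)ᗮ = ⊥ := by
    rw [Submodule.eq_bot_iff]
    intro z hz
    rw [Submodule.mem_orthogonal'] at hz
    have hz0 : ∀ x : a.domain, ⟪z, a x⟫_ℂ = 0 := fun x =>
      hz _ ⟨⟨((x : X), a x), a.mem_graph x⟩, rfl⟩
    have hzd : z ∈ a.domain := by
      rw [← LinearPMap.isSelfAdjoint_def.mp h.isSelfAdjoint]
      exact LinearPMap.mem_adjoint_domain_of_exists z ⟨0, fun x => by simp [hz0]⟩
    have h3 : a ⟨z, hzd⟩ = 0 := by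
      refine h.isSelfAdjoint.dense_domain.eq_zero_of_inner_left ℂ (fun v hv => ?_)
      have := h.symm_apply ⟨z, hzd⟩ ⟨v, hv⟩
      rw [this]; exact hz0 ⟨v, hv⟩
    have h4 := h.norm_le ⟨z, hzd⟩
    rw [h3] at h4
    simpa using h4
  have hsurj : LinearMap.range L.toLinearMap = ⊤ := by
    have hc : IsClosed ((LinearMap.range L.toLinearMap : Submodule ℂ X) : Set X) := by
      rw [LinearMap.coe_range]; exact hrc
    have : CompleteSpace (LinearMap.range L.toLinearMap) := hc.completeSpace_coe
    exact Submodule.orthogonal_eq_bot_iff.1 hort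
  have hker : LinearMap.ker L.toLinearMap = ⊥ := LinearMap.ker_eq_bot.2 hanti.injective
  let e := ContinuousLinearEquiv.ofBijective L hker hsurj
  have he : ∀ p, e p = L p := fun p => rfl
  refine ⟨(ContinuousLinearMap.fst ℂ X X).comp (a.graph.subtypeL.comp (e.symm : X →L[ℂ] a.graph)),
    fun x => ?_, fun y => ?_⟩
  · obtain ⟨z, hz1, hz2⟩ := (LinearPMap.mem_graph_iff a).1 (e.symm x).2
    have h5 : L (e.symm x) = x := by rw [← he]; simp
    refine ⟨?_, ?_⟩
    · change ((e.symm x : X × X)).1 ∈ _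
      rw [← hz1]; exact z.2
    · have : (⟨((e.symm x : X × X)).1, hz1 ▸ z.2⟩ : a.domain) = z := Subtype.ext hz1.symm
      change a ⟨((e.symm x : X × X)).1, _⟩ = x
      rw [this, hz2]; exact h5
  · have : e.symm (a y) = ⟨((y : X), a y), a.mem_graph y⟩ := by
      rw [ContinuousLinearEquiv.symm_apply_eq]; rfl
    change ((e.symm (a y) : X × X)).1 = y
    rw [this]

/-- The bounded inverse `a⁻¹` of a selfadjoint operator `a ≥ m > 0`. -/
noncomputable def IsSelfAdjointGE.inv (h : IsSelfAdjointGE a m) : X →L[ℂ] X :=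
  h.exists_inverse.choose

theorem IsSelfAdjointGE.inv_mem (h : IsSelfAdjointGE a m) (x : X) : h.inv x ∈ a.domain :=
  (h.exists_inverse.choose_spec.1 x).1

theorem IsSelfAdjointGE.apply_inv (h : IsSelfAdjointGE a m) (x : X) :
    a ⟨h.inv x, h.inv_mem x⟩ = x := (h.exists_inverse.choose_spec.1 x).2

theorem IsSelfAdjointGE.inv_apply (h : IsSelfAdjointGE a m) (y : a.domain) :
    h.inv (a y) = y := h.exists_inverse.choose_spec.2 y

theorem IsSelfAdjointGE.inv_nonneg (h : IsSelfAdjointGE a m) : 0 ≤ h.inv := by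
  rw [ContinuousLinearMap.nonneg_iff_isPositive]
  rw [ContinuousLinearMap.isPositive_def']
  have hs : ∀ x y, ⟪h.inv x, y⟫_ℂ = ⟪x, h.inv y⟫_ℂ := fun x y => by
    have := h.symm_apply ⟨h.inv x, h.inv_mem x⟩ ⟨h.inv y, h.inv_mem y⟩
    rw [h.apply_inv, h.apply_inv] at this
    exact this.symm
  refine ⟨ContinuousLinearMap.isSelfAdjoint_iff_isSymmetric.2 hs, fun x => ?_⟩
  rw [ContinuousLinearMap.reApplyInnerSelf_apply]
  have := h.ge ⟨h.inv x, h.inv_mem x⟩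
  rw [h.apply_inv] at this
  exact le_trans (mul_nonneg h.pos.le (sq_nonneg _)) this

theorem IsSelfAdjointGE.denseRange_inv (h : IsSelfAdjointGE a m) : DenseRange h.inv := by
  refine h.isSelfAdjoint.dense_domain.mono fun x hx => ⟨a ⟨x, hx⟩, h.inv_apply ⟨x, hx⟩⟩

theorem IsSelfAdjointGE.isSelfAdjoint_inv (h : IsSelfAdjointGE a m) : IsSelfAdjoint h.inv :=
  IsSelfAdjoint.of_nonneg h.inv_nonneg

theorem IsSelfAdjointGE.spectrum_inv (h : IsSelfAdjointGE a m) {z : ℂ}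
    (hz : z ∈ spectrum ℂ h.inv) : 0 ≤ z := 
  spectrum_nonneg_of_nonneg h.inv_nonneg hz

/-- The thermal occupation operator `ρ = (e^{βa} - 1)⁻¹`, as the continuous function
`l ↦ (e^{β/l} - 1)⁻¹` (with value `0` at `l = 0`) of `a⁻¹`. -/
noncomputable def IsSelfAdjointGE.rho (h : IsSelfAdjointGE a m) (β : ℝ) : X →L[ℂ] X :=
  cfc (fun l : ℝ => if l = 0 then 0 else (Real.exp (β / l) - 1)⁻¹) h.inv

theorem IsSelfAdjointGE.rho_nonneg (h : IsSelfAdjointGE a m) {β : ℝ} (hβ : 0 < β) :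
    0 ≤ h.rho β := by
  refine cfc_nonneg fun l hl => ?_
  have hl0 : 0 ≤ l := spectrum_nonneg_of_nonneg h.inv_nonneg hl
  split_ifs with h0
  · exact le_rfl
  · have : 0 ≤ β / l := by positivity
    have := Real.one_le_exp this
    exact _root_.inv_nonneg.2 (by linarith)

/-- The bounded operator `a⁻¹ e^{ita}`, as the continuous function `l ↦ l e^{it/l}` of `a⁻¹`. -/
noncomputable def IsSelfAdjointGE.invMulExp (h : IsSelfAdjointGE a m) (t : ℝ) : X →L[ℂ] X :=
  cfc (fun z : ℂ => z * Complex.exp (Complex.I * t / z)) h.inv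

theorem IsSelfAdjointGE.continuousOn_aux (h : IsSelfAdjointGE a m) (t : ℝ) :
    ContinuousOn (fun z : ℂ => z * Complex.exp (Complex.I * t / z)) (spectrum ℂ h.inv) := by
  have hn : ∀ z ∈ spectrum ℂ h.inv, ‖Complex.exp (Complex.I * t / z)‖ = 1 := fun z hz => by
    obtain ⟨hr, hi⟩ := Complex.nonneg_iff.1 (h.spectrum_inv hz)
    have : z = (z.re : ℂ) := Complex.ext rfl (by simp [← hi])
    rw [this, Complex.norm_exp]
    have : Complex.I * t / (z.re : ℂ) = ((t / z.re : ℝ) : ℂ) * Complex.I := by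
      push_cast; ring
    rw [this]; simp
  intro z hz
  by_cases h0 : z = 0
  · subst h0
    rw [ContinuousWithinAt, zero_mul, tendsto_zero_iff_norm_tendsto_zero]
    have : Filter.Tendsto (fun z : ℂ => ‖z‖) (nhdsWithin 0 (spectrum ℂ h.inv)) (nhds 0) := by
      have := (continuous_norm (E := ℂ)).tendsto 0
      rw [norm_zero] at this
      exact this.mono_left nhdsWithin_le_nhds
    refine this.congr' ?_
    filter_upwards [self_mem_nhdsWithin] with w hw
    rw [norm_mul, hn w hw, mul_one]
  · refine ContinuousAt.continuousWithinAt ?_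
    fun_prop (disch := assumption)

theorem IsSelfAdjointGE.invMulExp_mul (h : IsSelfAdjointGE a m) (s t : ℝ) :
    h.invMulExp s * h.invMulExp t = h.invMulExp (s + t) * h.inv := by
  have hn : IsStarNormal h.inv := h.isSelfAdjoint_inv.isStarNormal
  have e1 : h.invMulExp (s + t) * h.inv = h.invMulExp (s + t) * cfc (fun z : ℂ => z) h.inv := by
    rw [cfc_id' ℂ h.inv]
  rw [e1, invMulExp, invMulExp, invMulExp,
    ← cfc_mul _ _ _ (h.continuousOn_aux s) (h.continuousOn_aux t),
    ← cfc_mul _ (fun z : ℂ => z) _ (h.continuousOn_aux (s + t)) continuousOn_id]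
  congr 1
  funext z
  rw [show Complex.I * ((s + t : ℝ) : ℂ) / z = Complex.I * s / z + Complex.I * t / z by
    push_cast; ring, Complex.exp_add]
  ring

theorem IsSelfAdjointGE.invMulExp_zero (h : IsSelfAdjointGE a m) : h.invMulExp 0 = h.inv := by
  have hn : IsStarNormal h.inv := h.isSelfAdjoint_inv.isStarNormal
  simp [invMulExp, cfc_id' ℂ h.inv]

theorem IsSelfAdjointGE.star_invMulExp (h : IsSelfAdjointGE a m) (t : ℝ) :
    star (h.invMulExp t) = h.invMulExp (-t) := by
  rw [invMulExp, invMulExp, ← cfc_star]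
  refine cfc_congr fun z hz => ?_
  obtain ⟨hr, hi⟩ := Complex.nonneg_iff.1 (h.spectrum_inv hz)
  have : (starRingEnd ℂ) z = z := Complex.conj_eq_iff_im.2 hi.symm
  simp [← Complex.exp_conj, this]

theorem IsSelfAdjointGE.norm_invMulExp (h : IsSelfAdjointGE a m) (t : ℝ) (x : X) :
    ‖h.invMulExp t x‖ = ‖h.inv x‖ := by
  have h1 : star (h.invMulExp t) * h.invMulExp t = star h.inv * h.inv := by
    rw [h.star_invMulExp, h.invMulExp_mul, neg_add_cancel, h.invMulExp_zero,
      h.isSelfAdjoint_inv.star_eq]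
  have key : ∀ A : X →L[ℂ] X, (‖A x‖ : ℂ) ^ 2 = ⟪x, (star A * A) x⟫_ℂ := fun A => by
    rw [mul_apply_eq_comp, ContinuousLinearMap.star_eq_adjoint,
      ContinuousLinearMap.adjoint_inner_right, inner_self_eq_norm_sq_to_K]; rfl
  have h2 : (‖h.invMulExp t x‖ : ℂ) ^ 2 = (‖h.inv x‖ : ℂ) ^ 2 := by rw [key, key, h1]
  exact (sq_eq_sq₀ (norm_nonneg _) (norm_nonneg _)).1 (by exact_mod_cast h2)

/-- The unitary `e^{ita}`: the unique bounded operator `U` with `U a⁻¹ = a⁻¹ e^{ita}`. -/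
noncomputable def IsSelfAdjointGE.expI (h : IsSelfAdjointGE a m) (t : ℝ) : X →L[ℂ] X :=
  (h.invMulExp t : X →ₗ[ℂ] X).extendOfNorm (h.inv : X →ₗ[ℂ] X)

theorem IsSelfAdjointGE.expI_inv (h : IsSelfAdjointGE a m) (t : ℝ) (x : X) :
    h.expI t (h.inv x) = h.invMulExp t x :=
  LinearMap.extendOfNorm_eq (f := (h.invMulExp t : X →ₗ[ℂ] X)) (e := (h.inv : X →ₗ[ℂ] X))
    h.denseRange_inv ⟨1, fun x => by simpa using (h.norm_invMulExp t x).le⟩ x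

theorem IsSelfAdjointGE.ext_inv (h : IsSelfAdjointGE a m) {A B : X →L[ℂ] X}
    (hAB : ∀ x, A (h.inv x) = B (h.inv x)) : A = B := by
  ext y
  exact congrFun (h.denseRange_inv.equalizer A.continuous B.continuous (funext hAB)) y

theorem IsSelfAdjointGE.commute_invMulExp (h : IsSelfAdjointGE a m) {B : X →L[ℂ] X}
    (hB : Commute h.inv B) (t : ℝ) : Commute (h.invMulExp t) B :=
  IsSelfAdjoint.commute_cfc h.isSelfAdjoint_inv hB _

theorem IsSelfAdjointGE.commute_expI (h : IsSelfAdjointGE a m) {B : X →L[ℂ] X}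
    (hB : Commute h.inv B) (t : ℝ) : Commute (h.expI t) B := by
  refine h.ext_inv fun x => ?_
  have h1 : h.inv (B x) = B (h.inv x) := congrArg (fun A : X →L[ℂ] X => A x) hB.eq
  have h2 : h.invMulExp t (B x) = B (h.invMulExp t x) :=
    congrArg (fun A : X →L[ℂ] X => A x) (h.commute_invMulExp hB t).eq
  simp only [mul_apply_eq_comp]
  rw [← h1, h.expI_inv, h.expI_inv, h2]

theorem IsSelfAdjointGE.expI_add (h : IsSelfAdjointGE a m) (s t : ℝ) :
    h.expI (s + t) = h.expI s * h.expI t := by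
  have h0 : h.expI (s + t) * h.inv = h.expI s * h.expI t * h.inv := by
    refine h.ext_inv fun x => ?_
    have h2 : h.invMulExp t (h.inv x) = h.inv (h.invMulExp t x) :=
      congrArg (fun A : X →L[ℂ] X => A x) (h.commute_invMulExp (Commute.refl _) t).eq
    have h3 := congrArg (fun A : X →L[ℂ] X => A x) (h.invMulExp_mul s t)
    simp only [mul_apply_eq_comp] at h3 ⊢
    rw [h.expI_inv, h.expI_inv, h2, h.expI_inv, h3]
  exact h.ext_inv fun x => congrArg (fun A : X →L[ℂ] X => A x) h0

theorem IsSelfAdjointGE.expI_zero (h : IsSelfAdjointGE a m) : h.expI 0 = 1 := by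
  refine h.ext_inv fun x => ?_
  rw [h.expI_inv, h.invMulExp_zero]; rfl

theorem IsSelfAdjointGE.norm_expI (h : IsSelfAdjointGE a m) (t : ℝ) (x : X) :
    ‖h.expI t x‖ = ‖x‖ := by
  induction x using h.denseRange_inv.induction_on with
  | hp => exact isClosed_eq (by fun_prop) (by fun_prop)
  | ih x => rw [h.expI_inv, h.norm_invMulExp]

theorem IsSelfAdjointGE.inner_expI (h : IsSelfAdjointGE a m) (t : ℝ) (x y : X) :
    ⟪h.expI t x, h.expI t y⟫_ℂ = ⟪x, y⟫_ℂ :=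
  (LinearMap.norm_map_iff_inner_map_map (h.expI t)).1 (h.norm_expI t) x y

theorem IsSelfAdjointGE.rho_expI (h : IsSelfAdjointGE a m) (β t : ℝ) (x : X) :
    h.rho β (h.expI t x) = h.expI t (h.rho β x) := by
  have h1 : Commute h.inv (h.rho β) :=
    (IsSelfAdjoint.commute_cfc h.isSelfAdjoint_inv (Commute.refl _) _).symm
  exact (congrArg (fun A : X →L[ℂ] X => A x) (h.commute_expI h1 t).eq).symm

end OneParticle
section Kernel

variable {ι : Type*} {E : Type*} [NormedAddCommGroup E] [InnerProductSpace ℂ E] [CompleteSpace E]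

theorem posSemidef_gram (B : E →L[ℂ] E) (hB : 0 ≤ B) (v : ι → E) :
    Matrix.PosSemidef (Matrix.of fun i j => ⟪v i, B (v j)⟫_ℂ) := by
  have hB' := (ContinuousLinearMap.nonneg_iff_isPositive B).1 hB
  have hs := ContinuousLinearMap.isSelfAdjoint_iff_isSymmetric.1 hB'.isSelfAdjoint
  refine ⟨?_, fun f => ?_⟩
  · ext i j
    have := hs (v i) (v j)
    simp only [ContinuousLinearMap.coe_coe] at this
    simp [Matrix.conjTranspose_apply, this]
  · have h0 := hB'.inner_nonneg_right (f.sum fun i c => c • v i)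
    refine h0.trans_eq ?_
    simp only [Finsupp.sum, map_sum, sum_inner, inner_sum, map_smul, inner_smul_left,
      inner_smul_right, Complex.star_def, Finset.mul_sum]
    rw [Finset.sum_comm]
    refine Finset.sum_congr rfl fun i _ => Finset.sum_congr rfl fun j _ => ?_
    simp only [Matrix.of_apply]; ring

theorem posSemidef_rankOne (u : ι → ℂ) :
    Matrix.PosSemidef (Matrix.of fun i j => (starRingEnd ℂ) (u i) * u j) := by
  have h1 : (0 : ℂ →L[ℂ] ℂ) ≤ 1 := zero_le_one
  have := posSemidef_gram (1 : ℂ →L[ℂ] ℂ) h1 u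
  convert this using 3 with i j
  simp [mul_comm]

theorem posSemidef_exp {L : Matrix ι ι ℂ} (hL : L.PosSemidef) :
    Matrix.PosSemidef (Matrix.of fun i j => Complex.exp (L i j)) := by
  have hpow : ∀ n : ℕ, Matrix.PosSemidef (Matrix.of fun i j => (L i j) ^ n) := fun n => by
    induction n with
    | zero => simpa using posSemidef_rankOne (fun _ : ι => (1 : ℂ))
    | succ k ih =>
      have e : (Matrix.of fun i j => (L i j) ^ (k + 1)) =
          (Matrix.of fun i j => (L i j) ^ k).hadamard L := by
        ext i j; simp [pow_succ]
      rw [e]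
      exact ih.hadamard hL
  have hsum : ∀ n : ℕ, Matrix.PosSemidef
      (∑ k ∈ Finset.range n, ((k.factorial : ℝ)⁻¹ : ℝ) • (Matrix.of fun i j => (L i j) ^ k)) :=
    fun n => Matrix.posSemidef_sum _ fun k _ => (hpow k).smul (by positivity)
  have hlim : ∀ i j, Filter.Tendsto (fun n => (∑ k ∈ Finset.range n,
      ((k.factorial : ℝ)⁻¹ : ℝ) • (Matrix.of fun i j => (L i j) ^ k)) i j) Filter.atTop
      (nhds (Complex.exp (L i j))) := fun i j => by
    have := (NormedSpace.expSeries_div_hasSum_exp (L i j)).tendsto_sum_nat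
    rw [← Complex.exp_eq_exp_ℂ] at this
    refine this.congr fun n => ?_
    rw [Matrix.sum_apply]
    refine Finset.sum_congr rfl fun k _ => ?_
    simp [Matrix.smul_apply, div_eq_inv_mul]
  refine ⟨?_, fun f => ?_⟩
  · ext i j
    have := hL.1.apply i j
    rw [Complex.star_def] at this
    simp only [Matrix.conjTranspose_apply, Matrix.of_apply, Complex.star_def]
    rw [← Complex.exp_conj, this]
  · refine ge_of_tendsto' (x := Filter.atTop) (b := 0)
      (f := fun n => f.sum fun i xi => f.sum fun j xj => star xi * (∑ k ∈ Finset.range n,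
        ((k.factorial : ℝ)⁻¹ : ℝ) • (Matrix.of fun i j => (L i j) ^ k)) i j * xj)
      ?_ (fun n => (hsum n).2 f)
    refine tendsto_finsetSum _ fun i _ => tendsto_finsetSum _ fun j _ => ?_
    exact ((hlim i j).const_mul _).mul_const _

/-- The sesquilinear form `⟨∑ cₓ x, ∑ d_y y⟩ = ∑ conj cₓ · K x y · d_y`. -/
noncomputable def kernelForm (K : Matrix ι ι ℂ) (f g : ι →₀ ℂ) : ℂ :=
  f.sum fun x c => g.sum fun y d => star c * K x y * d

theorem kernelForm_add_left (K : Matrix ι ι ℂ) (f g k : ι →₀ ℂ) :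
    kernelForm K (f + g) k = kernelForm K f k + kernelForm K g k := by
  unfold kernelForm
  rw [Finsupp.sum_add_index'] <;> simp [← Finsupp.sum_add, add_mul]

theorem kernelForm_smul_left (K : Matrix ι ι ℂ) (r : ℂ) (f k : ι →₀ ℂ) :
    kernelForm K (r • f) k = star r * kernelForm K f k := by
  unfold kernelForm
  rw [Finsupp.sum_smul_index] <;> simp [Finsupp.mul_sum, mul_assoc]

theorem kernelForm_single (K : Matrix ι ι ℂ) (x y : ι) (c d : ℂ) :
    kernelForm K (Finsupp.single x c) (Finsupp.single y d) = star c * K x y * d := by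
  simp [kernelForm]

variable {K : Matrix ι ι ℂ}

theorem kernelForm_conj (hK : K.PosSemidef) (f g : ι →₀ ℂ) :
    star (kernelForm K g f) = kernelForm K f g := by
  simp only [kernelForm, Finsupp.sum, map_sum, map_mul, Complex.star_def, Complex.conj_conj]
  rw [Finset.sum_comm]
  refine Finset.sum_congr rfl fun i _ => Finset.sum_congr rfl fun j _ => ?_
  have := hK.1.apply i j
  rw [Complex.star_def] at this
  rw [this]; ring

set_option linter.unusedVariables false in
/-- Formal finite linear combinations of points of `ι`, with the semi-inner product in which two
points `x`, `y` have the inner product `K x y`. -/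
@[nolint unusedArguments]
def PreKernelSpace (hK : K.PosSemidef) : Type _ := ι →₀ ℂ

variable (hK : K.PosSemidef)

noncomputable instance : AddCommGroup (PreKernelSpace hK) := inferInstanceAs (AddCommGroup (ι →₀ ℂ))
noncomputable instance : Module ℂ (PreKernelSpace hK) := inferInstanceAs (Module ℂ (ι →₀ ℂ))

/-- The semi-inner product of `PreKernelSpace`. -/
noncomputable abbrev preKernelCore : PreInnerProductSpace.Core ℂ (PreKernelSpace hK) where
  inner f g := kernelForm K f g
  conj_inner_symm f g := kernelForm_conj hK f g
  add_left f g k := kernelForm_add_left K f g k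
  smul_left f g r := kernelForm_smul_left K r f g
  re_inner_nonneg f := (Complex.nonneg_iff.1 (hK.2 f)).1

noncomputable instance : SeminormedAddCommGroup (PreKernelSpace hK) :=
  InnerProductSpace.Core.toSeminormedAddCommGroup (c := preKernelCore hK)
noncomputable instance : InnerProductSpace ℂ (PreKernelSpace hK) :=
  InnerProductSpace.ofCore (preKernelCore hK)

/-- The Hilbert space of a positive semidefinite kernel: the Hausdorff completion of the formal
linear combinations of points. -/
abbrev KernelSpace : Type _ := UniformSpace.Completion (PreKernelSpace hK)

/-- The canonical map of formal linear combinations to `KernelSpace`. -/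
noncomputable def toKernelSpace : (ι →₀ ℂ) →ₗ[ℂ] KernelSpace hK where
  toFun f := ((show PreKernelSpace hK from f : PreKernelSpace hK) : KernelSpace hK)
  map_add' f g := UniformSpace.Completion.coe_add (α := PreKernelSpace hK) f g
  map_smul' c f := UniformSpace.Completion.coe_smul (X := PreKernelSpace hK) c f

theorem inner_toKernelSpace (f g : ι →₀ ℂ) :
    ⟪toKernelSpace hK f, toKernelSpace hK g⟫_ℂ = kernelForm K f g :=
  UniformSpace.Completion.inner_coe (E := PreKernelSpace hK) f g

theorem denseRange_toKernelSpace : DenseRange (toKernelSpace hK) :=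
  UniformSpace.Completion.denseRange_coe (α := PreKernelSpace hK)

/-- The vector of `KernelSpace` given by the point `x`. -/
noncomputable def kernelVec (x : ι) : KernelSpace hK := toKernelSpace hK (Finsupp.single x 1)

theorem inner_kernelVec (x y : ι) : ⟪kernelVec hK x, kernelVec hK y⟫_ℂ = K x y := by
  simp [kernelVec, inner_toKernelSpace, kernelForm_single]

theorem toKernelSpace_single (x : ι) (c : ℂ) :
    toKernelSpace hK (Finsupp.single x c) = c • kernelVec hK x := by
  rw [kernelVec, ← map_smul]; simp

theorem kernelSpace_ext {A B : KernelSpace hK →L[ℂ] KernelSpace hK}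
    (h : ∀ x, A (kernelVec hK x) = B (kernelVec hK x)) : A = B := by
  ext v
  induction v using (denseRange_toKernelSpace hK).induction_on with
  | hp => exact isClosed_eq A.continuous B.continuous
  | ih f =>
    induction f using Finsupp.induction_linear with
    | zero => simp
    | add f g hf hg => simp [hf, hg]
    | single x c => simp [toKernelSpace_single, h]

theorem exists_kernelIsometry (φ : ι → ι) (c : ι → ℂ)
    (hφ : ∀ x y, star (c x) * K (φ x) (φ y) * c y = K x y) :
    ∃ A : KernelSpace hK →L[ℂ] KernelSpace hK, (∀ v, ‖A v‖ = ‖v‖) ∧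
      ∀ x, A (kernelVec hK x) = c x • kernelVec hK (φ x) := by
  let J : (ι →₀ ℂ) →ₗ[ℂ] (ι →₀ ℂ) :=
    Finsupp.linearCombination ℂ fun x => Finsupp.single (φ x) (c x)
  have hJ1 : ∀ x d, J (Finsupp.single x d) = Finsupp.single (φ x) (d * c x) := fun x d => by
    simp [J]
  have hJ : ∀ f g, kernelForm K (J f) (J g) = kernelForm K f g := fun f g => by
    induction f using Finsupp.induction_linear with
    | zero => simp [kernelForm]
    | add f f' hf hf' => rw [map_add, kernelForm_add_left, kernelForm_add_left, hf, hf']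
    | single x d =>
      rw [← kernelForm_conj hK, ← kernelForm_conj hK (Finsupp.single x d)]
      congr 1
      induction g using Finsupp.induction_linear with
      | zero => simp [kernelForm]
      | add f f' hf hf' => rw [map_add, kernelForm_add_left, kernelForm_add_left, hf, hf']
      | single y e =>
        rw [hJ1, hJ1, kernelForm_single, kernelForm_single, star_mul]
        have := hφ y x
        rw [← this]
        ring
  have hn : ∀ f, ‖toKernelSpace hK (J f)‖ = ‖toKernelSpace hK f‖ := fun f => by
    rw [@norm_eq_sqrt_re_inner ℂ, @norm_eq_sqrt_re_inner ℂ, inner_toKernelSpace,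
      inner_toKernelSpace, hJ]
  let A := ((toKernelSpace hK).comp J).extendOfNorm (toKernelSpace hK)
  have hA : ∀ f, A (toKernelSpace hK f) = toKernelSpace hK (J f) :=
    LinearMap.extendOfNorm_eq (denseRange_toKernelSpace hK) ⟨1, fun f => by simp [hn]⟩
  refine ⟨A, fun v => ?_, fun x => ?_⟩
  · induction v using (denseRange_toKernelSpace hK).induction_on with
    | hp => exact isClosed_eq (by fun_prop) (by fun_prop)
    | ih f => rw [hA, hn]
  · rw [kernelVec, hA, hJ1, toKernelSpace_single, one_mul]

/-- A bijection `φ` of the points together with phases `c` that leaves the kernel invariant defines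
a unitary operator. -/
theorem exists_kernelUnitary (φ : ι ≃ ι) (c : ι → ℂ) (hc : ∀ x, c x ≠ 0)
    (hφ : ∀ x y, star (c x) * K (φ x) (φ y) * c y = K x y) :
    ∃ U : unitary (KernelSpace hK →L[ℂ] KernelSpace hK),
      ∀ x, (U : KernelSpace hK →L[ℂ] KernelSpace hK) (kernelVec hK x)
        = c x • kernelVec hK (φ x) := by
  obtain ⟨A, hAn, hA⟩ := exists_kernelIsometry hK φ c hφ
  obtain ⟨B, hBn, hB⟩ := exists_kernelIsometry hK φ.symm (fun y => (c (φ.symm y))⁻¹)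
    (fun x y => by
      have := hφ (φ.symm x) (φ.symm y)
      rw [φ.apply_symm_apply, φ.apply_symm_apply] at this
      rw [← this, star_inv₀]
      have h1 := hc (φ.symm x)
      have h2 := hc (φ.symm y)
      have h3 : star (c (φ.symm x)) ≠ 0 := star_ne_zero.2 h1
      field_simp)
  have hAB : A * B = 1 := kernelSpace_ext hK fun x => by
    simp [hA, hB, hc]
  have hBA : B * A = 1 := kernelSpace_ext hK fun x => by
    simp [hA, hB, hc]
  have hAA : star A * A = 1 := by
    rw [ContinuousLinearMap.star_eq_adjoint]
    exact (ContinuousLinearMap.norm_map_iff_adjoint_comp_self A).1 hAn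
  have hsB : star A = B := by
    calc star A = star A * (A * B) := by rw [hAB, mul_one]
      _ = B := by rw [← mul_assoc, hAA, one_mul]
  exact ⟨⟨A, Unitary.mem_iff.2 ⟨hAA, by rw [hsB, hAB]⟩⟩, hA⟩

end Kernel
section FieldAlgebra

variable {X : Type*} [NormedAddCommGroup X] [InnerProductSpace ℂ X] [CompleteSpace X]

/-- The value `exp(-¼ (x, (1 + 2ρ) x))` of the quasi-free functional on the Weyl element `W(x)`. -/
noncomputable def weylFunctional (ρ : X →L[ℂ] X) (x : X) : ℂ :=
  Complex.exp (-(1 / 4) * ⟪x, x + (2 : ℂ) • ρ x⟫_ℂ)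

/-- The GNS inner products `ω(W(x)* W(y)) = e^{iσ(x,y)/2} ω(W(y - x))`, where `σ = Im (·,·)`. -/
noncomputable def weylKernel (ρ : X →L[ℂ] X) : Matrix X X ℂ :=
  Matrix.of fun x y =>
    Complex.exp (Complex.I / 2 * ((⟪x, y⟫_ℂ).im : ℂ)) * weylFunctional ρ (y - x)

theorem weylKernel_posSemidef {ρ : X →L[ℂ] X} (hρ : 0 ≤ ρ) : (weylKernel ρ).PosSemidef := by
  have hρ' := (ContinuousLinearMap.nonneg_iff_isPositive ρ).1 hρ
  have h1 : (0 : X →L[ℂ] X) ≤ 1 := zero_le_one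
  have hhalf : (0 : ℝ) ≤ 1 / 2 := by norm_num
  have hL := (((posSemidef_gram 1 h1 (fun x : X => x)).add
    (posSemidef_gram ρ hρ (fun x : X => x))).add
    (posSemidef_gram ρ hρ (fun x : X => x)).transpose).smul hhalf
  have := (posSemidef_exp hL).hadamard (posSemidef_rankOne
    (fun x : X => Complex.exp (-(1 / 4) * ⟪x, x + (2 : ℂ) • ρ x⟫_ℂ)))
  refine (congrArg Matrix.PosSemidef ?_).mpr this
  ext x y
  have hself : ∀ z, (starRingEnd ℂ) ⟪z, ρ z⟫_ℂ = ⟪z, ρ z⟫_ℂ := fun z => by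
    rw [inner_conj_symm]
    exact (ContinuousLinearMap.isSelfAdjoint_iff_isSymmetric.1 hρ'.isSelfAdjoint) z z
  have hself' : ∀ z : X, (starRingEnd ℂ) ⟪z, z⟫_ℂ = ⟪z, z⟫_ℂ := fun z => inner_conj_symm z z
  simp only [weylKernel, weylFunctional, Matrix.hadamard_apply, Matrix.of_apply, Matrix.smul_apply,
    Matrix.add_apply, Matrix.transpose_apply, one_apply_eq_self, ← Complex.exp_conj,
    ← Complex.exp_add, map_sub, map_mul, map_neg, map_div₀, map_one, inner_add_right,
    inner_smul_right, inner_sub_left, inner_sub_right, map_add, hself, hself', map_ofNat,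
    smul_sub, Complex.real_smul]
  congr 1
  have e1 : Complex.I * ((⟪x, y⟫_ℂ).im : ℂ) = (⟪x, y⟫_ℂ - ⟪y, x⟫_ℂ) / 2 := by
    rw [← inner_conj_symm y x, Complex.sub_conj]; push_cast; ring
  push_cast
  linear_combination (1 / 2 : ℂ) * e1

/-- The GNS Hilbert space of the quasi-free state. -/
abbrev FieldSpace {ρ : X →L[ℂ] X} (hρ : 0 ≤ ρ) : Type _ := KernelSpace (weylKernel_posSemidef hρ)

variable {ρ : X →L[ℂ] X} (hρ : 0 ≤ ρ)

/-- The GNS vector `W_ω(x) Ω`. -/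
noncomputable abbrev coherentVec (x : X) : FieldSpace hρ :=
  kernelVec (weylKernel_posSemidef hρ) x

/-- The GNS vacuum vector `Ω`. -/
noncomputable def vacuum : FieldSpace hρ := coherentVec hρ 0

theorem exists_weyl (x : X) : ∃ U : unitary (FieldSpace hρ →L[ℂ] FieldSpace hρ),
    ∀ y, (U : FieldSpace hρ →L[ℂ] FieldSpace hρ) (coherentVec hρ y)
      = Complex.exp (-(Complex.I / 2 * ((⟪x, y⟫_ℂ).im : ℂ))) • coherentVec hρ (x + y) := by
  refine exists_kernelUnitary _ (Equiv.addLeft x)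
    (fun y => Complex.exp (-(Complex.I / 2 * ((⟪x, y⟫_ℂ).im : ℂ))))
    (fun y => Complex.exp_ne_zero _) fun y z => ?_
  have e : (⟪x, x⟫_ℂ).im = 0 := inner_self_im (𝕜 := ℂ) x
  have e2 : (⟪y, x⟫_ℂ).im = - (⟪x, y⟫_ℂ).im := by
    rw [← inner_conj_symm y x, Complex.conj_im]
  simp only [weylKernel, Matrix.of_apply, Equiv.coe_addLeft, add_sub_add_left_eq_sub,
    Complex.star_def, ← Complex.exp_conj, inner_add_left, inner_add_right, Complex.add_im, e, e2]
  rw [← mul_assoc, mul_right_comm, ← Complex.exp_add, ← Complex.exp_add]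
  congr 2
  simp only [map_neg, map_mul, map_div₀, Complex.conj_I, Complex.conj_ofReal, map_ofNat]
  push_cast
  ring

/-- The Weyl operator `W_ω(x)` in the GNS representation, i.e. left multiplication by `W(x)`:
`W_ω(x) W_ω(y) Ω = e^{-iσ(x,y)/2} W_ω(x + y) Ω`. -/
noncomputable def weyl (x : X) : FieldSpace hρ →L[ℂ] FieldSpace hρ := (exists_weyl hρ x).choose

theorem weyl_coherentVec (x y : X) : weyl hρ x (coherentVec hρ y)
    = Complex.exp (-(Complex.I / 2 * ((⟪x, y⟫_ℂ).im : ℂ))) • coherentVec hρ (x + y) :=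
  (exists_weyl hρ x).choose_spec y

theorem weyl_vacuum (x : X) : weyl hρ x (vacuum hρ) = coherentVec hρ x := by
  simp [vacuum, weyl_coherentVec]

theorem weyl_mem_unitary (x : X) : weyl hρ x ∈ unitary (FieldSpace hρ →L[ℂ] FieldSpace hρ) :=
  (exists_weyl hρ x).choose.2

/-- The canonical commutation relations in Weyl form. -/
theorem weyl_mul (x y : X) : weyl hρ x * weyl hρ y
    = Complex.exp (-(Complex.I / 2 * ((⟪x, y⟫_ℂ).im : ℂ))) • weyl hρ (x + y) := by
  refine kernelSpace_ext _ fun z => ?_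
  simp only [mul_apply_eq_comp, FunLike.coe_smul, Pi.smul_apply]
  rw [weyl_coherentVec, map_smul, weyl_coherentVec, weyl_coherentVec, smul_smul, smul_smul,
    ← Complex.exp_add, ← Complex.exp_add, add_assoc]
  congr 2
  simp only [inner_add_left, inner_add_right, Complex.add_im]
  push_cast
  ring

theorem weyl_zero : weyl hρ 0 = 1 :=
  kernelSpace_ext _ fun z => by rw [weyl_coherentVec]; simp

/-- The vacuum expectation of the Weyl operators is the quasi-free functional. -/
theorem inner_vacuum_weyl (x : X) :
    ⟪vacuum hρ, weyl hρ x (vacuum hρ)⟫_ℂ = weylFunctional ρ x := by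
  rw [weyl_vacuum, vacuum, inner_kernelVec]
  simp [weylKernel]

end FieldAlgebra

section Generalities

variable {H : Type*} [NormedAddCommGroup H] [InnerProductSpace ℂ H] [CompleteSpace H]

/-- The von Neumann algebra generated by a set of bounded operators: the double commutant
`(S ∪ S*)''`. -/
noncomputable def vonNeumannGenerated (S : Set (H →L[ℂ] H)) : VonNeumannAlgebra H where
  toStarSubalgebra :=
    StarSubalgebra.centralizer ℂ (StarSubalgebra.centralizer ℂ S : Set (H →L[ℂ] H))
  centralizer_centralizer' := by
    change Set.centralizer (Set.centralizer
      ((StarSubalgebra.centralizer ℂ (StarSubalgebra.centralizer ℂ S : Set (H →L[ℂ] H)) :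
        StarSubalgebra ℂ (H →L[ℂ] H)) : Set (H →L[ℂ] H))) = 
      ((StarSubalgebra.centralizer ℂ (StarSubalgebra.centralizer ℂ S : Set (H →L[ℂ] H)) :
        StarSubalgebra ℂ (H →L[ℂ] H)) : Set (H →L[ℂ] H))
    rw [StarSubalgebra.coe_centralizer, Set.centralizer_centralizer_centralizer]

theorem coe_vonNeumannGenerated (S : Set (H →L[ℂ] H)) :
    (vonNeumannGenerated S : Set (H →L[ℂ] H)) = Set.centralizer (Set.centralizer (S ∪ star S)) :=
  StarSubalgebra.coe_centralizer_centralizer (R := ℂ) S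

/-- The vector functional `A ↦ (Ω, A Ω)`. -/
noncomputable def vectorFunctional (Ω : H) : (H →L[ℂ] H) →ₗ[ℂ] ℂ where
  toFun A := ⟪Ω, A Ω⟫_ℂ
  map_add' A B := by simp
  map_smul' c A := by simp

/-- `(M, τ, ω)` is a `β`-KMS system: `τ` restricts to a one-parameter group of `*`-automorphisms of
`M`, and `ω` is a state on `M` satisfying the KMS condition at inverse temperature `β`. -/
structure IsKMSSystem (β : ℝ) (M : VonNeumannAlgebra H)
    (τ : ℝ → (H →L[ℂ] H) ≃⋆ₐ[ℂ] (H →L[ℂ] H)) (ω : (H →L[ℂ] H) →ₗ[ℂ] ℂ) : Prop where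
  dynamics_mem : ∀ t, ∀ A ∈ M, τ t A ∈ M
  dynamics_zero : ∀ A ∈ M, τ 0 A = A
  dynamics_add : ∀ s t, ∀ A ∈ M, τ (s + t) A = τ s (τ t A)
  state_one : ω 1 = 1
  state_nonneg : ∀ A ∈ M, 0 ≤ ω (star A * A)
  kms : ∀ A ∈ M, ∀ B ∈ M, ∃ F : ℂ → ℂ,
    DifferentiableOn ℂ F {z | 0 < z.im ∧ z.im < β} ∧
    ContinuousOn F {z | 0 ≤ z.im ∧ z.im ≤ β} ∧
    ∀ t : ℝ, F t = ω (A * τ t B) ∧ F (t + Complex.I * β) = ω (τ t B * A)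

/-- The tube `{z ∈ ℂⁿ | Im z₁ < Im z₂ < ⋯ < Im zₙ, Im zₙ - Im z₁ < β}`. -/
def tube (β : ℝ) (n : ℕ) : Set (Fin n → ℂ) :=
  {z | ∀ i j, i < j → (z i).im < (z j).im ∧ (z j).im - (z i).im < β}

/-- `G` is the analytic continuation of the Green's function
`(t₁, …, tₙ) ↦ ω(τ_{t₁}(A₁) ⋯ τ_{tₙ}(Aₙ))`: it is holomorphic in the tube, continuous on the closed
tube, and has the Green's function as its restriction to `ℝⁿ` (these properties determine `G` on
the closed tube). -/
structure IsGreenContinuation (β : ℝ) (τ : ℝ → (H →L[ℂ] H) ≃⋆ₐ[ℂ] (H →L[ℂ] H))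
    (ω : (H →L[ℂ] H) →ₗ[ℂ] ℂ) {n : ℕ} (A : Fin n → (H →L[ℂ] H)) (G : (Fin n → ℂ) → ℂ) : Prop where
  holomorphic : DifferentiableOn ℂ G (tube β n)
  continuousOn : ContinuousOn G (closure (tube β n))
  boundary : ∀ t : Fin n → ℝ,
    G (fun i => (t i : ℂ)) = ω (List.ofFn fun i => τ (t i) (A i)).prod

/-- Stochastic positivity (in the `W*`-sense) of a KMS system `(M, τ, ω)` with respect to an abelian
von Neumann subalgebra `U`. -/
structure IsStochasticallyPositive (β : ℝ) (M U : VonNeumannAlgebra H)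
    (τ : ℝ → (H →L[ℂ] H) ≃⋆ₐ[ℂ] (H →L[ℂ] H)) (ω : (H →L[ℂ] H) →ₗ[ℂ] ℂ) : Prop where
  isKMSSystem : IsKMSSystem β M τ ω
  le : U ≤ M
  abelian : ∀ A ∈ U, ∀ B ∈ U, A * B = B * A
  generates : vonNeumannGenerated (⋃ t, τ t '' (U : Set (H →L[ℂ] H))) = M
  /-- The Euclidean Green's functions `(s₁, …, sₙ) ↦ G(is₁, …, isₙ)` of positive elements of `U`
  exist and are positive whenever `s₁ ≤ ⋯ ≤ sₙ` and `sₙ - s₁ ≤ β`. -/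
  positive : ∀ (n : ℕ) (A : Fin n → (H →L[ℂ] H)), (∀ i, A i ∈ U ∧ 0 ≤ A i) →
    ∃ G : (Fin n → ℂ) → ℂ, IsGreenContinuation β τ ω A G ∧
      ∀ s : Fin n → ℝ, Monotone s → (∀ i j, s j - s i ≤ β) →
        0 ≤ G (fun i => Complex.I * (s i : ℂ))

end Generalities

section QuasiFreeSystem

variable {X : Type*} [NormedAddCommGroup X] [InnerProductSpace ℂ X] [CompleteSpace X]

/-- The antiunitary operator `κ` commutes with the (unbounded) operator `a`: it maps the domain of
`a` to itself and `a κ x = κ a x` there. -/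
def CommutesWith (a : X →ₗ.[ℂ] X) (κ : X ≃ₗᵢ⋆[ℂ] X) : Prop :=
  ∀ x : a.domain, ∃ hx : κ x ∈ a.domain, a ⟨κ x, hx⟩ = κ (a x)

variable {a : X →ₗ.[ℂ] X} {m β : ℝ} (h : IsSelfAdjointGE a m) (hβ : 0 < β)

/-- The Hilbert space of the quasi-free state `ω(W(x)) = exp(-¼ (x, (1 + 2ρ) x))`,
`ρ = (e^{βa} - 1)⁻¹`. -/
abbrev ThermalSpace : Type _ := FieldSpace (h.rho_nonneg hβ)

theorem exists_liouvilleUnitary (t : ℝ) :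
    ∃ V : unitary (ThermalSpace h hβ →L[ℂ] ThermalSpace h hβ),
      ∀ x, (V : ThermalSpace h hβ →L[ℂ] ThermalSpace h hβ) (coherentVec (h.rho_nonneg hβ) x)
        = coherentVec (h.rho_nonneg hβ) (h.expI t x) := by
  have h1 : ∀ s x, h.expI s (h.expI (-s) x) = x := fun s x => by
    have := congrArg (fun A : X →L[ℂ] X => A x) (h.expI_add s (-s))
    rw [add_neg_cancel, h.expI_zero] at this
    exact this.symm
  have h2 : ∀ s x, h.expI (-s) (h.expI s x) = x := fun s x => by
    simpa using h1 (-s) x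
  obtain ⟨V, hV⟩ := exists_kernelUnitary (weylKernel_posSemidef (h.rho_nonneg hβ))
    ⟨h.expI t, h.expI (-t), h2 t, h1 t⟩ (fun _ => 1) (fun _ => one_ne_zero) (fun x y => by
      simp only [weylKernel, weylFunctional, Matrix.of_apply, Equiv.coe_fn_mk, star_one, one_mul,
        mul_one, h.inner_expI, ← map_sub, h.rho_expI, ← map_smul, ← map_add])
  exact ⟨V, fun x => (hV x).trans (one_smul _ _)⟩

/-- The unitary `e^{itL}` on the GNS space, `e^{itL} W_ω(x) Ω = W_ω(e^{ita} x) Ω`. -/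
noncomputable def liouvilleUnitary (t : ℝ) :
    unitary (ThermalSpace h hβ →L[ℂ] ThermalSpace h hβ) :=
  (exists_liouvilleUnitary h hβ t).choose

/-- The quasi-free dynamics `τ_t(A) = e^{itL} A e^{-itL}`. -/
noncomputable def dynamics (t : ℝ) :
    (ThermalSpace h hβ →L[ℂ] ThermalSpace h hβ) ≃⋆ₐ[ℂ]
      (ThermalSpace h hβ →L[ℂ] ThermalSpace h hβ) :=
  Unitary.conjStarAlgAut ℂ _ (liouvilleUnitary h hβ t)

/-- The dynamics acts on Weyl operators by `τ_t(W_ω(x)) = W_ω(e^{ita} x)`. -/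
theorem dynamics_weyl (t : ℝ) (x : X) :
    dynamics h hβ t (weyl (h.rho_nonneg hβ) x) = weyl (h.rho_nonneg hβ) (h.expI t x) := by
  have hV := (exists_liouvilleUnitary h hβ t).choose_spec
  have hc : (liouvilleUnitary h hβ t : ThermalSpace h hβ →L[ℂ] ThermalSpace h hβ)
      * weyl (h.rho_nonneg hβ) x =
      weyl (h.rho_nonneg hβ) (h.expI t x) * liouvilleUnitary h hβ t := by
    refine kernelSpace_ext _ fun y => ?_
    simp only [mul_apply_eq_comp]
    rw [weyl_coherentVec, map_smul, liouvilleUnitary, hV, hV, weyl_coherentVec, map_add,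
      h.inner_expI]
  rw [dynamics, Unitary.conjStarAlgAut_apply, hc, mul_assoc]
  simp

/-- The quasi-free state `A ↦ (Ω, A Ω)`. -/
noncomputable def thermalState :
    (ThermalSpace h hβ →L[ℂ] ThermalSpace h hβ) →ₗ[ℂ] ℂ :=
  vectorFunctional (vacuum (h.rho_nonneg hβ))

/-- The field algebra `𝒲`: the von Neumann algebra generated by all `W_ω(x)`. -/
noncomputable def fieldAlgebra : VonNeumannAlgebra (ThermalSpace h hβ) :=
  vonNeumannGenerated (Set.range (weyl (h.rho_nonneg hβ)))

/-- The algebra `𝒲_κ`: the von Neumann algebra generated by the `W_ω(x)` with `κ x = x`. -/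
noncomputable def fieldAlgebraFixed (κ : X ≃ₗᵢ⋆[ℂ] X) : VonNeumannAlgebra (ThermalSpace h hβ) :=
  vonNeumannGenerated (weyl (h.rho_nonneg hβ) '' {x | κ x = x})

end QuasiFreeSystem
end QuasiFree

/-! The Weyl operators W_ω(a⁻¹u) have explicit Gaussian correlations, and everything is transported
from them to the von Neumann algebras by density.

Correlations. With the covariance (x,(1+ρ)y)+(y,ρx), the expectation of a product of Weyl operators
is the exponential of a sum of two-point functions over pairs i ≤ j (`inner_vacuum_weyl_prod`).
Since e^{-βa}(1+ρ) = ρ, each two-point function continues to the strip 0 ≤ Im ζ ≤ β, and the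
reflection ζ ↦ iβ - ζ exchanges its two arguments (`IsSelfAdjointGE.twoPoint_swap`): this is the KMS
condition at the one-particle level. So the Green's function continues to the closed tube, and over
the vertices (0,…,0,β,…,β) of its base it equals real-time correlations in cyclically permuted order
(`greenWeyl_eq_of_timeVertex`). The smoothing a⁻¹ makes it complex differentiable up to the
boundary.

Density. By the three lines theorem, a bounded function that is holomorphic up to the boundary of
the tube is controlled by its values over the vertices (`norm_le_of_timeVertex`). Hence bounded
correlations that converge locally uniformly in real time, in all cyclic orders, force convergence
on the whole closed tube, with a limit holomorphic inside and continuous up to the boundary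
(`exists_tendsto_of_timeVertex`). For the KMS condition, approximation of AΩ and A*Ω is enough. For
n-point functions, positive elements of 𝒲_κ are strong limits of bounded nets of squares C*C
(`exists_tendsto_star_mul_self`), a commutative form of Kaplansky's density theorem.

Positivity. At imaginary times and on κ-fixed vectors the covariance is that of a harmonic
oscillator on a circle of length β, and equals ∑ ‖R_k u‖² with R_k linear
(`IsSelfAdjointGE.exists_gram`). For squares Cᵢ*Cᵢ the Euclidean Green's function is then a
quadratic form of the Gaussian kernel exp(-¼ ∑ ‖R_k(u_q - u_p)‖²), which is positive semidefinite
(`posSemidef_gaussian`). Pointwise limits keep the sign.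

Generation. Differentiating e^{ita} at t = 0 on κ-fixed vectors produces i X_κ, so the closed
additive span of the orbits of X_κ is all of X (`mem_of_isClosed_addSubgroup`). -/

namespace QuasiFree

/-! ### Geometry of the tube and the maximum principle over the vertices of its base -/

section Tube

open Filter Topology

/-- The closed tube, described by the non-strict inequalities. -/
def closedTube (β : ℝ) (n : ℕ) : Set (Fin n → ℂ) :=
  {z | ∀ i j, i ≤ j → (z i).im ≤ (z j).im ∧ (z j).im - (z i).im ≤ β}

theorem closure_tube_subset {β : ℝ} (hβ : 0 ≤ β) (n : ℕ) :
    closure (tube β n) ⊆ closedTube β n := by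
  refine closure_minimal (fun z hz i j hij => ?_) ?_
  · rcases hij.eq_or_lt with rfl | hij
    · simpa using hβ
    · exact ⟨(hz i j hij).1.le, (hz i j hij).2.le⟩
  · simp only [closedTube, Set.ofPred_forall]
    refine isClosed_iInter fun i => isClosed_iInter fun j => isClosed_iInter fun _ => ?_
    have hc : ∀ k, Continuous fun z : Fin n → ℂ => (z k).im := fun k =>
      Complex.continuous_im.comp (continuous_apply k)
    exact (isClosed_le (hc i) (hc j)).inter (isClosed_le ((hc j).sub (hc i)) continuous_const)

theorem isOpen_tube (β : ℝ) (n : ℕ) : IsOpen (tube β n) := by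
  simp only [tube, Set.ofPred_forall]
  refine isOpen_iInter_of_finite fun i => isOpen_iInter_of_finite fun j =>
    isOpen_iInter_of_finite fun _ => ?_
  have hc : ∀ k, Continuous fun z : Fin n → ℂ => (z k).im := fun k =>
    Complex.continuous_im.comp (continuous_apply k)
  exact (isOpen_lt (hc i) (hc j)).inter (isOpen_lt ((hc j).sub (hc i)) continuous_const)

/-- The imaginary parts `0 ≤ s₁ ≤ ⋯ ≤ sₙ ≤ β` of the closed tube, normalized by a translation. -/
def timeSimplex (β : ℝ) (n : ℕ) : Set (Fin n → ℝ) :=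
  {s | Monotone s ∧ ∀ i, 0 ≤ s i ∧ s i ≤ β}

/-- The vertices `(0, …, 0, β, …, β)` of `timeSimplex`. -/
def timeVertex (β : ℝ) (n k : ℕ) : Fin n → ℝ := fun i => if i.val < k then 0 else β

theorem timeVertex_mem {β : ℝ} (hβ : 0 ≤ β) (n k : ℕ) : timeVertex β n k ∈ timeSimplex β n := by
  refine ⟨fun i j hij => ?_, fun i => ?_⟩
  · have : i.val ≤ j.val := hij
    unfold timeVertex
    split_ifs <;> first | exact le_rfl | exact hβ | omega
  · unfold timeVertex
    split_ifs <;> simp [hβ]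

theorem convex_timeSimplex (β : ℝ) (n : ℕ) : Convex ℝ (timeSimplex β n) := by
  rintro p ⟨hp, hp'⟩ q ⟨hq, hq'⟩ x y hx hy hxy
  refine ⟨(hp.const_mul hx).add (hq.const_mul hy), fun i => ?_⟩
  simp only [Pi.add_apply, Pi.smul_apply, smul_eq_mul]
  have := hp' i
  have := hq' i
  have hy' : y = 1 - x := by linarith
  constructor <;> nlinarith

theorem mem_closedTube_of_timeSimplex {β : ℝ} {n : ℕ} {z : Fin n → ℂ}
    (hz : (fun i => (z i).im) ∈ timeSimplex β n) : z ∈ closedTube β n := fun i j hij =>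
  ⟨hz.1 hij, by have := hz.2 i; have := hz.2 j; simp only at *; linarith⟩

/-- An ordered tuple is a convex combination of the vertices, the weight of the k-th vertex being
the k-th gap of 0 ≤ s₁ ≤ ⋯ ≤ sₙ ≤ β divided by β. Coordinate i is met by the vertices with k ≤ i,
and their gaps telescope to its value. -/
theorem timeSimplex_subset {β : ℝ} (hβ : 0 < β) {n : ℕ} {S : Set (Fin n → ℝ)} (hS : Convex ℝ S)
    (hv : ∀ k ≤ n, timeVertex β n k ∈ S) : timeSimplex β n ⊆ S := by
  rintro s ⟨hs, hs'⟩
  -- The padded sequence 0, s₁, …, sₙ, β; because of the leading 0, position k + 1 holds the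
  -- zero-based entry k of s.
  let e : ℕ → ℝ := fun k => if k = 0 then 0 else if h : k - 1 < n then s ⟨k - 1, h⟩ else β
  have he : ∀ k ∈ Finset.range (n + 1), 0 ≤ e (k + 1) - e k := fun k hk => by
    have hk' := Finset.mem_range.1 hk
    simp only [e, Nat.add_sub_cancel, Nat.add_one_ne_zero, if_false]
    split_ifs with h1 h2 h3
    · simpa using (hs' ⟨k, h1⟩).1
    · exact sub_nonneg.2 (hs (Fin.mk_le_mk.2 (Nat.sub_le _ _)))
    · omega
    · simpa using hβ.le
    · exact sub_nonneg.2 (hs' _).2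
    · simp
  have h1 : ∑ k ∈ Finset.range (n + 1), (e (k + 1) - e k) / β = 1 := by
    rw [← Finset.sum_div, Finset.sum_range_sub]
    simp [e, hβ.ne']
  have h2 := hS.sum_mem (t := Finset.range (n + 1)) (w := fun k => (e (k + 1) - e k) / β)
    (z := fun k => timeVertex β n k) (fun k hk => div_nonneg (he k hk) hβ.le) h1
    (fun k hk => hv k (Nat.lt_succ_iff.1 (Finset.mem_range.1 hk)))
  convert h2 using 1
  funext i
  have h3 : s i = e (i.val + 1) - e 0 := by simp [e]
  rw [h3, ← Finset.sum_range_sub, Finset.sum_apply]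
  have h4 : Finset.range (i.val + 1) = (Finset.range (n + 1)).filter (· ≤ i.val) := by
    ext k; have := i.2; simp; omega
  rw [h4, Finset.sum_filter]
  refine Finset.sum_congr rfl fun k _ => ?_
  simp only [timeVertex, Pi.smul_apply, smul_eq_mul]
  rcases le_or_gt k i.val with h | h
  · rw [if_pos h, if_neg (not_lt.2 h), div_mul_cancel₀ _ hβ.ne']
  · rw [if_neg (not_le.2 h), if_pos h, mul_zero]

/-- Maximum principle in the tube: a bounded function that is differentiable up to the boundary is
bounded by its supremum over the vertices of the base. -/
theorem norm_le_of_timeVertex {β : ℝ} (hβ : 0 < β) {n : ℕ} {G : (Fin n → ℂ) → ℂ}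
    (hG : DifferentiableOn ℂ G {z | (fun i => (z i).im) ∈ timeSimplex β n}) {M : ℝ}
    (hM : ∀ z, (fun i => (z i).im) ∈ timeSimplex β n → ‖G z‖ ≤ M) {C : ℝ}
    (hC : ∀ k ≤ n, ∀ z, (∀ i, (z i).im = timeVertex β n k i) → ‖G z‖ ≤ C)
    (z : Fin n → ℂ) (hz : (fun i => (z i).im) ∈ timeSimplex β n) : ‖G z‖ ≤ C := by
  let S : Set (Fin n → ℝ) :=
    {s | s ∈ timeSimplex β n ∧ ∀ z : Fin n → ℂ, (∀ i, (z i).im = s i) → ‖G z‖ ≤ C}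
  -- `S` consists of the imaginary parts over which the bound holds for every real part. It contains
  -- the vertices, so convexity suffices, and convexity is the three lines theorem along a segment.
  suffices hS : Convex ℝ S from
    (timeSimplex_subset hβ hS (fun k hk => ⟨timeVertex_mem hβ.le n k, hC k hk⟩) hz).2 z
      (fun i => rfl)
  rintro p ⟨hp, hp'⟩ q ⟨hq, hq'⟩ x y hx hy hxy
  refine ⟨convex_timeSimplex β n hp hq hx hy hxy, fun z hz => ?_⟩
  -- A complex line through z, reached at w = iy, with Im l(w) = p + Im w · (q - p): the strip 0 ≤
  -- Im w ≤ 1 lies over the segment from p to q and its two edges over the endpoints.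
  let l : ℂ → Fin n → ℂ := fun w i => z i + (w - y * Complex.I) * ((q i - p i : ℝ) : ℂ)
  have hl : ∀ w i, (l w i).im = p i + w.im * (q i - p i) := fun w i => by
    have h0 := hz i
    simp only [Pi.add_apply, Pi.smul_apply, smul_eq_mul] at h0
    have hx' : x = 1 - y := by linarith
    simp only [l, Complex.add_im, Complex.sub_im, Complex.mul_im,
      Complex.ofReal_re, Complex.I_im, Complex.ofReal_im, Complex.I_re, h0, hx']
    ring
  have hmem : ∀ w : ℂ, 0 ≤ w.im → w.im ≤ 1 → (fun i => (l w i).im) ∈ timeSimplex β n := by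
    intro w h0 h1
    have := convex_timeSimplex β n hp hq (sub_nonneg.2 h1) h0 (by ring)
    convert this using 1
    funext i
    rw [hl]; simp; ring
  have hd : DifferentiableOn ℂ (fun w => G (l w)) (Complex.im ⁻¹' Set.Icc 0 1) :=
    hG.comp (f := l) (fun w _ => by
      have : Differentiable ℂ l := by
        rw [differentiable_pi]; intro i; simp only [l]; fun_prop
      exact this.differentiableAt.differentiableWithinAt) (fun w hw => hmem w hw.1 hw.2)
  have hcl : closure (Complex.im ⁻¹' Set.Ioo 0 1) ⊆ Complex.im ⁻¹' Set.Icc (0 : ℝ) 1 :=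
    closure_minimal (Set.preimage_mono Set.Ioo_subset_Icc_self)
      (isClosed_Icc.preimage Complex.continuous_im)
  have hlz : l (y * Complex.I) = z := by funext i; simp [l]
  rw [← hlz]
  refine PhragmenLindelof.horizontal_strip (f := fun w => G (l w)) (a := 0) (b := 1)
    (hd.mono hcl).diffContOnCl ⟨0, by simp [Real.pi_pos], 0, ?_⟩ (fun w hw => hp' _ fun i => ?_)
    (fun w hw => hq' _ fun i => ?_) ?_ ?_
  · refine Asymptotics.IsBigO.of_bound M ?_
    filter_upwards [mem_inf_of_right (mem_principal_self _)] with w hw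
    simpa using hM _ (hmem w hw.1.le hw.2.le)
  · rw [hl, hw]; ring
  · rw [hl, hw]; ring
  · simpa using hy
  · simpa using (by linarith : y ≤ 1)

/-- Cauchy estimate for the Fréchet derivative. -/
theorem norm_fderiv_le_of_forall_mem_ball {E : Type*} [NormedAddCommGroup E] [NormedSpace ℂ E]
    {f : E → ℂ} {x : E} {r C : ℝ} (hr : 0 < r) (hf : DifferentiableOn ℂ f (Metric.ball x (2 * r)))
    (hC : ∀ y ∈ Metric.ball x (2 * r), ‖f y‖ ≤ C) : ‖fderiv ℂ f x‖ ≤ C / r := by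
  have hC0 : 0 ≤ C := (norm_nonneg _).trans (hC x (Metric.mem_ball_self (by positivity)))
  refine ContinuousLinearMap.opNorm_le_bound _ (by positivity) fun v => ?_
  rcases eq_or_ne v 0 with rfl | hv
  · simp
  have hv' : 0 < ‖v‖ := norm_pos_iff.2 hv
  -- The one-variable Cauchy estimate is applied on the complex line through x in direction v; the
  -- disc of radius R is mapped into the closed ball of radius r around x.
  set R : ℝ := r / ‖v‖ with hR
  have hR0 : 0 < R := by positivity
  let g : ℂ → ℂ := fun w => f (x + w • v)
  have hmem : ∀ w ∈ Metric.closedBall (0 : ℂ) R, x + w • v ∈ Metric.ball x (2 * r) := by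
    intro w hw
    rw [mem_closedBall_zero_iff] at hw
    rw [mem_ball_iff_norm, add_sub_cancel_left, norm_smul]
    calc ‖w‖ * ‖v‖ ≤ R * ‖v‖ := by gcongr
      _ = r := by rw [hR]; field_simp
      _ < 2 * r := by linarith
  have hg : DifferentiableOn ℂ g (Metric.closedBall 0 R) :=
    hf.comp (f := fun w : ℂ => x + w • v)
      ((differentiable_const _).add (differentiable_id.smul_const v)).differentiableOn hmem
  have h1 := Complex.norm_deriv_le_of_forall_mem_sphere_norm_le (f := g) (c := 0) (C := C) hR0
    (hg.mono Metric.closure_ball_subset_closedBall).diffContOnCl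
    (fun w hw => hC _ (hmem w (Metric.sphere_subset_closedBall hw)))
  have h2 : deriv g 0 = fderiv ℂ f x v := by
    have h3 : DifferentiableAt ℂ f (x + (0 : ℂ) • v) := by
      rw [zero_smul, add_zero]
      exact hf.differentiableAt (Metric.ball_mem_nhds _ (by positivity))
    have h4 : HasDerivAt (fun w : ℂ => x + w • v) v 0 := by
      simpa using ((hasDerivAt_id (0 : ℂ)).smul_const v).const_add x
    have := (h3.hasFDerivAt.comp_hasDerivAt (0 : ℂ) h4).deriv
    rw [zero_smul, add_zero] at this
    exact this
  rw [← h2]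
  refine h1.trans_eq ?_
  rw [hR]; field_simp

/-- A locally uniform limit of holomorphic functions of several variables is holomorphic. -/
theorem differentiableOn_of_locally_tendstoUniformlyOn {E ι : Type*} [NormedAddCommGroup E]
    [NormedSpace ℂ E] {l : Filter ι} [l.NeBot] {U : Set E} (hU : IsOpen U) {F : ι → E → ℂ}
    {f : E → ℂ} (hF : ∀ n, DifferentiableOn ℂ (F n) U)
    (hf : ∀ x ∈ U, ∃ t ∈ 𝓝 x, TendstoUniformlyOn F f l t) : DifferentiableOn ℂ f U := by
  intro x hx
  obtain ⟨t, ht, htu⟩ := hf x hx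
  obtain ⟨R, hR, hRt⟩ := Metric.mem_nhds_iff.1 (inter_mem ht (hU.mem_nhds hx))
  set r : ℝ := R / 4 with hr
  have hr0 : 0 < r := by positivity
  have hsub : ∀ y ∈ Metric.ball x (2 * r), Metric.ball y (2 * r) ⊆ t ∩ U := fun y hy =>
    (Metric.ball_subset_ball' (by rw [Metric.mem_ball] at hy; linarith)).trans hRt
  have hself : Metric.ball x (2 * r) ⊆ t ∩ U := hsub x (Metric.mem_ball_self (by positivity))
  have hcs := htu.uniformCauchySeqOn
  -- The Cauchy estimate applied to differences makes the derivatives uniformly Cauchy. With r = R /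
  -- 4, the ball of radius 2r around each point of the ball of radius 2r stays inside the region of
  -- uniform convergence.
  have hcs' : UniformCauchySeqOn (fun n => fderiv ℂ (F n)) l (Metric.ball x (2 * r)) := by
    intro u hu
    obtain ⟨ε, hε, hεu⟩ := Metric.mem_uniformity_dist.1 hu
    filter_upwards [hcs _ (Metric.dist_mem_uniformity (by positivity : 0 < ε * r / 2))]
      with n hn y hy
    refine hεu ?_
    have hd : ∀ k, DifferentiableOn ℂ (F k) (Metric.ball y (2 * r)) := fun k =>
      (hF k).mono ((hsub y hy).trans Set.inter_subset_right)
    have hd' : ∀ k, DifferentiableAt ℂ (F k) y := fun k =>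
      (hF k).differentiableAt (hU.mem_nhds (hself hy).2)
    have := norm_fderiv_le_of_forall_mem_ball hr0 ((hd n.1).sub (hd n.2))
      (C := ε * r / 2) fun w hw => by
        have := hn w (hsub y hy hw).1
        rw [dist_eq_norm] at this
        exact this.le
    rw [fderiv_sub (hd' _) (hd' _)] at this
    rw [dist_eq_norm]
    refine this.trans_lt ?_
    rw [div_lt_iff₀ hr0]
    nlinarith [mul_pos hε hr0]
  have hlim : ∀ y ∈ Metric.ball x (2 * r), ∃ L, Tendsto (fun n => fderiv ℂ (F n) y) l (𝓝 L) :=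
    fun y hy => CompleteSpace.complete (hcs'.cauchy_map hy)
  choose! g' hg' using hlim
  have := hasFDerivAt_of_tendstoUniformlyOn Metric.isOpen_ball
    (hcs'.tendstoUniformlyOn_of_tendsto hg')
    (fun n y hy => ((hF n).differentiableAt (hU.mem_nhds (hself hy).2)).hasFDerivAt)
    (fun y hy => htu.tendsto_at (hself hy).1) (Metric.mem_ball_self (by positivity))
  exact this.differentiableAt.differentiableWithinAt

end Tube

/-! ### Density theorems for the double commutant -/

section Density

open Filter Topology

variable {H : Type*} [NormedAddCommGroup H] [InnerProductSpace ℂ H] [CompleteSpace H]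

/-- The double commutant of a `*`-algebra lies in its strong closure. -/
theorem exists_mem_norm_sub_apply_lt {ι : Type*} [Fintype ι] (𝔄 : StarSubalgebra ℂ (H →L[ℂ] H))
    {A : H →L[ℂ] H} (hA : A ∈ Set.centralizer (Set.centralizer (𝔄 : Set (H →L[ℂ] H))))
    (v : ι → H) {ε : ℝ} (hε : 0 < ε) : ∃ B ∈ 𝔄, ∀ i, ‖(B - A) (v i)‖ < ε := by
  classical
  -- Von Neumann's amplification: several vectors become the single vector (vᵢ) of a direct sum of
  -- copies of H, on which operators act diagonally by `d`. The aim is that `d A` preserves the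
  -- closed cyclic subspace `M` of (vᵢ).
  let e := PiLp.continuousLinearEquiv 2 ℂ (fun _ : ι => H)
  let d : (H →L[ℂ] H) → (PiLp 2 (fun _ : ι => H) →L[ℂ] PiLp 2 (fun _ : ι => H)) := fun B =>
    (e.symm : (ι → H) →L[ℂ] _).comp
      ((ContinuousLinearMap.pi fun i => B.comp (ContinuousLinearMap.proj i)).comp
        (e : _ →L[ℂ] (ι → H)))
  have hd : ∀ B x i, d B x i = B (x i) := fun B x i => rfl
  let j : (H →L[ℂ] H) →ₗ[ℂ] PiLp 2 (fun _ : ι => H) :=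
    { toFun := fun B => WithLp.toLp 2 fun i => B (v i)
      map_add' := fun B C => rfl
      map_smul' := fun c B => rfl }
  have hj : ∀ B i, j B i = B (v i) := fun B i => rfl
  let M : Submodule ℂ (PiLp 2 (fun _ : ι => H)) :=
    (𝔄.toSubalgebra.toSubmodule.map j).topologicalClosure
  have hMcomplete : CompleteSpace M := (Submodule.isClosed_topologicalClosure _).completeSpace_coe
  have hdM : ∀ B ∈ 𝔄, ∀ x ∈ M, d B x ∈ M := fun B hB x hx => by
    refine map_mem_closure (d B).continuous hx ?_
    rintro _ ⟨C, hC, rfl⟩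
    exact ⟨B * C, 𝔄.mul_mem hB hC, rfl⟩
  have hinner : ∀ B x y, ⟪d (star B) x, y⟫_ℂ = ⟪x, d B y⟫_ℂ := fun B x y => by
    rw [PiLp.inner_apply, PiLp.inner_apply]
    refine Finset.sum_congr rfl fun i _ => ?_
    rw [hd, hd, ContinuousLinearMap.star_eq_adjoint, ContinuousLinearMap.adjoint_inner_left]
  have hcomm : ∀ B ∈ 𝔄, ∀ x, M.starProjection (d B x) = d B (M.starProjection x) := by
    intro B hB x
    refine Submodule.eq_starProjection_of_mem_of_inner_eq_zero
      (hdM B hB _ (Submodule.starProjection_apply_mem M x)) fun w hw => ?_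
    rw [← map_sub, ← inner_conj_symm, ← hinner, inner_conj_symm]
    exact Submodule.starProjection_inner_eq_zero _ _ (hdM _ (star_mem hB) _ hw)
  let s : ι → (H →L[ℂ] PiLp 2 (fun _ : ι => H)) := fun k =>
    (e.symm : (ι → H) →L[ℂ] _).comp (ContinuousLinearMap.single ℂ (fun _ : ι => H) k)
  have hs : ∀ B k y, s k (B y) = d B (s k y) := fun B k y => by
    ext i
    rw [hd]
    change (Pi.single k (B y) : ι → H) i = B ((Pi.single k y : ι → H) i)
    rcases eq_or_ne i k with rfl | h
    · simp
    · simp [h]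
  -- The matrix entries of the projection onto `M`. The projection commutes with every `d B`, so its
  -- entries lie in the commutant of 𝔄; hence A commutes with them and `d A` commutes with the
  -- projection.
  let E : ι → ι → (H →L[ℂ] H) := fun i k => (PiLp.proj 2 (fun _ : ι => H) i).comp
    ((M.starProjection).comp (s k))
  have hE : ∀ i k y, E i k y = M.starProjection (s k y) i := fun i k y => rfl
  have hEc : ∀ i k, E i k ∈ Set.centralizer (𝔄 : Set (H →L[ℂ] H)) := fun i k B hB => by
    ext y
    simp only [mul_apply_eq_comp]
    rw [hE, hE, hs, hcomm B hB, hd]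
  have hsum : ∀ x : PiLp 2 (fun _ : ι => H), x = ∑ k, s k (x k) := fun x => by
    apply e.injective
    rw [map_sum]
    change WithLp.ofLp x = ∑ k, Pi.single k (WithLp.ofLp x k)
    exact (Finset.univ_sum_single _).symm
  have hcA : ∀ x, M.starProjection (d A x) = d A (M.starProjection x) := fun x => by
    have h1 : ∀ x i, M.starProjection x i = ∑ k, E i k (x k) := fun x i => by
      conv_lhs => rw [hsum x, map_sum]
      simp only [hE]
      rw [WithLp.ofLp_sum, Finset.sum_apply]
    ext i
    rw [h1, hd, h1, map_sum]
    refine Finset.sum_congr rfl fun k _ => ?_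
    rw [hd]
    exact congrArg (fun B : H →L[ℂ] H => B (x k)) (hA (E i k) (hEc i k))
  have hv : j 1 ∈ M := subset_closure ⟨1, one_mem 𝔄, rfl⟩
  have hAv : j A ∈ M := by
    have h2 : d A (j 1) = j A := rfl
    rw [← h2, ← Submodule.starProjection_eq_self_iff, hcA, Submodule.starProjection_eq_self_iff.2 hv]
  obtain ⟨_, ⟨B, hB, rfl⟩, hBA⟩ := Metric.mem_closure_iff.1 hAv ε hε
  refine ⟨B, hB, fun i => ?_⟩
  rw [dist_comm, dist_eq_norm, ← map_sub] at hBA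
  exact (PiLp.norm_apply_le (j (B - A)) i).trans_lt hBA

/-- The double commutant of a `*`-algebra lies in its strong-`*` closure (for one vector). -/
theorem exists_mem_norm_sub_apply_lt_star (𝔄 : StarSubalgebra ℂ (H →L[ℂ] H))
    {A : H →L[ℂ] H} (hA : A ∈ Set.centralizer (Set.centralizer (𝔄 : Set (H →L[ℂ] H))))
    (Ω : H) {ε : ℝ} (hε : 0 < ε) :
    ∃ B ∈ 𝔄, ‖B Ω - A Ω‖ < ε ∧ ‖star B Ω - star A Ω‖ < ε := by
  -- The map B ↦ (BΩ, B*Ω) is only real linear, so the orthogonality argument takes place in the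
  -- underlying real Hilbert space.
  let _ : InnerProductSpace ℝ H := InnerProductSpace.rclikeToReal ℂ H
  let j : (H →L[ℂ] H) →ₗ[ℝ] WithLp 2 (H × H) :=
    { toFun := fun B => WithLp.toLp 2 (B Ω, star B Ω)
      map_add' := fun B C => by rw [star_add]; rfl
      map_smul' := fun c B => by
        simp only [star_smul, star_trivial]; rfl }
  let M : Submodule ℝ (WithLp 2 (H × H)) :=
    ((𝔄.toSubalgebra.toSubmodule.restrictScalars ℝ).map j)
  have hAM : j A ∈ M.topologicalClosure := by
    rw [← Submodule.orthogonal_orthogonal_eq_closure]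
    intro ζ hζ
    have h1 : ∀ B, ⟪ζ, j B⟫_ℝ = (⟪ζ.fst, B Ω⟫_ℂ + ⟪Ω, B ζ.snd⟫_ℂ).re := fun B => by
      rw [WithLp.prod_inner_apply]
      change (⟪ζ.fst, B Ω⟫_ℂ).re + (⟪ζ.snd, star B Ω⟫_ℂ).re = _
      rw [ContinuousLinearMap.star_eq_adjoint, ContinuousLinearMap.adjoint_inner_right,
        ← inner_conj_symm (B ζ.snd) Ω, Complex.conj_re, Complex.add_re]
    have h2 : ∀ B ∈ 𝔄, ⟪ζ, j B⟫_ℝ = 0 := fun B hB => by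
      rw [real_inner_comm]; exact hζ _ ⟨B, hB, rfl⟩
    by_contra hne
    have hne' : 0 < |⟪ζ, j A⟫_ℝ| := abs_pos.2 hne
    set K : ℝ := ‖ζ.fst‖ + ‖Ω‖ + 1 with hK
    have hK0 : 0 < K := by positivity
    -- Once the adjoint is moved to the other side, the functional given by ζ sees an operator only
    -- through its values at Ω and at ζ.snd, so strong approximation at these two vectors
    -- contradicts a nonzero value at A.
    obtain ⟨B, hB, hBA⟩ := exists_mem_norm_sub_apply_lt 𝔄 hA ![Ω, ζ.snd]
      (div_pos hne' hK0)
    have e0 := hBA 0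
    have e1 := hBA 1
    simp only [Matrix.cons_val_zero, Matrix.cons_val_one] at e0 e1
    have h3 : ⟪ζ, j A⟫_ℝ = -(⟪ζ.fst, (B - A) Ω⟫_ℂ + ⟪Ω, (B - A) ζ.snd⟫_ℂ).re := by
      rw [← h1, map_sub, inner_sub_right, h2 B hB]; ring
    have h4 : |⟪ζ, j A⟫_ℝ| ≤ ‖ζ.fst‖ * ‖(B - A) Ω‖ + ‖Ω‖ * ‖(B - A) ζ.snd‖ := by
      rw [h3, abs_neg]
      refine (Complex.abs_re_le_norm _).trans ((norm_add_le _ _).trans ?_)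
      exact add_le_add (norm_inner_le_norm _ _) (norm_inner_le_norm _ _)
    rw [lt_div_iff₀ hK0] at e0 e1
    have : K * |⟪ζ, j A⟫_ℝ| < K * |⟪ζ, j A⟫_ℝ| := by
      calc K * |⟪ζ, j A⟫_ℝ| ≤ ‖ζ.fst‖ * (‖(B - A) Ω‖ * K) + ‖Ω‖ * (‖(B - A) ζ.snd‖ * K) := by
            nlinarith
        _ ≤ ‖ζ.fst‖ * |⟪ζ, j A⟫_ℝ| + ‖Ω‖ * |⟪ζ, j A⟫_ℝ| := by gcongr
        _ < K * |⟪ζ, j A⟫_ℝ| := by rw [hK]; nlinarith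
    exact lt_irrefl _ this
  obtain ⟨_, ⟨B, hB, rfl⟩, hBA⟩ := Metric.mem_closure_iff.1 hAM ε hε
  rw [dist_comm, dist_eq_norm, ← map_sub] at hBA
  have hfst : ‖(j (B - A)).fst‖ ≤ ‖j (B - A)‖ := WithLp.norm_fst_le _ _
  have hsnd : ‖(j (B - A)).snd‖ ≤ ‖j (B - A)‖ := WithLp.norm_snd_le _ _
  refine ⟨B, hB, ?_, ?_⟩
  · exact lt_of_le_of_lt hfst hBA
  · have : (j (B - A)).snd = star B Ω - star A Ω := by
      change star (B - A) Ω = _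
      rw [star_sub]; rfl
    rw [← this]
    exact hsnd.trans_lt hBA

/-- If `𝔄` is commutative, selfadjoint elements of its double commutant are strong limits of bounded
nets of elements of `𝔄`. -/
theorem exists_mem_norm_le_norm_sub_apply_lt {ι : Type*} [Fintype ι]
    (𝔄 : StarSubalgebra ℂ (H →L[ℂ] H)) (hcomm : ∀ A ∈ 𝔄, ∀ B ∈ 𝔄, A * B = B * A)
    {C : H →L[ℂ] H} (hC : C ∈ Set.centralizer (Set.centralizer (𝔄 : Set (H →L[ℂ] H))))
    (hCsa : IsSelfAdjoint C) (hC1 : ‖C‖ ≤ 1) (v : ι → H) {ε : ℝ} (hε : 0 < ε) :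
    ∃ B ∈ 𝔄, ‖B‖ ≤ 2 ∧ ∀ i, ‖(B - C) (v i)‖ < ε := by
  -- Kaplansky's device: f(t) = 2t/(1+t²) is bounded by 1. Write C = f(D), approximate D strongly
  -- without any norm bound, and apply f to the approximants. Commutativity of the double commutant
  -- makes the difference of the values of f explicit.
  have hle : (𝔄 : Set (H →L[ℂ] H)) ⊆ Set.centralizer 𝔄 := fun A hA B hB => hcomm B hB A hA
  have hcc : ∀ A ∈ Set.centralizer (Set.centralizer (𝔄 : Set (H →L[ℂ] H))),
      ∀ B ∈ Set.centralizer (Set.centralizer (𝔄 : Set (H →L[ℂ] H))), Commute A B :=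
    fun A hA B hB => hB A (Set.centralizer_subset hle hA)
  have hsub : (𝔄 : Set (H →L[ℂ] H)) ⊆ Set.centralizer (Set.centralizer 𝔄) :=
    Set.subset_centralizer_centralizer
  have hspec : ∀ t ∈ spectrum ℝ C, |t| ≤ 1 := fun t ht =>
    (spectrum.norm_le_norm_mul_of_mem ht).trans
      (mul_le_one₀ hC1 (norm_nonneg _) ContinuousLinearMap.norm_id_le)
  -- `C = 2 D (1 + D²)⁻¹`
  let g : ℝ → ℝ := fun t => t / (1 + √(1 - t ^ 2))
  -- On [-1,1] the function g inverts t ↦ 2t/(1+t²). The real square root is 0 on negative numbers,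
  -- so the denominator is at least 1 everywhere.
  have hg : Continuous g := by
    refine continuous_id.div (by fun_prop) fun t => ?_
    positivity
  set D := cfc g C with hD
  have hDsa : IsSelfAdjoint D := IsSelfAdjoint.cfc
  have hDmem : D ∈ Set.centralizer (Set.centralizer (𝔄 : Set (H →L[ℂ] H))) := fun X hX =>
    (IsSelfAdjoint.commute_cfc hCsa (show Commute C X from (hC X hX).symm) g).symm.eq
  have hDC : C * (1 + D ^ 2) = 2 * D := by
    have e1 : C * (1 + D ^ 2) = cfc (fun t => t * (1 + g t ^ 2)) C := by
      rw [cfc_mul (fun t : ℝ => t) _ C (by fun_prop) (by fun_prop), cfc_id' ℝ C,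
        cfc_const_add 1 _ C (by fun_prop), cfc_pow g 2 C (by fun_prop), map_one]
    have e2 : 2 * D = cfc (fun t => 2 * g t) C := by
      rw [cfc_const_mul (2 : ℝ) g C (by fun_prop), two_smul, two_mul]
    rw [e1, e2]
    refine cfc_congr fun t ht => ?_
    have h0 : 0 ≤ 1 - t ^ 2 := by have := (sq_le_one_iff_abs_le_one t).2 (hspec t ht); linarith
    have h1 : √(1 - t ^ 2) ^ 2 = 1 - t ^ 2 := Real.sq_sqrt h0
    have h2 : 1 + √(1 - t ^ 2) ≠ 0 := by positivity
    simp only [g]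
    field_simp
    linear_combination t * h1
  -- the resolvent-type operators
  let r : ℝ → ℝ := fun t => (1 + t ^ 2)⁻¹
  have hr : Continuous r := by
    refine Continuous.inv₀ (by fun_prop) fun t => ?_
    positivity
  have hrr : ∀ E : H →L[ℂ] H, IsSelfAdjoint E → (1 + E ^ 2) * cfc r E = 1 := fun E hE => by
    have e1 : 1 + E ^ 2 = cfc (fun t : ℝ => 1 + t ^ 2) E := by
      rw [cfc_const_add 1 _ E (by fun_prop), cfc_pow_id E 2, map_one]
    rw [e1, ← cfc_mul _ _ E (by fun_prop) (by fun_prop)]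
    have : (fun t : ℝ => (1 + t ^ 2) * r t) = fun _ => 1 := by
      funext t; simp only [r]; rw [mul_inv_cancel₀ (by positivity)]
    rw [this, cfc_const_one ℝ E]
  have hrn : ∀ E : H →L[ℂ] H, ‖cfc r E‖ ≤ 1 := fun E => by
    refine norm_cfc_le zero_le_one fun t _ => ?_
    simp only [r, Real.norm_eq_abs]
    rw [abs_of_pos (by positivity)]
    exact inv_le_one_of_one_le₀ (by nlinarith [sq_nonneg t])
  have hEr : ∀ E : H →L[ℂ] H, IsSelfAdjoint E → E * cfc r E = cfc (fun t => t * r t) E :=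
    fun E hE => by
      rw [cfc_mul (fun t : ℝ => t) _ E (by fun_prop) (by fun_prop), cfc_id' ℝ E]
  have hErn : ∀ E : H →L[ℂ] H, IsSelfAdjoint E → ‖E * cfc r E‖ ≤ 1 / 2 := fun E hE => by
    rw [hEr E hE]
    refine norm_cfc_le (by norm_num) fun t _ => ?_
    simp only [r, Real.norm_eq_abs, abs_mul]
    rw [abs_inv, abs_of_pos (by positivity : 0 < 1 + t ^ 2), ← div_eq_mul_inv,
      div_le_iff₀ (by positivity)]
    nlinarith [sq_nonneg (|t| - 1), sq_abs t]
  have hCD : C = 2 * (D * cfc r D) := by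
    rw [← mul_assoc, ← hDC, mul_assoc, hrr D hDsa, mul_one]
  -- the approximation of `D`
  obtain ⟨B₀, hB₀, hB₀v⟩ := exists_mem_norm_sub_apply_lt 𝔄 hDmem v (show 0 < ε / 8 by positivity)
  set B₁ : H →L[ℂ] H := (2⁻¹ : ℂ) • (B₀ + star B₀) with hB₁
  have hB₁mem : B₁ ∈ 𝔄 := 𝔄.smul_mem (add_mem hB₀ (star_mem hB₀)) _
  have hB₁sa : IsSelfAdjoint B₁ := by
    rw [isSelfAdjoint_iff, hB₁, star_smul, star_add, star_star, add_comm]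
    simp
  -- B₀ - D is normal, because everything commutes, so B₀* approximates D at each vector as well as
  -- B₀ does, and passing to the selfadjoint part loses nothing.
  have hB₁v : ∀ i, ‖(B₁ - D) (v i)‖ < ε / 8 := fun i => by
    have hnorm : ‖star (B₀ - D) (v i)‖ = ‖(B₀ - D) (v i)‖ := by
      have hn : IsStarNormal (B₀ - D) := ⟨by
        rw [star_sub, hDsa.star_eq]
        have h1 := hcc _ (hsub hB₀) _ hDmem
        have h2 := hcc _ (hsub (star_mem hB₀)) _ hDmem
        have h3 := hcc _ (hsub (star_mem hB₀)) _ (hsub hB₀)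
        exact ((h3.sub_right h2).sub_left (h1.symm.sub_right (Commute.refl D)))⟩
      rw [ContinuousLinearMap.star_eq_adjoint]
      exact (ContinuousLinearMap.isStarNormal_iff_norm_eq_adjoint.1 hn (v i)).symm
    have e : (B₁ - D) (v i) = (2⁻¹ : ℂ) • ((B₀ - D) (v i) + star (B₀ - D) (v i)) := by
      rw [star_sub, hDsa.star_eq, hB₁]
      simp only [FunLike.coe_sub, Pi.sub_apply, FunLike.coe_smul, Pi.smul_apply, FunLike.coe_add,
        Pi.add_apply]
      module
    rw [e, norm_smul]
    have := norm_add_le ((B₀ - D) (v i)) (star (B₀ - D) (v i))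
    rw [hnorm] at this
    have h3 := hB₀v i
    rw [show ‖(2⁻¹ : ℂ)‖ = 2⁻¹ by simp]
    linarith
  set f₁ : H →L[ℂ] H := 2 * (B₁ * cfc r B₁) with hf₁
  have hRmem : ∀ E ∈ Set.centralizer (Set.centralizer (𝔄 : Set (H →L[ℂ] H))), IsSelfAdjoint E →
      cfc r E ∈ Set.centralizer (Set.centralizer (𝔄 : Set (H →L[ℂ] H))) := fun E hE hE' X hX =>
    (IsSelfAdjoint.commute_cfc hE' (show Commute E X from (hE X hX).symm) r).symm.eq
  -- With R = (1+D²)⁻¹ and R₁ = (1+B₁²)⁻¹ this is f(B₁) - f(D) = 2R₁R(1 - B₁D)(B₁ - D). The factor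
  -- in front of B₁ - D is bounded independently of B₁, since ‖R‖ ≤ 1 and ‖DR‖ ≤ 1/2 and likewise
  -- for B₁.
  have hdiff : f₁ - C =
      (2 * (cfc r B₁ * cfc r D) - 2 * ((B₁ * cfc r B₁) * (D * cfc r D))) * (B₁ - D) := by
    have c1 := hcc _ (hsub hB₁mem) _ hDmem
    have c2 := hcc _ (hsub hB₁mem) _ (hRmem _ hDmem hDsa)
    have c3 := hcc _ (hsub hB₁mem) _ (hRmem _ (hsub hB₁mem) hB₁sa)
    have c4 := hcc _ hDmem _ (hRmem _ hDmem hDsa)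
    have c5 := hcc _ hDmem _ (hRmem _ (hsub hB₁mem) hB₁sa)
    have c6 := hcc _ (hRmem _ hDmem hDsa) _ (hRmem _ (hsub hB₁mem) hB₁sa)
    have i1 := hrr _ hDsa
    have i2 := hrr _ hB₁sa
    rw [hf₁, hCD]
    generalize cfc r D = R at *
    generalize cfc r B₁ = R₁ at *
    have e1 : B₁ * R₁ = B₁ * R₁ * ((1 + D ^ 2) * R) := by rw [i1, mul_one]
    have e2 : D * R = D * R * ((1 + B₁ ^ 2) * R₁) := by rw [i2, mul_one]
    have assoc : ∀ {x y : H →L[ℂ] H}, Commute x y → ∀ z, y * (x * z) = x * (y * z) :=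
      fun h z => by rw [← mul_assoc, ← h.eq, mul_assoc]
    calc 2 * (B₁ * R₁) - 2 * (D * R)
        = 2 * (B₁ * R₁ * ((1 + D ^ 2) * R)) - 2 * (D * R * ((1 + B₁ ^ 2) * R₁)) := by
          rw [← e1, ← e2]
      _ = _ := by
        simp only [pow_two, mul_add, add_mul, mul_sub, sub_mul, one_mul, mul_assoc,
          two_mul, c2.eq.symm, c4.eq.symm, c6.eq, assoc c1,
          assoc c2, assoc c3, assoc c5.symm]
        abel
  have hdn : ∀ i, ‖(f₁ - C) (v i)‖ < ε / 2 := fun i => by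
    rw [hdiff, mul_apply_eq_comp]
    refine (ContinuousLinearMap.le_opNorm _ _).trans_lt ?_
    have h2 : ∀ E : H →L[ℂ] H, ‖2 * E‖ ≤ 2 * ‖E‖ := fun E => by
      rw [two_mul, two_mul]; exact norm_add_le _ _
    have : ‖2 * (cfc r B₁ * cfc r D) - 2 * ((B₁ * cfc r B₁) * (D * cfc r D))‖ ≤ 4 := by
      refine (norm_sub_le _ _).trans ?_
      have a1 := h2 (cfc r B₁ * cfc r D)
      have a2 := h2 ((B₁ * cfc r B₁) * (D * cfc r D))
      have a3 : ‖cfc r B₁ * cfc r D‖ ≤ 1 * 1 := norm_mul_le_of_le (hrn _) (hrn _)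
      have a4 : ‖(B₁ * cfc r B₁) * (D * cfc r D)‖ ≤ 1 / 2 * (1 / 2) :=
        norm_mul_le_of_le (hErn _ hB₁sa) (hErn _ hDsa)
      linarith
    have h3 := hB₁v i
    have := mul_le_mul this h3.le (norm_nonneg _) (by norm_num)
    nlinarith [norm_nonneg ((B₁ - D) (v i))]
  have hf₁n : ‖f₁‖ ≤ 1 := by
    rw [hf₁, two_mul]
    have := hErn _ hB₁sa
    exact (norm_add_le _ _).trans (by linarith)
  -- The functional calculus leaves 𝔄 but stays in its norm closure. The final norm approximation
  -- within distance 1 is what turns the bound 1 into 2.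
  have hf₁mem : f₁ ∈ 𝔄.topologicalClosure := by
    have h0 : B₁ ∈ 𝔄.topologicalClosure := subset_closure hB₁mem
    have h1 : cfc r B₁ ∈ 𝔄.topologicalClosure := by
      rw [cfc_real_eq_complex r]
      exact StarAlgebra.elemental.le_of_mem 𝔄.isClosed_topologicalClosure h0
        (cfc_mem_elemental _ B₁)
    rw [hf₁, two_mul]
    exact add_mem (mul_mem h0 h1) (mul_mem h0 h1)
  set K : ℝ := 1 + ∑ i, ‖v i‖ with hK
  have hK0 : 0 < K := by positivity
  obtain ⟨B, hB, hBf⟩ := Metric.mem_closure_iff.1 hf₁mem (min 1 (ε / (2 * K))) (by positivity)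
  rw [dist_comm, dist_eq_norm] at hBf
  refine ⟨B, hB, ?_, fun i => ?_⟩
  · have := norm_sub_norm_le B f₁
    have := hBf.le.trans (min_le_left _ _)
    linarith
  · have e : (B - C) (v i) = (B - f₁) (v i) + (f₁ - C) (v i) := by
      rw [← add_apply, sub_add_sub_cancel]
    rw [e]
    refine (norm_add_le _ _).trans_lt ?_
    have h1 : ‖(B - f₁) (v i)‖ ≤ ε / (2 * K) * K :=
      (ContinuousLinearMap.le_opNorm _ _).trans (mul_le_mul (hBf.le.trans (min_le_right _ _))
        (by
          have := Finset.single_le_sum (f := fun i => ‖v i‖) (fun i _ => norm_nonneg _)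
            (Finset.mem_univ i)
          linarith) (norm_nonneg _) (by positivity))
    have h2 : ε / (2 * K) * K = ε / 2 := by field_simp
    have := hdn i
    linarith

end Density

/-! ### Functional calculus of a⁻¹ at complex times -/

section Spectral

open Filter Topology

/-- A second-order Taylor remainder uniform on the closed left half-plane, where the exponential is
bounded by 1. For ‖v - u‖ > 1 the three terms are bounded separately, whence the constant 3. -/
theorem norm_exp_sub_exp_sub_le {u v : ℂ} (hu : u.re ≤ 0) (hv : v.re ≤ 0) :
    ‖Complex.exp v - Complex.exp u - (v - u) * Complex.exp u‖ ≤ 3 * ‖v - u‖ ^ 2 := by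
  have h1 : ∀ w : ℂ, w.re ≤ 0 → ‖Complex.exp w‖ ≤ 1 := fun w hw => by
    rw [Complex.norm_exp]; exact Real.exp_le_one_iff.2 hw
  rcases le_or_gt ‖v - u‖ 1 with h | h
  · have e : Complex.exp v - Complex.exp u - (v - u) * Complex.exp u
        = Complex.exp u * (Complex.exp (v - u) - 1 - (v - u)) := by
      rw [Complex.exp_sub]; field_simp
    rw [e, norm_mul]
    have := Complex.norm_exp_sub_one_sub_id_le h
    nlinarith [h1 u hu, norm_nonneg (Complex.exp u), sq_nonneg ‖v - u‖,
      norm_nonneg (Complex.exp (v - u) - 1 - (v - u))]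
  · have a1 := norm_sub_le (Complex.exp v - Complex.exp u) ((v - u) * Complex.exp u)
    have a2 := norm_sub_le (Complex.exp v) (Complex.exp u)
    rw [norm_mul] at a1
    nlinarith [h1 u hu, h1 v hv, norm_nonneg (Complex.exp u), norm_nonneg (v - u)]

/-- Functions of a become functions of l = 1/a, singular at l = 0, which belongs to the spectrum of
a⁻¹ when a is unbounded. One factor l makes a bounded singularity continuous there. -/
theorem continuousOn_id_mul_of_bdd {𝕜 : Type*} [NormedField 𝕜] {s : Set 𝕜} {f : 𝕜 → 𝕜} {M : ℝ}
    (hM : ∀ z ∈ s, ‖f z‖ ≤ M)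
    (hf : ∀ z ∈ s, z ≠ 0 → ContinuousWithinAt f s z) : ContinuousOn (fun z => z * f z) s := by
  intro z hz
  rcases eq_or_ne z 0 with rfl | h0
  · rw [ContinuousWithinAt, zero_mul]
    refine squeeze_zero_norm' (a := fun w => ‖w‖ * M) ?_ ?_
    · filter_upwards [self_mem_nhdsWithin] with w hw
      rw [norm_mul]
      exact mul_le_mul_of_nonneg_left (hM w hw) (norm_nonneg _)
    · have : Continuous fun w : 𝕜 => ‖w‖ * M := by fun_prop
      have := this.tendsto 0
      rw [norm_zero, zero_mul] at this
      exact this.mono_left nhdsWithin_le_nhds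
  · exact continuousWithinAt_id.mul (hf z hz h0)

theorem continuous_apply_of_denseRange {P E F ι : Type*} [TopologicalSpace P]
    [SeminormedAddCommGroup E] [SeminormedAddCommGroup F] {f : P → E → F} {e : ι → E}
    (he : DenseRange e) (hf : ∀ p x y, ‖f p x - f p y‖ ≤ ‖x - y‖)
    (hc : ∀ i, Continuous fun p => f p (e i)) (x : E) : Continuous fun p => f p x := by
  refine continuous_of_uniform_approx_of_continuous fun u hu => ?_
  obtain ⟨ε, hε, hεu⟩ := Metric.mem_uniformity_dist.1 hu
  obtain ⟨i, hi⟩ := he.exists_dist_lt x hε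
  refine ⟨_, hc i, fun p => hεu ?_⟩
  rw [dist_eq_norm] at hi ⊢
  exact (hf p _ _).trans_lt hi

variable {X : Type*} [NormedAddCommGroup X] [InnerProductSpace ℂ X] [CompleteSpace X]
variable {a : X →ₗ.[ℂ] X} {m : ℝ}

theorem IsSelfAdjointGE.mem_spectrum_inv (h : IsSelfAdjointGE a m) {z : ℂ}
    (hz : z ∈ spectrum ℂ h.inv) : ∃ l : ℝ, z = l ∧ 0 ≤ l ∧ l ≤ ‖h.inv‖ := by
  obtain ⟨hr, hi⟩ := Complex.nonneg_iff.1 (h.spectrum_inv hz)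
  have hz' : z = (z.re : ℂ) := Complex.ext rfl (by simp [← hi])
  refine ⟨z.re, hz', hr, (Complex.re_le_norm z).trans ?_⟩
  exact (spectrum.norm_le_norm_mul_of_mem hz).trans
    (mul_le_of_le_one_right (norm_nonneg _) ContinuousLinearMap.norm_id_le)

/-- The factor `(1 - e^{-β/l})⁻¹ = 1 + (e^{β/l} - 1)⁻¹`. -/
noncomputable def boseFactor (β : ℝ) (z : ℂ) : ℂ := (1 - Complex.exp (-β / z))⁻¹

theorem boseFactor_ofReal (β l : ℝ) :
    boseFactor β l = (((1 - Real.exp (-β / l))⁻¹ : ℝ) : ℂ) := by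
  simp [boseFactor]

theorem one_sub_exp_pos {β l : ℝ} (hβ : 0 < β) (hl : 0 < l) : 0 < 1 - Real.exp (-β / l) := by
  have : Real.exp (-β / l) < 1 := Real.exp_lt_one_iff.2 (div_neg_of_neg_of_pos (neg_lt_zero.2 hβ) hl)
  linarith

/-- With x = β/l this is e^{-x}(1+x) ≤ 1; at l = 0 the junk value is 0. Since a ≥ m > 0, l is
bounded on the spectrum of a⁻¹ and so is the Bose factor. -/
theorem norm_boseFactor_le {β l : ℝ} (hβ : 0 < β) (hl : 0 ≤ l) :
    ‖boseFactor β l‖ ≤ 1 + l / β := by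
  rcases hl.eq_or_lt with rfl | hl
  · simp [boseFactor]
  have h0 := one_sub_exp_pos hβ hl
  rw [boseFactor_ofReal, Complex.norm_real, Real.norm_of_nonneg (inv_nonneg.2 h0.le),
    inv_le_iff_one_le_mul₀ h0]
  have h1 : β / l + 1 ≤ Real.exp (β / l) := Real.add_one_le_exp _
  have h2 : Real.exp (-β / l) * Real.exp (β / l) = 1 := by
    rw [← Real.exp_add, neg_div, neg_add_cancel, Real.exp_zero]
  have h3 : 0 < Real.exp (-β / l) := Real.exp_pos _
  have h4 : Real.exp (-β / l) * (β / l + 1) ≤ 1 := by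
    exact (mul_le_mul_of_nonneg_left h1 h3.le).trans_eq h2
  have h7 : l / β * (Real.exp (-β / l) * (β / l + 1)) ≤ l / β * 1 :=
    mul_le_mul_of_nonneg_left h4 (by positivity)
  have h8 : l / β * (Real.exp (-β / l) * (β / l + 1)) = Real.exp (-β / l) * (1 + l / β) := by
    field_simp
  linarith

theorem continuousAt_boseFactor {β l : ℝ} (hβ : 0 < β) (hl : 0 < l) :
    ContinuousAt (boseFactor β) l := by
  have h1 : (1 : ℂ) - Complex.exp (-β / l) ≠ 0 := by
    have := one_sub_exp_pos hβ hl
    exact_mod_cast this.ne'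
  have h2 : (l : ℂ) ≠ 0 := by exact_mod_cast hl.ne'
  unfold boseFactor
  fun_prop (disch := assumption)

theorem re_I_mul_div_nonpos {ζ : ℂ} (hζ : 0 ≤ ζ.im) {l : ℝ} (hl : 0 ≤ l) :
    (Complex.I * ζ / l).re ≤ 0 := by
  rw [Complex.div_ofReal_re]
  simp only [Complex.mul_re, Complex.I_re, Complex.I_im, zero_mul, one_mul, zero_sub]
  exact div_nonpos_of_nonpos_of_nonneg (neg_nonpos.2 hζ) hl

theorem norm_exp_I_mul_div_le {ζ : ℂ} (hζ : 0 ≤ ζ.im) {l : ℝ} (hl : 0 ≤ l) :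
    ‖Complex.exp (Complex.I * ζ / l)‖ ≤ 1 := by
  rw [Complex.norm_exp]
  exact Real.exp_le_one_iff.2 (re_I_mul_div_nonpos hζ hl)

/-- The bounded operator `a⁻² e^{iζa} (1 - e^{-βa})⁻¹`, for `ζ` in the closed upper half-plane. -/
noncomputable def IsSelfAdjointGE.thermalOp (h : IsSelfAdjointGE a m) (β : ℝ) (ζ : ℂ) :
    X →L[ℂ] X :=
  cfc (fun z : ℂ => z * (z * (Complex.exp (Complex.I * ζ / z) * boseFactor β z))) h.inv

/-- The bounded operator `i a⁻¹ e^{iζa} (1 - e^{-βa})⁻¹`, the derivative of `thermalOp`. -/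
noncomputable def IsSelfAdjointGE.thermalOpDeriv (h : IsSelfAdjointGE a m) (β : ℝ) (ζ : ℂ) :
    X →L[ℂ] X :=
  cfc (fun z : ℂ => z * (Complex.I * (Complex.exp (Complex.I * ζ / z) * boseFactor β z))) h.inv

variable (h : IsSelfAdjointGE a m) {β : ℝ}

theorem IsSelfAdjointGE.norm_exp_mul_boseFactor_le (hβ : 0 < β) {ζ : ℂ} (hζ : 0 ≤ ζ.im) {z : ℂ}
    (hz : z ∈ spectrum ℂ h.inv) :
    ‖Complex.exp (Complex.I * ζ / z) * boseFactor β z‖ ≤ 1 + ‖h.inv‖ / β := by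
  obtain ⟨l, rfl, hl, hl'⟩ := h.mem_spectrum_inv hz
  rw [norm_mul]
  refine (mul_le_of_le_one_left (norm_nonneg _) (norm_exp_I_mul_div_le hζ hl)).trans
    ((norm_boseFactor_le hβ hl).trans ?_)
  gcongr

theorem IsSelfAdjointGE.continuousWithinAt_exp_mul_boseFactor (hβ : 0 < β) (ζ : ℂ) {z : ℂ}
    (hz : z ∈ spectrum ℂ h.inv) (h0 : z ≠ 0) :
    ContinuousWithinAt (fun z => Complex.exp (Complex.I * ζ / z) * boseFactor β z)
      (spectrum ℂ h.inv) z := by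
  obtain ⟨l, rfl, hl, hl'⟩ := h.mem_spectrum_inv hz
  have hl0 : 0 < l := hl.lt_of_ne (by rintro rfl; simp at h0)
  have := continuousAt_boseFactor hβ hl0
  refine ContinuousAt.continuousWithinAt ?_
  fun_prop (disch := assumption)

theorem IsSelfAdjointGE.continuousOn_thermalOpDeriv (hβ : 0 < β) {ζ : ℂ} (hζ : 0 ≤ ζ.im) :
    ContinuousOn (fun z : ℂ => z * (Complex.I * (Complex.exp (Complex.I * ζ / z) *
      boseFactor β z))) (spectrum ℂ h.inv) :=
  continuousOn_id_mul_of_bdd (M := 1 + ‖h.inv‖ / β)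
    (fun z hz => by
      rw [norm_mul, Complex.norm_I, one_mul]; exact h.norm_exp_mul_boseFactor_le hβ hζ hz)
    fun z hz h0 => (h.continuousWithinAt_exp_mul_boseFactor hβ ζ hz h0).const_mul _

theorem IsSelfAdjointGE.continuousOn_thermalOp (hβ : 0 < β) {ζ : ℂ} (hζ : 0 ≤ ζ.im) :
    ContinuousOn (fun z : ℂ => z * (z * (Complex.exp (Complex.I * ζ / z) * boseFactor β z)))
      (spectrum ℂ h.inv) :=
  continuousOn_id.mul (continuousOn_id_mul_of_bdd (M := 1 + ‖h.inv‖ / β)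
    (fun _ hz => h.norm_exp_mul_boseFactor_le hβ hζ hz)
    fun _ hz h0 => h.continuousWithinAt_exp_mul_boseFactor hβ ζ hz h0)

theorem IsSelfAdjointGE.norm_thermalOp_le (hβ : 0 < β) {ζ : ℂ} (hζ : 0 ≤ ζ.im) :
    ‖h.thermalOp β ζ‖ ≤ ‖h.inv‖ * (‖h.inv‖ * (1 + ‖h.inv‖ / β)) := by
  refine norm_cfc_le (by positivity) fun z hz => ?_
  have h1 := h.norm_exp_mul_boseFactor_le hβ hζ hz
  obtain ⟨l, rfl, hl, hl'⟩ := h.mem_spectrum_inv hz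
  have h2 : ‖(l : ℂ)‖ ≤ ‖h.inv‖ := by rwa [Complex.norm_real, Real.norm_of_nonneg hl]
  rw [norm_mul, norm_mul]
  gcongr

/-- The second-order remainder is of size |ξ - ζ|²/l², and the factor l² coming from a⁻² cancels the
denominator uniformly on the spectrum. This gives differentiability in operator norm up to and
including the real axis. -/
theorem IsSelfAdjointGE.hasDerivWithinAt_thermalOp (hβ : 0 < β) {ζ : ℂ} (hζ : 0 ≤ ζ.im) :
    HasDerivWithinAt (h.thermalOp β) (h.thermalOpDeriv β ζ) {ζ | 0 ≤ ζ.im} ζ := by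
  have hn : IsStarNormal h.inv := h.isSelfAdjoint_inv.isStarNormal
  have key : ∀ ξ : ℂ, 0 ≤ ξ.im →
      ‖h.thermalOp β ξ - (h.thermalOp β ζ + (ξ - ζ) • h.thermalOpDeriv β ζ)‖
        ≤ 3 * (1 + ‖h.inv‖ / β) * ‖ξ - ζ‖ ^ 2 := fun ξ hξ => by
    have c1 := h.continuousOn_thermalOp hβ hξ
    have c2 := h.continuousOn_thermalOp hβ hζ
    have c3 := h.continuousOn_thermalOpDeriv hβ hζ
    have c4 : ContinuousOn (fun z : ℂ => (ξ - ζ) • (z * (Complex.I *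
      (Complex.exp (Complex.I * ζ / z) * boseFactor β z)))) (spectrum ℂ h.inv) := by
      simp only [smul_eq_mul]
      exact continuousOn_const.mul c3
    rw [thermalOp, thermalOp, thermalOpDeriv, ← cfc_smul (ξ - ζ) _ h.inv c3,
      ← cfc_add _ _ _ c2 c4,
      ← cfc_sub _ (fun z : ℂ => _ + _) _ c1 (c2.add c4)]
    refine norm_cfc_le (by positivity) fun z hz => ?_
    obtain ⟨l, rfl, hl, hl'⟩ := h.mem_spectrum_inv hz
    rcases hl.eq_or_lt with rfl | hl0
    · simp; positivity
    have hl1 : (l : ℂ) ≠ 0 := by exact_mod_cast hl0.ne'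
    have e : (l : ℂ) * (l * (Complex.exp (Complex.I * ξ / l) * boseFactor β l)) -
        (l * (l * (Complex.exp (Complex.I * ζ / l) * boseFactor β l)) +
          (ξ - ζ) • (l * (Complex.I * (Complex.exp (Complex.I * ζ / l) * boseFactor β l)))) =
        (Complex.exp (Complex.I * ξ / l) - Complex.exp (Complex.I * ζ / l) -
          (Complex.I * ξ / l - Complex.I * ζ / l) * Complex.exp (Complex.I * ζ / l)) *
          (l ^ 2 * boseFactor β l) := by
      rw [smul_eq_mul]; field_simp; ring
    rw [e, norm_mul]
    have h1 := norm_exp_sub_exp_sub_le (re_I_mul_div_nonpos hζ hl) (re_I_mul_div_nonpos hξ hl)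
    have h2 : ‖Complex.I * ξ / l - Complex.I * ζ / l‖ = ‖ξ - ζ‖ / l := by
      rw [← sub_div, ← mul_sub, norm_div, norm_mul, Complex.norm_I, one_mul, Complex.norm_real,
        Real.norm_of_nonneg hl]
    rw [h2] at h1
    have h3 : ‖(l : ℂ) ^ 2 * boseFactor β l‖ ≤ l ^ 2 * (1 + ‖h.inv‖ / β) := by
      rw [norm_mul, norm_pow, Complex.norm_real, Real.norm_of_nonneg hl]
      gcongr
      refine (norm_boseFactor_le hβ hl).trans ?_
      gcongr
    refine (mul_le_mul h1 h3 (norm_nonneg _) (by positivity)).trans_eq ?_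
    field_simp
  have h0 : HasDerivWithinAt (fun ξ => h.thermalOp β ξ -
      (h.thermalOp β ζ + (ξ - ζ) • h.thermalOpDeriv β ζ)) 0 {ζ | 0 ≤ ζ.im} ζ := by
    refine hasDerivWithinAt_iff_hasFDerivWithinAt.2 ?_
    rw [ContinuousLinearMap.toSpanSingleton_zero]
    refine Asymptotics.IsBigO.hasFDerivWithinAt (s := {ζ : ℂ | 0 ≤ ζ.im}) (n := 2) ?_ hζ
      (by norm_num)
    refine Asymptotics.IsBigO.of_bound (3 * (1 + ‖h.inv‖ / β)) ?_
    filter_upwards [self_mem_nhdsWithin] with ξ hξ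
    rw [norm_pow, norm_norm]
    exact key ξ hξ
  have h1 : HasDerivWithinAt (fun ξ => h.thermalOp β ζ + (ξ - ζ) • h.thermalOpDeriv β ζ)
      (h.thermalOpDeriv β ζ) {ζ | 0 ≤ ζ.im} ζ := by
    have := (((hasDerivWithinAt_id ζ {ζ | 0 ≤ ζ.im}).sub_const ζ).smul_const
      (h.thermalOpDeriv β ζ)).const_add (h.thermalOp β ζ)
    simpa using this
  have := h0.add h1
  rw [zero_add] at this
  refine this.congr_of_mem (fun ξ _ => ?_) hζ
  simp

theorem IsSelfAdjointGE.norm_invMulExp_sub_le (s t : ℝ) :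
    ‖h.invMulExp t - h.invMulExp s‖ ≤ |t - s| := by
  rw [invMulExp, invMulExp, ← cfc_sub _ _ _ (h.continuousOn_aux t) (h.continuousOn_aux s)]
  refine norm_cfc_le (abs_nonneg _) fun z hz => ?_
  obtain ⟨l, rfl, hl, hl'⟩ := h.mem_spectrum_inv hz
  rcases hl.eq_or_lt with rfl | hl0
  · simp
  have e : (l : ℂ) * Complex.exp (Complex.I * t / l) - l * Complex.exp (Complex.I * s / l) =
      l * (Complex.exp (Complex.I * (s / l : ℝ)) *
        (Complex.exp (Complex.I * ((t - s) / l : ℝ)) - 1)) := by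
    rw [mul_sub, ← Complex.exp_add, mul_one, ← mul_sub]
    push_cast
    ring_nf
  rw [e, norm_mul, norm_mul, mul_comm Complex.I, Complex.norm_exp_ofReal_mul_I, one_mul,
    Complex.norm_real, Real.norm_of_nonneg hl]
  have := Real.norm_exp_I_mul_ofReal_sub_one_le (x := (t - s) / l)
  refine (mul_le_mul_of_nonneg_left this hl).trans_eq ?_
  rw [Real.norm_eq_abs, abs_div, abs_of_pos hl0]
  field_simp

theorem IsSelfAdjointGE.continuous_expI (x : X) : Continuous fun t => h.expI t x := by
  refine continuous_apply_of_denseRange h.denseRange_inv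
    (fun t x y => by rw [← map_sub, h.norm_expI]) (fun y => ?_) x
  simp only [h.expI_inv]
  refine LipschitzWith.continuous (K := ‖y‖₊) (LipschitzWith.of_dist_le_mul fun t s => ?_)
  rw [dist_eq_norm, ← sub_apply, mul_comm]
  refine (ContinuousLinearMap.le_opNorm _ _).trans ?_
  exact mul_le_mul_of_nonneg_right (h.norm_invMulExp_sub_le s t) (norm_nonneg _)

/-- A quantitative derivative at t = 0 on the range of a⁻², where the Taylor remainder of order
t²/l² is compensated. It serves to extract i a⁻¹y from the orbit of a⁻²y. -/
theorem IsSelfAdjointGE.norm_expI_sub_sub_le (t : ℝ) (y : X) :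
    ‖h.expI t (h.inv (h.inv y)) - h.inv (h.inv y) - (t * Complex.I) • h.inv y‖
      ≤ 3 * t ^ 2 * ‖y‖ := by
  have hn : IsStarNormal h.inv := h.isSelfAdjoint_inv.isStarNormal
  have e : h.expI t (h.inv (h.inv y)) - h.inv (h.inv y) - (t * Complex.I) • h.inv y =
      cfc (fun z : ℂ => z * Complex.exp (Complex.I * t / z) * z - z * z - (t * Complex.I) * z)
        h.inv y := by
    have c1 := h.continuousOn_aux t
    rw [cfc_sub (fun z : ℂ => z * Complex.exp (Complex.I * t / z) * z - z * z) _ h.inv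
      ((c1.mul continuousOn_id).sub (by fun_prop)) (by fun_prop),
      cfc_sub (fun z : ℂ => z * Complex.exp (Complex.I * t / z) * z) _ h.inv
      (c1.mul continuousOn_id) (by fun_prop),
      cfc_mul (fun z : ℂ => z * Complex.exp (Complex.I * t / z)) (fun z => z) h.inv c1 (by fun_prop),
      cfc_mul (fun z : ℂ => z) (fun z => z) h.inv, cfc_const_mul (t * Complex.I) (fun z => z) h.inv,
      cfc_id' ℂ h.inv, ← invMulExp, h.expI_inv]
    rfl
  rw [e]
  refine (ContinuousLinearMap.le_opNorm _ _).trans ?_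
  refine mul_le_mul_of_nonneg_right (norm_cfc_le (by positivity) fun z hz => ?_) (norm_nonneg _)
  obtain ⟨l, rfl, hl, hl'⟩ := h.mem_spectrum_inv hz
  rcases hl.eq_or_lt with rfl | hl0
  · simp; positivity
  have hl1 : (l : ℂ) ≠ 0 := by exact_mod_cast hl0.ne'
  have hre := re_I_mul_div_nonpos (ζ := t) (by simp) hl
  have h1 := norm_exp_sub_exp_sub_le (u := 0) (v := Complex.I * t / l) (by simp) hre
  have e1 : (l : ℂ) * Complex.exp (Complex.I * t / l) * l - l * l - (t * Complex.I) * l =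
      l ^ 2 * (Complex.exp (Complex.I * t / l) - Complex.exp 0 -
        (Complex.I * t / l - 0) * Complex.exp 0) := by
    rw [Complex.exp_zero, sub_zero]; field_simp
  rw [e1, norm_mul, norm_pow, Complex.norm_real, Real.norm_of_nonneg hl]
  refine (mul_le_mul_of_nonneg_left h1 (by positivity)).trans_eq ?_
  rw [sub_zero, norm_div, norm_mul, Complex.norm_I, one_mul, Complex.norm_real, Complex.norm_real,
    Real.norm_of_nonneg hl, Real.norm_eq_abs, div_pow, sq_abs]
  field_simp

end Spectral

/-! ### The two-point function on the strip -/

section TwoPoint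

open Filter Topology

variable {X : Type*} [NormedAddCommGroup X] [InnerProductSpace ℂ X] [CompleteSpace X]
variable {a : X →ₗ.[ℂ] X} {m : ℝ} (h : IsSelfAdjointGE a m) {β : ℝ}

/-- The covariance form `(x, (1 + ρ) y) + (y, ρ x)`. -/
noncomputable def covForm (ρ : X →L[ℂ] X) (x y : X) : ℂ :=
  ⟪x, y⟫_ℂ + ⟪x, ρ y⟫_ℂ + ⟪y, ρ x⟫_ℂ

/-- The analytic continuation to the strip `0 ≤ Im ζ ≤ β` of the two-point function
`t ↦ (a⁻¹ x, (1 + ρ) e^{ita} a⁻¹ y) + (e^{ita} a⁻¹ y, ρ a⁻¹ x)`. -/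
noncomputable def IsSelfAdjointGE.twoPoint (β : ℝ) (x y : X) (ζ : ℂ) : ℂ :=
  ⟪x, h.thermalOp β ζ y⟫_ℂ + ⟪y, h.thermalOp β (Complex.I * β - ζ) x⟫_ℂ

/-- The KMS condition for one particle: the reflection of the strip interchanges the two summands.
-/
theorem IsSelfAdjointGE.twoPoint_swap (x y : X) (ζ : ℂ) :
    h.twoPoint β x y (Complex.I * β - ζ) = h.twoPoint β y x ζ := by
  rw [twoPoint, twoPoint, sub_sub_cancel, add_comm]

theorem im_I_mul_sub (β : ℝ) (ζ : ℂ) : (Complex.I * β - ζ).im = β - ζ.im := by simp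

theorem IsSelfAdjointGE.differentiableOn_twoPoint (hβ : 0 < β) (x y : X) :
    DifferentiableOn ℂ (h.twoPoint β x y) {ζ | 0 ≤ ζ.im ∧ ζ.im ≤ β} := by
  have hop : ∀ x y : X, DifferentiableOn ℂ (fun ζ => ⟪x, h.thermalOp β ζ y⟫_ℂ)
      {ζ | 0 ≤ ζ.im} := fun x y ζ hζ => by
    have h1 := (h.hasDerivWithinAt_thermalOp hβ hζ).differentiableWithinAt
    exact ((innerSL ℂ x).differentiableAt).comp_differentiableWithinAt ζ
      (h1.clm_apply (differentiableWithinAt_const y))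
  refine ((hop x y).mono fun ζ hζ => hζ.1).add ?_
  refine (hop y x).comp (f := fun ζ => Complex.I * β - ζ) (by fun_prop) fun ζ hζ => ?_
  change 0 ≤ (Complex.I * β - ζ).im
  rw [im_I_mul_sub]
  linarith [hζ.2]

theorem IsSelfAdjointGE.exists_norm_twoPoint_le (hβ : 0 < β) (x y : X) :
    ∃ C, ∀ ζ : ℂ, 0 ≤ ζ.im → ζ.im ≤ β → ‖h.twoPoint β x y ζ‖ ≤ C := by
  set K := ‖h.inv‖ * (‖h.inv‖ * (1 + ‖h.inv‖ / β))
  have hK : ∀ ζ : ℂ, 0 ≤ ζ.im → ∀ x y : X, ‖⟪x, h.thermalOp β ζ y⟫_ℂ‖ ≤ ‖x‖ * (K * ‖y‖) :=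
    fun ζ hζ x y => (norm_inner_le_norm _ _).trans (by
      gcongr
      exact ContinuousLinearMap.le_of_opNorm_le _ (h.norm_thermalOp_le hβ hζ) y)
  refine ⟨‖x‖ * (K * ‖y‖) + ‖y‖ * (K * ‖x‖), fun ζ h1 h2 => (norm_add_le _ _).trans ?_⟩
  refine add_le_add (hK _ h1 _ _) (hK _ ?_ _ _)
  rw [im_I_mul_sub]; linarith

/-- The thermal occupation number `(e^{β/l} - 1)⁻¹` as a complex function. -/
noncomputable def occFun (β : ℝ) (z : ℂ) : ℂ :=
  ((if z.re = 0 then 0 else (Real.exp (β / z.re) - 1)⁻¹ : ℝ) : ℂ)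

theorem occFun_ofReal {β l : ℝ} (hl : 0 < l) :
    occFun β l = (Complex.exp (β / l) - 1)⁻¹ := by
  simp [occFun, hl.ne']

theorem exp_div_sub_one_ne {β l : ℝ} (hβ : 0 < β) (hl : 0 < l) :
    Complex.exp (β / l) - 1 ≠ 0 := by
  have h1 : 0 < Real.exp (β / l) - 1 := by
    have := Real.one_lt_exp_iff.2 (div_pos hβ hl); linarith
  exact_mod_cast h1.ne'

theorem boseFactor_eq_one_add {β l : ℝ} (hβ : 0 < β) (hl : 0 < l) :
    boseFactor β l = 1 + occFun β l := by
  have h1 := exp_div_sub_one_ne hβ hl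
  rw [occFun_ofReal hl, boseFactor, neg_div, Complex.exp_neg]
  have h2 := Complex.exp_ne_zero (β / l : ℂ)
  have h3 : 1 - (Complex.exp (β / l : ℂ))⁻¹ ≠ 0 := by
    intro h0; apply h1; field_simp at h0; rwa [mul_zero] at h0
  field_simp
  ring

/-- This is e^{-βa}(1+ρ) = ρ, by which the ρ-term of the covariance is a value of `thermalOp` at a
point with imaginary part β. -/
theorem exp_mul_boseFactor {β l : ℝ} (hβ : 0 < β) (hl : 0 < l) :
    Complex.exp (-(β / l)) * boseFactor β l = occFun β l := by
  have h1 := exp_div_sub_one_ne hβ hl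
  rw [occFun_ofReal hl, boseFactor, neg_div, Complex.exp_neg]
  have h2 := Complex.exp_ne_zero (β / l : ℂ)
  have h3 : 1 - (Complex.exp (β / l : ℂ))⁻¹ ≠ 0 := by
    intro h0; apply h1; field_simp at h0; rwa [mul_zero] at h0
  field_simp

theorem IsSelfAdjointGE.rho_eq_cfc : h.rho β = cfc (occFun β) h.inv := by
  rw [rho, cfc_real_eq_complex _ h.isSelfAdjoint_inv]
  rfl

/-- Since e^x - 1 ≥ x, the quotient of the occupation number by l is at most 1/β, so a factor l can
be split off to get continuity at 0. -/
theorem IsSelfAdjointGE.continuousOn_occFun (hβ : 0 < β) :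
    ContinuousOn (occFun β) (spectrum ℂ h.inv) := by
  have h1 := continuousOn_id_mul_of_bdd (s := spectrum ℂ h.inv) (M := 1 / β)
    (f := fun z => z⁻¹ * occFun β z) (fun z hz => ?_) (fun z hz h0 => ?_)
  · refine h1.congr fun z hz => ?_
    rcases eq_or_ne z 0 with rfl | h0
    · simp [occFun]
    · simp only; field_simp
  · obtain ⟨l, rfl, hl, hl'⟩ := h.mem_spectrum_inv hz
    rcases hl.eq_or_lt with rfl | hl0
    · simp; positivity
    have h2 : 0 < β / l := div_pos hβ hl0
    have h3 : β / l ≤ Real.exp (β / l) - 1 := by linarith [Real.add_one_le_exp (β / l)]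
    rw [norm_mul, norm_inv, Complex.norm_real, Real.norm_of_nonneg hl, occFun]
    simp only [Complex.ofReal_re, hl0.ne', if_false, Complex.norm_real]
    rw [Real.norm_of_nonneg (_root_.inv_nonneg.2 (h2.le.trans h3))]
    refine (mul_le_mul_of_nonneg_left (inv_anti₀ h2 h3) (by positivity)).trans_eq ?_
    field_simp
  · obtain ⟨l, rfl, hl, hl'⟩ := h.mem_spectrum_inv hz
    have hl0 : 0 < l := hl.lt_of_ne (by rintro rfl; simp at h0)
    have h2 := exp_div_sub_one_ne hβ hl0
    have h3 : ContinuousAt (fun z : ℂ => z⁻¹ * (Complex.exp (β / z) - 1)⁻¹) l := by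
      fun_prop (disch := assumption)
    refine h3.continuousWithinAt.congr_of_mem (fun w hw => ?_) hz
    obtain ⟨k, rfl, hk, -⟩ := h.mem_spectrum_inv hw
    rcases hk.eq_or_lt with rfl | hk0
    · simp
    · rw [occFun_ofReal hk0]

theorem IsSelfAdjointGE.invMulExp_mul_invMulExp_add (hβ : 0 < β) (s t : ℝ) :
    h.invMulExp (-s) * h.invMulExp t + h.invMulExp (-s) * (h.rho β * h.invMulExp t)
      = h.thermalOp β (t - s) := by
  have c1 := h.continuousOn_aux (-s)
  have c2 := h.continuousOn_aux t
  have c3 := h.continuousOn_occFun hβ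
  rw [h.rho_eq_cfc, invMulExp, invMulExp, thermalOp, ← cfc_mul _ _ _ c3 c2,
    ← cfc_mul _ _ _ c1 c2, ← cfc_mul _ (fun z => _ * _) _ c1 (c3.mul c2),
    ← cfc_add _ (fun z => _ * _) (fun z => _ * _) (c1.mul c2) (c1.mul (c3.mul c2))]
  refine cfc_congr fun z hz => ?_
  obtain ⟨l, rfl, hl, hl'⟩ := h.mem_spectrum_inv hz
  rcases hl.eq_or_lt with rfl | hl0
  · simp
  have e : Complex.exp (Complex.I * (t - s) / l) =
      Complex.exp (Complex.I * ((-s : ℝ) : ℂ) / l) * Complex.exp (Complex.I * t / l) := by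
    rw [← Complex.exp_add]; push_cast; ring_nf
  rw [boseFactor_eq_one_add hβ hl0, e]
  ring

theorem IsSelfAdjointGE.invMulExp_mul_rho_mul (hβ : 0 < β) (s t : ℝ) :
    h.invMulExp (-t) * (h.rho β * h.invMulExp s) = h.thermalOp β (Complex.I * β - (t - s)) := by
  have c1 := h.continuousOn_aux (-t)
  have c2 := h.continuousOn_aux s
  have c3 := h.continuousOn_occFun hβ
  rw [h.rho_eq_cfc, invMulExp, invMulExp, thermalOp, ← cfc_mul _ _ _ c3 c2,
    ← cfc_mul _ (fun z => _ * _) _ c1 (c3.mul c2)]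
  refine cfc_congr fun z hz => ?_
  obtain ⟨l, rfl, hl, hl'⟩ := h.mem_spectrum_inv hz
  rcases hl.eq_or_lt with rfl | hl0
  · simp
  have e : Complex.exp (Complex.I * (Complex.I * β - (t - s)) / l) =
      Complex.exp (-(β / l)) * (Complex.exp (Complex.I * ((-t : ℝ) : ℂ) / l) *
        Complex.exp (Complex.I * s / l)) := by
    rw [← Complex.exp_add, ← Complex.exp_add]
    congr 1
    push_cast
    rw [mul_sub, ← mul_assoc, Complex.I_mul_I]
    ring
  rw [e, ← exp_mul_boseFactor hβ hl0]
  ring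

/-- Moved across the inner product, a⁻¹e^{isa} becomes a⁻¹e^{-isa}; each term is then one function
of a depending on t - s only. This ties the real-time covariance to its analytic continuation. -/
theorem IsSelfAdjointGE.covForm_expI (hβ : 0 < β) (s t : ℝ) (x y : X) :
    covForm (h.rho β) (h.expI s (h.inv x)) (h.expI t (h.inv y)) = h.twoPoint β x y (t - s) := by
  have hadj : ∀ (s : ℝ) (x y : X), ⟪h.invMulExp s x, y⟫_ℂ = ⟪x, h.invMulExp (-s) y⟫_ℂ :=
    fun s x y => by
      rw [← h.star_invMulExp, ContinuousLinearMap.star_eq_adjoint,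
        ContinuousLinearMap.adjoint_inner_right]
  rw [covForm, twoPoint, h.expI_inv, h.expI_inv, ← h.invMulExp_mul_invMulExp_add hβ,
    ← h.invMulExp_mul_rho_mul hβ, hadj s, hadj s, hadj t, add_apply, inner_add_right]
  rfl

end TwoPoint

/-! ### Reality with respect to the conjugation -/

section Conjugation

/-- Polarization gives equality of the real parts, and antilinearity reverses the imaginary part,
which is the real part after multiplication by i. -/
theorem inner_map_map_conj {X : Type*} [NormedAddCommGroup X] [InnerProductSpace ℂ X]
    (κ : X ≃ₗᵢ⋆[ℂ] X) (x y : X) : ⟪κ x, κ y⟫_ℂ = ⟪y, x⟫_ℂ := by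
  have hre : ∀ x y, (⟪κ x, κ y⟫_ℂ).re = (⟪x, y⟫_ℂ).re := fun x y => by
    have h1 := re_inner_eq_norm_add_mul_self_sub_norm_sub_mul_self_div_four (𝕜 := ℂ) (κ x) (κ y)
    have h2 := re_inner_eq_norm_add_mul_self_sub_norm_sub_mul_self_div_four (𝕜 := ℂ) x y
    rw [← map_add, ← map_sub, κ.norm_map, κ.norm_map, ← h2] at h1
    exact h1
  have him : ∀ x y : X, (⟪x, y⟫_ℂ).im = (⟪Complex.I • x, y⟫_ℂ).re := fun x y => by
    rw [inner_smul_left]; simp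
  rw [← inner_conj_symm y x]
  refine Complex.ext (by rw [hre, Complex.conj_re]) ?_
  have h1 : Complex.I • κ x = κ (-(Complex.I • x)) := by
    rw [map_neg, map_smulₛₗ, Complex.conj_I, neg_smul, neg_neg]
  rw [him, h1, hre, Complex.conj_im, inner_neg_left, Complex.neg_re, ← him]

variable {X : Type*} [NormedAddCommGroup X] [InnerProductSpace ℂ X] [CompleteSpace X]

/-- Conjugation of bounded operators by the antiunitary involution `κ`. -/
noncomputable def conjOp (κ : X ≃ₗᵢ⋆[ℂ] X) (hκ : ∀ x, κ (κ x) = x) :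
    (X →L[ℂ] X) →⋆ₐ[ℝ] (X →L[ℂ] X) where
  toFun A := (κ.toContinuousLinearEquiv : X →SL[starRingEnd ℂ] X).comp
    (A.comp (κ.toContinuousLinearEquiv : X →SL[starRingEnd ℂ] X))
  map_one' := by ext x; exact hκ x
  map_mul' A B := by
    ext x
    change κ (A (B (κ x))) = κ (A (κ (κ (B (κ x)))))
    rw [hκ]
  map_zero' := by ext x; exact map_zero κ
  map_add' A B := by ext x; exact map_add κ _ _
  commutes' r := by
    ext x
    change κ ((r : ℂ) • κ x) = (r : ℂ) • x
    rw [map_smulₛₗ, hκ, Complex.conj_ofReal]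
  map_star' A := by
    rw [ContinuousLinearMap.star_eq_adjoint, ContinuousLinearMap.star_eq_adjoint,
      ContinuousLinearMap.eq_adjoint_iff]
    intro x y
    change ⟪κ (ContinuousLinearMap.adjoint A (κ x)), y⟫_ℂ = ⟪x, κ (A (κ y))⟫_ℂ
    rw [← hκ y, inner_map_map_conj, hκ y, ContinuousLinearMap.adjoint_inner_right,
      ← inner_map_map_conj κ, hκ]

theorem conjOp_apply (κ : X ≃ₗᵢ⋆[ℂ] X) (hκ : ∀ x, κ (κ x) = x) (A : X →L[ℂ] X) (x : X) :
    conjOp κ hκ A x = κ (A (κ x)) := rfl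

theorem continuous_conjOp (κ : X ≃ₗᵢ⋆[ℂ] X) (hκ : ∀ x, κ (κ x) = x) :
    Continuous (conjOp κ hκ) := by
  refine AddMonoidHomClass.continuous_of_bound (conjOp κ hκ) 1 fun A => ?_
  rw [one_mul]
  refine ContinuousLinearMap.opNorm_le_bound _ (norm_nonneg _) fun x => ?_
  rw [conjOp_apply, κ.norm_map, ← κ.norm_map x]
  exact A.le_opNorm _

variable {a : X →ₗ.[ℂ] X} {m : ℝ} (h : IsSelfAdjointGE a m)

theorem IsSelfAdjointGE.conj_inv {κ : X ≃ₗᵢ⋆[ℂ] X} (hcomm : CommutesWith a κ) (x : X) : κ (h.inv x) = h.inv (κ x) := by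
  obtain ⟨hx, hx'⟩ := hcomm ⟨h.inv x, h.inv_mem x⟩
  rw [h.apply_inv] at hx'
  rw [← hx', h.inv_apply]

/-- Conjugation by κ is a continuous real *-homomorphism fixing a⁻¹, hence fixes its real functional
calculus. Real functions are required because κ is antilinear. -/
theorem IsSelfAdjointGE.conj_cfc {κ : X ≃ₗᵢ⋆[ℂ] X} (hκ : ∀ x, κ (κ x) = x)
    (hcomm : CommutesWith a κ) (f : ℝ → ℝ) (hf : ContinuousOn f (spectrum ℝ h.inv)) (x : X) :
    κ (cfc f h.inv x) = cfc f h.inv (κ x) := by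
  have h1 : conjOp κ hκ h.inv = h.inv := by
    ext x; rw [conjOp_apply, h.conj_inv hcomm, hκ]
  have h2 := StarAlgHom.map_cfc (conjOp κ hκ) f h.inv hf (continuous_conjOp κ hκ)
    h.isSelfAdjoint_inv (by rw [h1]; exact h.isSelfAdjoint_inv)
  rw [h1] at h2
  rw [← h2, conjOp_apply, hκ, h2]

theorem IsSelfAdjointGE.inner_cfc_comm {κ : X ≃ₗᵢ⋆[ℂ] X} (hκ : ∀ x, κ (κ x) = x)
    (hcomm : CommutesWith a κ) (f : ℝ → ℝ) (hf : ContinuousOn f (spectrum ℝ h.inv))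
    {x y : X} (hx : κ x = x) (hy : κ y = y) :
    ⟪x, cfc f h.inv y⟫_ℂ = ⟪y, cfc f h.inv x⟫_ℂ := by
  have h1 : κ (cfc f h.inv y) = cfc f h.inv y := by rw [h.conj_cfc hκ hcomm f hf, hy]
  have hsa : IsSelfAdjoint (cfc f h.inv) := IsSelfAdjoint.cfc
  rw [← inner_map_map_conj κ, h1, hx]
  exact (ContinuousLinearMap.isSelfAdjoint_iff_isSymmetric.1 hsa) y x

end Conjugation

/-! ### The Euclidean covariance as a sum of squares -/

section Gram

theorem sum_sum_eq_of_symm {n : ℕ} {T : Fin n → Fin n → ℂ} (hT : ∀ i j, T i j = T j i) :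
    ∑ i, ∑ j, T i j = ∑ i, T i i + 2 * ∑ i, ∑ j, if i < j then T i j else 0 := by
  have h1 : ∑ i, ∑ j, (if j < i then T i j else 0) = ∑ i, ∑ j, if i < j then T i j else 0 := by
    rw [Finset.sum_comm]
    simp only [hT]
  have h2 : ∑ i, T i i = ∑ i, ∑ j, if i = j then T i j else 0 := by simp
  rw [two_mul]
  nth_rw 2 [← h1]
  rw [h2]
  simp only [← Finset.sum_add_distrib]
  refine Finset.sum_congr rfl fun i _ => Finset.sum_congr rfl fun j _ => ?_
  rcases lt_trichotomy i j with h | rfl | h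
  · simp [h, h.ne, h.not_gt]
  · simp
  · simp [h, h.ne', h.not_gt]

/-- Forward distance on the circle of length `β` from the point `p (k + 1)` to the point `p i`. -/
noncomputable def arcDist (β : ℝ) (p : ℕ → ℝ) (k i : ℕ) : ℝ :=
  if k < i then p i - p (k + 1) else p i + β - p (k + 1)

/-- The thermal covariance of the harmonic oscillator at finitely many points of the circle of
length `β` is a Gram matrix. -/
theorem sum_arc_eq {β : ℝ} {n : ℕ} {p : ℕ → ℝ} (hp : p n = p 0 + β) (c : ℝ) {i j : ℕ}
    (hij : i ≤ j) (hj : j ≤ n) :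
    ∑ k ∈ Finset.range n, (1 - Real.exp (-(2 * (p (k + 1) - p k) * c))) *
        (Real.exp (-(arcDist β p k i * c)) * Real.exp (-(arcDist β p k j * c))) =
      (Real.exp (-((p j - p i) * c)) + Real.exp (-((β - (p j - p i)) * c))) *
        (1 - Real.exp (-(β * c))) := by
  -- Each summand is the increment of F over its arc, times e^{-βc} for every one of the points i, j
  -- that is reached only after going round past p n. The factor is constant for k < i, for i ≤ k <
  -- j and for j ≤ k, so three telescoping sums remain.
  let F : ℝ → ℝ := fun x => Real.exp ((2 * x - p i - p j) * c)
  have h1 : ∀ k ∈ Finset.Ico 0 i, (1 - Real.exp (-(2 * (p (k + 1) - p k) * c))) *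
      (Real.exp (-(arcDist β p k i * c)) * Real.exp (-(arcDist β p k j * c))) =
      F (p (k + 1)) - F (p k) := fun k hk => by
    have hk' := (Finset.mem_Ico.1 hk).2
    simp only [F]
    rw [arcDist, arcDist, if_pos hk', if_pos (hk'.trans_le hij), ← Real.exp_add, sub_mul, one_mul,
      ← Real.exp_add]
    ring_nf
  have h2 : ∀ k ∈ Finset.Ico i j, (1 - Real.exp (-(2 * (p (k + 1) - p k) * c))) *
      (Real.exp (-(arcDist β p k i * c)) * Real.exp (-(arcDist β p k j * c))) =
      Real.exp (-(β * c)) * (F (p (k + 1)) - F (p k)) := fun k hk => by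
    obtain ⟨hk, hk'⟩ := Finset.mem_Ico.1 hk
    simp only [F]
    rw [arcDist, arcDist, if_neg hk.not_gt, if_pos hk', ← Real.exp_add, sub_mul, one_mul,
      ← Real.exp_add, mul_sub (Real.exp _), ← Real.exp_add, ← Real.exp_add]
    ring_nf
  have h3 : ∀ k ∈ Finset.Ico j n, (1 - Real.exp (-(2 * (p (k + 1) - p k) * c))) *
      (Real.exp (-(arcDist β p k i * c)) * Real.exp (-(arcDist β p k j * c))) =
      Real.exp (-(2 * β * c)) * (F (p (k + 1)) - F (p k)) := fun k hk => by
    obtain ⟨hk, hk'⟩ := Finset.mem_Ico.1 hk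
    simp only [F]
    rw [arcDist, arcDist, if_neg (hij.trans hk).not_gt, if_neg hk.not_gt, ← Real.exp_add, sub_mul,
      one_mul, ← Real.exp_add, mul_sub (Real.exp _), ← Real.exp_add, ← Real.exp_add]
    ring_nf
  have tel : ∀ a b : ℕ, a ≤ b →
      ∑ k ∈ Finset.Ico a b, (F (p (k + 1)) - F (p k)) = F (p b) - F (p a) := fun a b hab =>
    Finset.sum_Ico_sub (fun k => F (p k)) hab
  rw [Finset.range_eq_Ico, ← Finset.sum_Ico_consecutive _ (Nat.zero_le i) (hij.trans hj),
    ← Finset.sum_Ico_consecutive _ hij hj, Finset.sum_congr rfl h1, Finset.sum_congr rfl h2,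
    Finset.sum_congr rfl h3, ← Finset.mul_sum, ← Finset.mul_sum, tel _ _ (Nat.zero_le i),
    tel _ _ hij, tel _ _ hj, hp]
  simp only [F, mul_sub, sub_mul, add_mul, ← Real.exp_add, mul_one]
  ring_nf

variable {X : Type*} [NormedAddCommGroup X] [InnerProductSpace ℂ X] [CompleteSpace X]
variable {a : X →ₗ.[ℂ] X} {m : ℝ} (h : IsSelfAdjointGE a m) {β : ℝ}

/-- `thermalFun β d l = l² e^{-d/l} (1 - e^{-β/l})⁻¹`. -/
noncomputable def thermalFun (β d l : ℝ) : ℝ :=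
  l * (l * (Real.exp (-(d * l⁻¹)) * (1 - Real.exp (-(β * l⁻¹)))⁻¹))

theorem IsSelfAdjointGE.mem_spectrum_real_inv {l : ℝ} (hl : l ∈ spectrum ℝ h.inv) :
    0 ≤ l ∧ l ≤ ‖h.inv‖ := by
  refine ⟨spectrum_nonneg_of_nonneg h.inv_nonneg hl, (le_abs_self l).trans ?_⟩
  exact (spectrum.norm_le_norm_mul_of_mem hl).trans
    (mul_le_of_le_one_right (norm_nonneg _) ContinuousLinearMap.norm_id_le)

theorem one_sub_exp_mul_inv_pos {l : ℝ} (hβ : 0 < β) (hl : 0 < l) :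
    0 < 1 - Real.exp (-(β * l⁻¹)) := by
  have := one_sub_exp_pos hβ hl
  rwa [neg_div, div_eq_mul_inv] at this

theorem abs_inv_one_sub_exp_le {l : ℝ} (hβ : 0 < β) (hl : 0 ≤ l) :
    |(1 - Real.exp (-(β * l⁻¹)))⁻¹| ≤ 1 + l / β := by
  have := norm_boseFactor_le hβ hl
  rwa [boseFactor_ofReal, Complex.norm_real, neg_div, div_eq_mul_inv] at this

theorem exp_neg_mul_inv_le_one {d l : ℝ} (hd : 0 ≤ d) (hl : 0 ≤ l) :
    |Real.exp (-(d * l⁻¹))| ≤ 1 := by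
  rw [Real.abs_exp, Real.exp_le_one_iff]
  have := mul_nonneg hd (_root_.inv_nonneg.2 hl)
  linarith

theorem IsSelfAdjointGE.continuousOn_thermalFun (hβ : 0 < β) {d : ℝ} (hd : 0 ≤ d) :
    ContinuousOn (thermalFun β d) (spectrum ℝ h.inv) := by
  refine continuousOn_id.mul (continuousOn_id_mul_of_bdd (M := 1 * (1 + ‖h.inv‖ / β))
    (fun l hl => ?_) fun l hl h0 => ?_)
  · obtain ⟨hl0, hl1⟩ := h.mem_spectrum_real_inv hl
    refine norm_mul_le_of_le (exp_neg_mul_inv_le_one hd hl0)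
      ((abs_inv_one_sub_exp_le hβ hl0).trans ?_)
    gcongr
  · obtain ⟨hl0, hl1⟩ := h.mem_spectrum_real_inv hl
    have := (one_sub_exp_mul_inv_pos hβ (hl0.lt_of_ne h0.symm)).ne'
    refine ContinuousAt.continuousWithinAt ?_
    fun_prop (disch := assumption)

theorem IsSelfAdjointGE.thermalOp_I_mul (d : ℝ) :
    h.thermalOp β (Complex.I * d) = cfc (thermalFun β d) h.inv := by
  rw [cfc_real_eq_complex _ h.isSelfAdjoint_inv, thermalOp]
  refine cfc_congr fun z hz => ?_
  obtain ⟨l, rfl, hl, hl'⟩ := h.mem_spectrum_inv hz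
  rw [boseFactor_ofReal, ← mul_assoc Complex.I, Complex.I_mul_I]
  simp only [thermalFun, Complex.ofReal_re]
  push_cast
  simp only [div_eq_mul_inv, neg_mul, one_mul]

/-- At imaginary times both operators are real functions of a⁻¹, so the second inner product is
symmetric in fixed vectors and merges with the first into e^{-da} + e^{-(β-d)a}, up to common
factors. -/
theorem IsSelfAdjointGE.twoPoint_I_mul (hβ : 0 < β) {κ : X ≃ₗᵢ⋆[ℂ] X} (hκ : ∀ x, κ (κ x) = x)
    (hcomm : CommutesWith a κ) {d : ℝ} (hd : 0 ≤ d) (hd' : d ≤ β) {x y : X} (hx : κ x = x)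
    (hy : κ y = y) : h.twoPoint β x y (Complex.I * d) =
      ⟪x, cfc (fun l => thermalFun β d l + thermalFun β (β - d) l) h.inv y⟫_ℂ := by
  have c1 := h.continuousOn_thermalFun hβ hd
  have c2 := h.continuousOn_thermalFun hβ (sub_nonneg.2 hd')
  have e : Complex.I * β - Complex.I * d = Complex.I * ((β - d : ℝ) : ℂ) := by
    push_cast; ring
  rw [twoPoint, e, h.thermalOp_I_mul, h.thermalOp_I_mul, h.inner_cfc_comm hκ hcomm _ c2 hy hx,
    cfc_add _ _ _ c1 c2, add_apply, inner_add_right]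

/-- The square root of the contribution of an arc of length `δ` at distance `d`. -/
noncomputable def arcFun (β δ d l : ℝ) : ℝ :=
  l * (√(1 - Real.exp (-(2 * δ * l⁻¹))) * (Real.exp (-(d * l⁻¹)) *
    (1 - Real.exp (-(β * l⁻¹)))⁻¹))

theorem IsSelfAdjointGE.continuousOn_arcFun (hβ : 0 < β) (δ : ℝ) {d : ℝ} (hd : 0 ≤ d) :
    ContinuousOn (arcFun β δ d) (spectrum ℝ h.inv) := by
  refine continuousOn_id_mul_of_bdd (M := 1 * (1 * (1 + ‖h.inv‖ / β))) (fun l hl => ?_)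
    fun l hl h0 => ?_
  · obtain ⟨hl0, hl1⟩ := h.mem_spectrum_real_inv hl
    refine norm_mul_le_of_le ?_ (norm_mul_le_of_le (exp_neg_mul_inv_le_one hd hl0)
      ((abs_inv_one_sub_exp_le hβ hl0).trans ?_))
    · rw [Real.norm_of_nonneg (Real.sqrt_nonneg _), Real.sqrt_le_iff]
      exact ⟨zero_le_one, by linarith [Real.exp_pos (-(2 * δ * l⁻¹))]⟩
    · gcongr
  · obtain ⟨hl0, hl1⟩ := h.mem_spectrum_real_inv hl
    have := (one_sub_exp_mul_inv_pos hβ (hl0.lt_of_ne h0.symm)).ne'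
    refine ContinuousAt.continuousWithinAt ?_
    fun_prop (disch := assumption)

/-- The Euclidean covariance of the time-zero fields at ordered times on the circle is a sum of
squares. -/
theorem IsSelfAdjointGE.exists_gram (hβ : 0 < β) {κ : X ≃ₗᵢ⋆[ℂ] X} (hκ : ∀ x, κ (κ x) = x)
    (hcomm : CommutesWith a κ) {n : ℕ} {s : Fin n → ℝ} (hs : Monotone s)
    (hsβ : ∀ i j, s j - s i ≤ β) :
    ∃ R : Fin n → (Fin n → X) →ₗ[ℂ] X, ∀ u : Fin n → X, (∀ i, κ (u i) = u i) →
      ∑ i, h.twoPoint β (u i) (u i) 0 +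
        2 * ∑ i, ∑ j, (if i < j then h.twoPoint β (u i) (u j) (Complex.I * (s j - s i)) else 0) =
      ((∑ k, ‖R k u‖ ^ 2 : ℝ) : ℂ) := by
  rcases n.eq_zero_or_pos with rfl | hn
  · exact ⟨fun _ => 0, fun u _ => by simp⟩
  -- The points on the circle, closed up by p n = s₀ + β. The times span at most β, so all arcs have
  -- nonnegative length.
  let p : ℕ → ℝ := fun k => if hk : k < n then s ⟨k, hk⟩ else s ⟨0, hn⟩ + β
  have hpi : ∀ i : Fin n, p i = s i := fun i => by simp [p]
  have hpn : p n = p 0 + β := by simp [p, hn]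
  have hδ : ∀ k : Fin n, 0 ≤ p (k + 1) - p k := fun k => by
    rw [hpi]
    simp only [p]
    split_ifs with hk
    · exact sub_nonneg.2 (hs (Fin.mk_le_mk.2 (Nat.le_succ _)))
    · linarith [hsβ ⟨0, hn⟩ k]
  have hD : ∀ k i : Fin n, 0 ≤ arcDist β p k i := fun k i => by
    rw [arcDist, hpi]
    simp only [p]
    split_ifs with hki hk hk
    · exact sub_nonneg.2 (hs (Fin.mk_le_mk.2 hki))
    · omega
    · linarith [hsβ i ⟨k + 1, hk⟩]
    · linarith [hs (show (⟨0, hn⟩ : Fin n) ≤ i from Nat.zero_le _)]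
  let r : Fin n → Fin n → ℝ → ℝ := fun k i => arcFun β (p (k + 1) - p k) (arcDist β p k i)
  have hr : ∀ k i, ContinuousOn (r k i) (spectrum ℝ h.inv) := fun k i =>
    h.continuousOn_arcFun hβ _ (hD k i)
  -- The oscillator covariance factors through the first-order operator d/dt + a on the circle, with
  -- periodic kernel e^{-da}(1 - e^{-βa})⁻¹. Integrating the product of the kernels seen from p i
  -- and p j over the k-th arc gives the k-th summand, up to the smoothing.
  let M : Fin n → Fin n → (X →L[ℂ] X) := fun i j => ∑ k, cfc (r k i) h.inv * cfc (r k j) h.inv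
  have hMs : ∀ i j, M i j = M j i := fun i j =>
    Finset.sum_congr rfl fun k _ => (cfc_commute_cfc _ _ _).eq
  have hM : ∀ i j, i ≤ j → M i j =
      cfc (fun l => thermalFun β (s j - s i) l + thermalFun β (β - (s j - s i)) l) h.inv := by
    intro i j hij
    have h1 : M i j = cfc (fun l => ∑ k, r k i l * r k j l) h.inv := by
      have e : (fun l => ∑ k, r k i l * r k j l) = ∑ k, fun l => r k i l * r k j l := by
        ext l; simp
      rw [e, cfc_sum_univ (fun k l => r k i l * r k j l) h.inv fun k => (hr k i).mul (hr k j)]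
      exact Finset.sum_congr rfl fun k _ => (cfc_mul _ _ _ (hr k i) (hr k j)).symm
    rw [h1]
    refine cfc_congr fun l hl => ?_
    obtain ⟨hl0, -⟩ := h.mem_spectrum_real_inv hl
    rcases hl0.eq_or_lt with rfl | hl0
    · simp [r, arcFun, thermalFun]
    have h2 := sum_arc_eq hpn l⁻¹ (show (i : ℕ) ≤ j from hij) j.2.le
    rw [Finset.sum_range, hpi, hpi] at h2
    have h3 := (one_sub_exp_mul_inv_pos hβ hl0).ne'
    have h4 : ∀ k : Fin n, r k i l * r k j l = (l * (1 - Real.exp (-(β * l⁻¹)))⁻¹) ^ 2 *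
        ((1 - Real.exp (-(2 * (p (k + 1) - p k) * l⁻¹))) *
        (Real.exp (-(arcDist β p k i * l⁻¹)) * Real.exp (-(arcDist β p k j * l⁻¹)))) := fun k => by
      have h5 : √(1 - Real.exp (-(2 * (p (k + 1) - p k) * l⁻¹))) ^ 2 =
          1 - Real.exp (-(2 * (p (k + 1) - p k) * l⁻¹)) := by
        refine Real.sq_sqrt (sub_nonneg.2 (Real.exp_le_one_iff.2 ?_))
        have := hδ k
        have : 0 ≤ 2 * (p (k + 1) - p k) * l⁻¹ := by positivity
        linarith
      rw [← h5]
      simp only [r, arcFun]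
      ring
    simp only [h4]
    rw [← Finset.mul_sum, h2]
    simp only [thermalFun]
    field_simp
  -- One vector per arc, summed over all points. Linearity in u is what later turns differences of
  -- field configurations into differences of vectors.
  let R : Fin n → (Fin n → X) →ₗ[ℂ] X := fun k =>
    ∑ i, ((cfc (r k i) h.inv : X →L[ℂ] X) : X →ₗ[ℂ] X).comp (LinearMap.proj i)
  have hR : ∀ k u, R k u = ∑ i, cfc (r k i) h.inv (u i) := fun k u => by
    simp [R, LinearMap.sum_apply]
  refine ⟨R, fun u hu => ?_⟩
  have hT : ∀ i j, i ≤ j → ⟪u i, M i j (u j)⟫_ℂ =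
      h.twoPoint β (u i) (u j) (Complex.I * (s j - s i)) := fun i j hij => by
    have := h.twoPoint_I_mul hβ hκ hcomm (sub_nonneg.2 (hs hij)) (hsβ i j) (hu i) (hu j)
    rw [hM i j hij, ← this]
    push_cast
    rfl
  have hTs : ∀ i j, i ≤ j → ⟪u i, M i j (u j)⟫_ℂ = ⟪u j, M j i (u i)⟫_ℂ := fun i j hij => by
    rw [hMs j i, hM i j hij, h.inner_cfc_comm hκ hcomm _ ?_ (hu i) (hu j)]
    exact (h.continuousOn_thermalFun hβ (sub_nonneg.2 (hs hij))).add
      (h.continuousOn_thermalFun hβ (sub_nonneg.2 (hsβ i j)))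
  have hsum : ((∑ k, ‖R k u‖ ^ 2 : ℝ) : ℂ) = ∑ i, ∑ j, ⟪u i, M i j (u j)⟫_ℂ := by
    have hsa : ∀ k i x y, ⟪cfc (r k i) h.inv x, y⟫_ℂ = ⟪x, cfc (r k i) h.inv y⟫_ℂ :=
      fun k i => ContinuousLinearMap.isSelfAdjoint_iff_isSymmetric.1 IsSelfAdjoint.cfc
    have h1 : ∀ k, ((‖R k u‖ ^ 2 : ℝ) : ℂ) =
        ∑ i, ∑ j, ⟪u i, (cfc (r k i) h.inv * cfc (r k j) h.inv) (u j)⟫_ℂ := fun k => by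
      have := inner_self_eq_norm_sq_to_K (𝕜 := ℂ) (R k u)
      rw [Complex.ofReal_pow]
      refine this.symm.trans ?_
      rw [hR, sum_inner]
      refine Finset.sum_congr rfl fun i _ => ?_
      rw [inner_sum]
      refine Finset.sum_congr rfl fun j _ => ?_
      rw [hsa]; rfl
    rw [Complex.ofReal_sum, Finset.sum_congr rfl fun k _ => h1 k, Finset.sum_comm]
    refine Finset.sum_congr rfl fun i _ => ?_
    rw [Finset.sum_comm]
    refine Finset.sum_congr rfl fun j _ => ?_
    rw [← inner_sum, ← sum_apply]
  rw [hsum, sum_sum_eq_of_symm (T := fun i j => ⟪u i, M i j (u j)⟫_ℂ) fun i j => ?_]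
  · congr 1
    · refine Finset.sum_congr rfl fun i _ => ?_
      rw [hT i i le_rfl, sub_self, mul_zero]
    · congr 1
      refine Finset.sum_congr rfl fun i _ => Finset.sum_congr rfl fun j _ => ?_
      split_ifs with hij
      · rw [hT i j hij.le]
      · rfl
  · rcases le_total i j with hij | hij
    · exact hTs i j hij
    · exact (hTs j i hij).symm

end Gram

/-! ### Vacuum expectations and strong continuity of Weyl operators -/

section WeylExpectation

variable {X : Type*} [NormedAddCommGroup X] [InnerProductSpace ℂ X]
variable {ρ : X →L[ℂ] X}

theorem weylFunctional_eq (x : X) : weylFunctional ρ x = Complex.exp (-(1 / 4) * covForm ρ x x) := by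
  rw [weylFunctional, covForm, inner_add_right, inner_smul_right, two_mul, add_assoc]

theorem covForm_add_left (x y z : X) : covForm ρ (x + y) z = covForm ρ x z + covForm ρ y z := by
  simp only [covForm, inner_add_left, map_add, inner_add_right]; ring

theorem covForm_add_right (x y z : X) : covForm ρ x (y + z) = covForm ρ x y + covForm ρ x z := by
  simp only [covForm, inner_add_left, map_add, inner_add_right]; ring

theorem covForm_sum_right {n : ℕ} (x : X) (y : Fin n → X) :
    covForm ρ x (∑ i, y i) = ∑ i, covForm ρ x (y i) := by
  simp only [covForm, map_sum, sum_inner, inner_sum, Finset.sum_add_distrib]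

theorem continuous_covForm : Continuous fun p : X × X => covForm ρ p.1 p.2 := by
  unfold covForm
  fun_prop

variable [CompleteSpace X]

/-- Polarization yields -¼(cov(x,y) + cov(y,x)), while cov(x,y) - cov(y,x) = 2i Im(x,y). The Weyl
phase therefore completes the exponent to -½ cov(x,y), which remembers the order of the factors. -/
theorem weylFunctional_add (hρ : 0 ≤ ρ) (x y : X) :
    Complex.exp (-(Complex.I / 2 * ((⟪x, y⟫_ℂ).im : ℂ))) * weylFunctional ρ (x + y) =
      weylFunctional ρ x * weylFunctional ρ y * Complex.exp (-(1 / 2) * covForm ρ x y) := by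
  have hs := ContinuousLinearMap.isSelfAdjoint_iff_isSymmetric.1 (IsSelfAdjoint.of_nonneg hρ)
  have h1 : ⟪x, ρ y⟫_ℂ = ⟪ρ x, y⟫_ℂ := (hs x y).symm
  have h2 : ⟪y, ρ x⟫_ℂ = ⟪ρ y, x⟫_ℂ := (hs y x).symm
  have e1 : Complex.I * ((⟪x, y⟫_ℂ).im : ℂ) = (⟪x, y⟫_ℂ - ⟪y, x⟫_ℂ) / 2 := by
    rw [← inner_conj_symm y x, Complex.sub_conj]; push_cast; ring
  simp only [weylFunctional_eq, ← Complex.exp_add]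
  congr 1
  simp only [covForm_add_left, covForm_add_right]
  simp only [covForm]
  linear_combination (-(1 / 2 : ℂ)) * e1

variable (hρ : 0 ≤ ρ)

theorem star_weyl (x : X) : star (weyl hρ x) = weyl hρ (-x) := by
  have h1 : weyl hρ x * weyl hρ (-x) = 1 := by
    have h0 : (⟪x, x⟫_ℂ).im = 0 := inner_self_im (𝕜 := ℂ) x
    rw [weyl_mul, add_neg_cancel, weyl_zero, inner_neg_right, Complex.neg_im, h0]
    simp
  calc star (weyl hρ x) = star (weyl hρ x) * (weyl hρ x * weyl hρ (-x)) := by rw [h1, mul_one]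
    _ = weyl hρ (-x) := by
      rw [← mul_assoc, (Unitary.mem_iff.1 (weyl_mem_unitary hρ x)).1, one_mul]

/-- The vacuum expectation of a product of Weyl operators. -/
theorem inner_vacuum_weyl_prod {n : ℕ} (y : Fin n → X) :
    ⟪vacuum hρ, (List.ofFn fun i => weyl hρ (y i)).prod (vacuum hρ)⟫_ℂ =
      Complex.exp (-(1 / 4) * ∑ i, covForm ρ (y i) (y i) -
        1 / 2 * ∑ i, ∑ j, if i < j then covForm ρ (y i) (y j) else 0) := by
  -- A product of Weyl operators is a scalar times a single one; the induction peels off the first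
  -- factor and follows the scalar.
  have key : ∃ c : ℂ, (List.ofFn fun i => weyl hρ (y i)).prod = c • weyl hρ (∑ i, y i) ∧
      c * weylFunctional ρ (∑ i, y i) = Complex.exp (-(1 / 4) * ∑ i, covForm ρ (y i) (y i) -
        1 / 2 * ∑ i, ∑ j, if i < j then covForm ρ (y i) (y j) else 0) := by
    induction n with
    | zero => exact ⟨1, by simp [weyl_zero], by simp [weylFunctional_eq, covForm]⟩
    | succ n ih =>
      obtain ⟨c, hc1, hc2⟩ := ih fun i => y i.succ
      refine ⟨c * Complex.exp (-(Complex.I / 2 *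
        ((⟪y 0, ∑ i : Fin n, y i.succ⟫_ℂ).im : ℂ))), ?_, ?_⟩
      · rw [List.ofFn_succ, List.prod_cons, hc1, mul_smul_comm, weyl_mul, smul_smul,
          Fin.sum_univ_succ]
      · rw [Fin.sum_univ_succ, mul_assoc, weylFunctional_add hρ, covForm_sum_right,
          show ∀ a b d : ℂ, c * (a * b * d) = c * b * (a * d) from fun a b d => by ring, hc2,
          weylFunctional_eq, ← Complex.exp_add, ← Complex.exp_add]
        congr 1
        simp only [Fin.sum_univ_succ, Fin.succ_lt_succ_iff, if_false, Fin.succ_pos, if_true,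
          Fin.not_lt_zero, zero_add]
        ring
  obtain ⟨c, hc1, hc2⟩ := key
  rw [hc1, ← hc2, FunLike.coe_smul, Pi.smul_apply, inner_smul_right, inner_vacuum_weyl]

theorem continuous_coherentVec : Continuous (coherentVec hρ) := by
  have hK : Continuous fun p : X × X => weylKernel ρ p.1 p.2 := by
    simp only [weylKernel, Matrix.of_apply, weylFunctional_eq]
    have := continuous_covForm (ρ := ρ)
    have h2 : Continuous fun p : X × X => covForm ρ (p.2 - p.1) (p.2 - p.1) :=
      this.comp (by fun_prop : Continuous fun p : X × X => (p.2 - p.1, p.2 - p.1))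
    fun_prop
  rw [continuous_iff_continuousAt]
  intro x
  rw [ContinuousAt, tendsto_iff_norm_sub_tendsto_zero]
  have e : ∀ y, ‖coherentVec hρ y - coherentVec hρ x‖ = √((weylKernel ρ y y - weylKernel ρ y x
      - weylKernel ρ x y + weylKernel ρ x x).re) := fun y => by
    rw [@norm_eq_sqrt_re_inner ℂ, inner_sub_left, inner_sub_right, inner_sub_right,
      inner_kernelVec, inner_kernelVec, inner_kernelVec, inner_kernelVec]
    congr 1
    simp only [map_sub, Complex.sub_re, Complex.add_re, RCLike.re_to_complex]
    ring
  simp only [e]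
  have c : Continuous fun y => √((weylKernel ρ y y - weylKernel ρ y x
      - weylKernel ρ x y + weylKernel ρ x x).re) := by
    have c1 : Continuous fun y => weylKernel ρ y y :=
      hK.comp (by fun_prop : Continuous fun y : X => (y, y))
    have c2 : Continuous fun y => weylKernel ρ y x :=
      hK.comp (by fun_prop : Continuous fun y : X => (y, x))
    have c3 : Continuous fun y => weylKernel ρ x y :=
      hK.comp (by fun_prop : Continuous fun y : X => (x, y))
    exact (Complex.continuous_re.comp (((c1.sub c2).sub c3).add continuous_const)).sqrt
  have := c.tendsto x
  simpa using this

theorem norm_apply_of_mem_unitary {H : Type*} [NormedAddCommGroup H] [InnerProductSpace ℂ H]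
    [CompleteSpace H] {U : H →L[ℂ] H} (hU : U ∈ unitary (H →L[ℂ] H)) (v : H) : ‖U v‖ = ‖v‖ := by
  have := (ContinuousLinearMap.norm_map_iff_adjoint_comp_self U).2
    (by rw [← ContinuousLinearMap.star_eq_adjoint]; exact (Unitary.mem_iff.1 hU).1)
  exact this v

/-- Isometries are equicontinuous, so strong continuity need only be checked on the vectors spanning
a dense subspace. -/
theorem continuous_apply_toKernelSpace {P ι : Type*} [TopologicalSpace P] {K : Matrix ι ι ℂ}
    (hK : K.PosSemidef) {F : Type*} [NormedAddCommGroup F] [NormedSpace ℂ F]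
    {f : P → (KernelSpace hK →L[ℂ] F)} (hf : ∀ p v, ‖f p v‖ = ‖v‖)
    (hc : ∀ x, Continuous fun p => f p (kernelVec hK x)) (v : KernelSpace hK) :
    Continuous fun p => f p v := by
  refine continuous_apply_of_denseRange (denseRange_toKernelSpace hK) (f := fun p v => f p v)
    (fun p x y => by rw [← map_sub, hf]) (fun g => ?_) v
  induction g using Finsupp.induction_linear with
  | zero => simpa using continuous_const
  | add f g hf hg => simp only [map_add]; fun_prop
  | single x c =>
    have := hc x
    simp only [toKernelSpace_single, map_smul]; fun_prop

/-- The Weyl operators are strongly continuous. -/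
theorem continuous_weyl_apply (v : FieldSpace hρ) : Continuous fun x => weyl hρ x v := by
  refine continuous_apply_toKernelSpace _
    (fun x v => norm_apply_of_mem_unitary (weyl_mem_unitary hρ x) v) (fun y => ?_) v
  simp only [weyl_coherentVec]
  have := (continuous_coherentVec hρ).comp (continuous_add_const y)
  have h2 : Continuous fun x : X =>
      Complex.exp (-(Complex.I / 2 * ((⟪x, y⟫_ℂ).im : ℂ))) := by fun_prop
  exact h2.smul this

end WeylExpectation

/-! ### Green's functions of Weyl operators at complex times -/

section GreenWeyl

variable {X : Type*} [NormedAddCommGroup X] [InnerProductSpace ℂ X] [CompleteSpace X]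
variable {a : X →ₗ.[ℂ] X} {m β : ℝ} (h : IsSelfAdjointGE a m)

/-- The Weyl operator `W_ω(a⁻¹ x)`. -/
noncomputable def smoothWeyl (hβ : 0 < β) (x : X) : ThermalSpace h hβ →L[ℂ] ThermalSpace h hβ :=
  weyl (h.rho_nonneg hβ) (h.inv x)

/-- The Green's function of the Weyl operators `W_ω(a⁻¹ uᵢ)` at complex times. -/
noncomputable def greenWeyl (β : ℝ) {n : ℕ} (u : Fin n → X) (z : Fin n → ℂ) : ℂ :=
  Complex.exp (-(1 / 4) * ∑ i, h.twoPoint β (u i) (u i) 0 -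
    1 / 2 * ∑ i, ∑ j, if i < j then h.twoPoint β (u i) (u j) (z j - z i) else 0)

theorem sub_im_of_mem_closedTube {n : ℕ} {z : Fin n → ℂ} (hz : z ∈ closedTube β n) {i j : Fin n}
    (hij : i < j) : 0 ≤ (z j - z i).im ∧ (z j - z i).im ≤ β := by
  rw [Complex.sub_im, sub_nonneg]
  exact hz i j hij.le

/-- Only differences z j - z i with i < j occur, and on the closed tube these lie in the closed
strip, where the two-point function is differentiable up to the edges. -/
theorem differentiableOn_greenWeyl (hβ : 0 < β) {n : ℕ} (u : Fin n → X) :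
    DifferentiableOn ℂ (greenWeyl h β u) (closedTube β n) := by
  refine DifferentiableOn.cexp (DifferentiableOn.sub (by fun_prop) (DifferentiableOn.const_mul ?_ _))
  refine DifferentiableOn.fun_sum fun i _ => DifferentiableOn.fun_sum fun j _ => ?_
  split_ifs with hij
  · exact (h.differentiableOn_twoPoint hβ (u i) (u j)).comp (f := fun z : Fin n → ℂ => z j - z i)
      (by fun_prop) fun z hz => sub_im_of_mem_closedTube hz hij
  · fun_prop

theorem exists_norm_greenWeyl_le (hβ : 0 < β) {n : ℕ} (u : Fin n → X) :
    ∃ C, ∀ z ∈ closedTube β n, ‖greenWeyl h β u z‖ ≤ C := by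
  choose C hC using fun i j => h.exists_norm_twoPoint_le hβ (u i) (u j)
  refine ⟨Real.exp (‖-(1 / 4) * ∑ i, h.twoPoint β (u i) (u i) 0‖ + 1 / 2 * ∑ i, ∑ j, |C i j|),
    fun z hz => ?_⟩
  rw [greenWeyl, Complex.norm_exp]
  refine Real.exp_le_exp.2 ((Complex.re_le_norm _).trans ((norm_sub_le _ _).trans ?_))
  gcongr
  rw [norm_mul]
  refine mul_le_mul (by simp) ?_ (norm_nonneg _) (by norm_num)
  refine (norm_sum_le _ _).trans (Finset.sum_le_sum fun i _ => ?_)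
  refine (norm_sum_le _ _).trans (Finset.sum_le_sum fun j _ => ?_)
  split_ifs with hij
  · obtain ⟨h1, h2⟩ := sub_im_of_mem_closedTube hz hij
    exact (hC i j _ h1 h2).trans (le_abs_self _)
  · simp

theorem greenWeyl_add_const {n : ℕ} (u : Fin n → X) (z : Fin n → ℂ) (c : ℂ) :
    greenWeyl h β u (fun i => z i + c) = greenWeyl h β u z := by
  simp only [greenWeyl, add_sub_add_right_eq_sub]

/-- The cyclic rotation of `Fin n` by `k`. -/
def rotation {n k : ℕ} (hk : k ≤ n) : Equiv.Perm (Fin n) where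
  toFun i := if hi : i.val < n - k then ⟨i + k, by omega⟩ else ⟨i - (n - k), by omega⟩
  invFun i := if hi : k ≤ i.val then ⟨i - k, by omega⟩ else ⟨i + (n - k), by omega⟩
  left_inv i := by
    ext
    have := i.2
    dsimp only
    split_ifs with h1 h2 h2 <;> first | omega | (dsimp only at h2 ⊢; omega)
  right_inv i := by
    ext
    have := i.2
    dsimp only
    split_ifs with h1 h2 h2 <;> first | omega | (dsimp only at h2 ⊢; omega)

theorem rotation_self (n : ℕ) : rotation (le_refl n) = 1 := by
  ext i; simp [rotation]

theorem rotation_symm_lt {n k : ℕ} (hk : k ≤ n) {i j : Fin n} (hij : i < j) :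
    (rotation hk).symm i < (rotation hk).symm j ↔ ¬ (i.val < k ∧ k ≤ j.val) := by
  have hij' : i.val < j.val := hij
  have hi := i.2
  have hj := j.2
  simp only [rotation, Equiv.coe_fn_symm_mk]
  split_ifs <;> simp only [Fin.lt_def] <;> omega

theorem sum_sum_perm_eq {n : ℕ} (σ : Equiv.Perm (Fin n)) (F : Fin n → Fin n → ℂ) :
    ∑ i, ∑ j, (if i < j then F (σ i) (σ j) else 0) =
      ∑ i, ∑ j, if i < j then (if σ.symm i < σ.symm j then F i j else F j i) else 0 := by
  have h1 : ∑ i, ∑ j, (if i < j then F (σ i) (σ j) else 0) =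
      ∑ i, ∑ j, if σ.symm i < σ.symm j then F i j else 0 := by
    refine Eq.symm ?_
    rw [← Equiv.sum_comp σ]
    refine Finset.sum_congr rfl fun i _ => ?_
    rw [← Equiv.sum_comp σ]
    simp only [Equiv.symm_apply_apply]
  have h2 : ∑ i, ∑ j, (if j < i then (if σ.symm i < σ.symm j then F i j else 0) else 0) =
      ∑ i, ∑ j, if i < j then (if σ.symm i < σ.symm j then 0 else F j i) else 0 := by
    rw [Finset.sum_comm]
    refine Finset.sum_congr rfl fun i _ => Finset.sum_congr rfl fun j _ => ?_
    by_cases hij : i < j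
    · have hne : σ.symm i ≠ σ.symm j := fun e => hij.ne (σ.symm.injective e)
      rcases hne.lt_or_gt with h | h
      · simp [hij, h, h.not_gt]
      · simp [hij, h, h.not_gt]
    · simp [hij]
  have h3 : ∑ i, ∑ j, (if σ.symm i < σ.symm j then F i j else 0) =
      ∑ i, ∑ j, (if i < j then (if σ.symm i < σ.symm j then F i j else 0) else 0) +
      ∑ i, ∑ j, (if j < i then (if σ.symm i < σ.symm j then F i j else 0) else 0) := by
    simp only [← Finset.sum_add_distrib]
    refine Finset.sum_congr rfl fun i _ => Finset.sum_congr rfl fun j _ => ?_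
    rcases lt_trichotomy i j with h | rfl | h
    · simp [h, h.not_gt]
    · simp
    · simp [h, h.not_gt]
  rw [h1, h3, h2]
  simp only [← Finset.sum_add_distrib]
  refine Finset.sum_congr rfl fun i _ => Finset.sum_congr rfl fun j _ => ?_
  split_ifs <;> simp

/-- Operators at imaginary time β move, in their order, to the left of those at imaginary time 0. A
pair i < k ≤ j has difference of imaginary part β, where `twoPoint_swap` reverses its order; the
other pairs keep theirs. -/
theorem greenWeyl_eq_of_timeVertex (hβ : 0 < β) {n k : ℕ} (hk : k ≤ n) (u : Fin n → X) {z : Fin n → ℂ}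
    (hz : ∀ i, (z i).im = timeVertex β n k i) :
    greenWeyl h β u z = thermalState h hβ (List.ofFn fun i => dynamics h hβ
      (z (rotation hk i)).re (smoothWeyl h hβ (u (rotation hk i)))).prod := by
  set σ := rotation hk
  let y : Fin n → X := fun i => h.expI (z i).re (h.inv (u i))
  have hcov : ∀ i j, covForm (h.rho β) (y i) (y j) =
      h.twoPoint β (u i) (u j) ((z j).re - (z i).re) := fun i j => h.covForm_expI hβ _ _ _ _
  have h1 : ∀ i, dynamics h hβ (z i).re (smoothWeyl h hβ (u i)) =
      weyl (h.rho_nonneg hβ) (y i) := fun i => dynamics_weyl h hβ _ _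
  simp only [h1]
  refine Eq.trans ?_ (inner_vacuum_weyl_prod (h.rho_nonneg hβ) fun i => y (σ i)).symm
  rw [greenWeyl, sum_sum_perm_eq σ fun i j => covForm (h.rho β) (y i) (y j),
    Equiv.sum_comp σ fun i => covForm (h.rho β) (y i) (y i)]
  congr 2
  · simp only [hcov, sub_self]
  · congr 1
    refine Finset.sum_congr rfl fun i _ => Finset.sum_congr rfl fun j _ => ?_
    split_ifs with hij hσ
    · rw [hcov]
      congr 1
      rw [rotation_symm_lt hk hij] at hσ
      have : (z j).im = (z i).im := by
        have hij' : i.val < j.val := hij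
        rw [hz, hz, timeVertex, timeVertex]
        split_ifs <;> first | rfl | omega
      refine Complex.ext (by simp) (by simp [this])
    · rw [hcov, ← h.twoPoint_swap]
      congr 1
      rw [rotation_symm_lt hk hij, not_not] at hσ
      have h2 : (z j).im = β := by rw [hz, timeVertex, if_neg (by omega)]
      have h3 : (z i).im = 0 := by rw [hz, timeVertex, if_pos hσ.1]
      refine Complex.ext (by simp) (by simp [h2, h3])
    · rfl

end GreenWeyl

/-! ### Linear combinations of Weyl operators and Euclidean positivity -/

section GreenSum

theorem inner_im_eq_zero_of_fixed {X : Type*} [NormedAddCommGroup X] [InnerProductSpace ℂ X]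
    {κ : X ≃ₗᵢ⋆[ℂ] X} {x y : X} (hx : κ x = x) (hy : κ y = y) :
    (⟪x, y⟫_ℂ).im = 0 := by
  have := inner_map_map_conj κ x y
  rw [hx, hy, ← inner_conj_symm y x] at this
  exact Complex.conj_eq_iff_im.1 this.symm

variable {X : Type*} [NormedAddCommGroup X] [InnerProductSpace ℂ X] [CompleteSpace X]
variable {a : X →ₗ.[ℂ] X} {m β : ℝ} (h : IsSelfAdjointGE a m) (hβ : 0 < β)
variable {ε : Type*} [Fintype ε] {n : ℕ}

/-- The linear combination `∑ cₑ W_ω(a⁻¹ uₑ)` of Weyl operators. -/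
noncomputable def weylSum (c : ε → ℂ) (u : ε → X) : ThermalSpace h hβ →L[ℂ] ThermalSpace h hβ :=
  ∑ e, c e • smoothWeyl h hβ (u e)

/-- The Green's function of linear combinations of Weyl operators at complex times. -/
noncomputable def greenSum (β : ℝ) (c : Fin n → ε → ℂ) (u : Fin n → ε → X) (z : Fin n → ℂ) : ℂ :=
  ∑ p : Fin n → ε, (∏ i, c i (p i)) * greenWeyl h β (fun i => u i (p i)) z

theorem differentiableOn_greenSum (hβ : 0 < β) (c : Fin n → ε → ℂ) (u : Fin n → ε → X) :
    DifferentiableOn ℂ (greenSum h β c u) (closedTube β n) :=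
  DifferentiableOn.fun_sum fun _ _ => (differentiableOn_greenWeyl h hβ _).const_mul _

theorem exists_norm_greenSum_le (hβ : 0 < β) (c : Fin n → ε → ℂ) (u : Fin n → ε → X) :
    ∃ C, ∀ z ∈ closedTube β n, ‖greenSum h β c u z‖ ≤ C := by
  choose C hC using fun p : Fin n → ε => exists_norm_greenWeyl_le h hβ fun i => u i (p i)
  refine ⟨∑ p : Fin n → ε, ‖∏ i, c i (p i)‖ * C p, fun z hz => ?_⟩
  refine (norm_sum_le _ _).trans (Finset.sum_le_sum fun p _ => ?_)
  rw [norm_mul]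
  exact mul_le_mul_of_nonneg_left (hC p z hz) (norm_nonneg _)

theorem greenSum_add_const (c : Fin n → ε → ℂ) (u : Fin n → ε → X) (z : Fin n → ℂ) (w : ℂ) :
    greenSum h β c u (fun i => z i + w) = greenSum h β c u z := by
  simp only [greenSum, greenWeyl_add_const]

theorem greenSum_eq_of_timeVertex {k : ℕ} (hk : k ≤ n) (c : Fin n → ε → ℂ) (u : Fin n → ε → X)
    {z : Fin n → ℂ} (hz : ∀ i, (z i).im = timeVertex β n k i) :
    greenSum h β c u z = thermalState h hβ (List.ofFn fun i => dynamics h hβ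
      (z (rotation hk i)).re (weylSum h hβ (c (rotation hk i)) (u (rotation hk i)))).prod := by
  classical
  set σ := rotation hk
  have h1 : (List.ofFn fun i => dynamics h hβ (z (σ i)).re
      (weylSum h hβ (c (σ i)) (u (σ i)))).prod =
      ∑ p : Fin n → ε, (∏ i, c (σ i) (p i)) • (List.ofFn fun i => dynamics h hβ (z (σ i)).re
        (smoothWeyl h hβ (u (σ i) (p i)))).prod := by
    simp only [weylSum, map_sum, map_smul]
    have := (MultilinearMap.mkPiAlgebraFin ℂ n
      (ThermalSpace h hβ →L[ℂ] ThermalSpace h hβ)).map_sum fun i e =>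
        c (σ i) e • dynamics h hβ (z (σ i)).re (smoothWeyl h hβ (u (σ i) e))
    rw [MultilinearMap.mkPiAlgebraFin_apply] at this
    rw [this]
    refine Finset.sum_congr rfl fun p _ => ?_
    rw [MultilinearMap.map_smul_univ, MultilinearMap.mkPiAlgebraFin_apply]
  rw [h1, map_sum, greenSum]
  refine Eq.trans ?_ (Equiv.sum_comp (Equiv.arrowCongr σ.symm (Equiv.refl ε)) _)
  refine Finset.sum_congr rfl fun p _ => ?_
  rw [map_smul, greenWeyl_eq_of_timeVertex h hβ hk _ hz, smul_eq_mul,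
    ← Equiv.prod_comp σ fun i => c i (p i)]
  rfl

/-- Expanding the square leaves the entrywise exponential of a Gram kernel plus its transpose, times
a rank-one kernel; Schur products keep positivity. -/
theorem posSemidef_gaussian {ι H κ : Type*} [NormedAddCommGroup H] [InnerProductSpace ℂ H]
    [CompleteSpace H] [Fintype κ] (v : κ → ι → H) :
    Matrix.PosSemidef (Matrix.of fun i j =>
      Complex.exp (-(1 / 4) * ((∑ k, ‖v k j - v k i‖ ^ 2 : ℝ) : ℂ))) := by
  have h1 : (0 : H →L[ℂ] H) ≤ 1 := zero_le_one
  have hL : Matrix.PosSemidef (∑ k, (1 / 4 : ℝ) •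
      ((Matrix.of fun i j => ⟪v k i, (1 : H →L[ℂ] H) (v k j)⟫_ℂ) +
        (Matrix.of fun i j => ⟪v k i, (1 : H →L[ℂ] H) (v k j)⟫_ℂ).transpose)) :=
    Matrix.posSemidef_sum _ fun k _ => ((posSemidef_gram 1 h1 (v k)).add
      (posSemidef_gram 1 h1 (v k)).transpose).smul (by norm_num)
  have := (posSemidef_exp hL).hadamard (posSemidef_rankOne
    (fun i => Complex.exp (-(1 / 4) * ((∑ k, ‖v k i‖ ^ 2 : ℝ) : ℂ))))
  refine (congrArg Matrix.PosSemidef ?_).mpr this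
  ext i j
  have e : ∀ k, ((‖v k j - v k i‖ ^ 2 : ℝ) : ℂ) =
      ((‖v k j‖ ^ 2 : ℝ) : ℂ) + ((‖v k i‖ ^ 2 : ℝ) : ℂ) - (⟪v k i, v k j⟫_ℂ + ⟪v k j, v k i⟫_ℂ) := by
    intro k
    have h1 : ∀ w : H, ((‖w‖ ^ 2 : ℝ) : ℂ) = ⟪w, w⟫_ℂ := fun w => by
      rw [Complex.ofReal_pow]; exact (inner_self_eq_norm_sq_to_K (𝕜 := ℂ) w).symm
    rw [h1, h1, h1, inner_sub_left, inner_sub_right, inner_sub_right]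
    ring
  simp only [Matrix.hadamard_apply, Matrix.of_apply, ← Complex.exp_conj, ← Complex.exp_add,
    Matrix.sum_apply, Matrix.smul_apply, Matrix.add_apply, Matrix.transpose_apply,
    one_apply_eq_self, map_mul, Complex.conj_ofReal]
  congr 1
  rw [Complex.ofReal_sum, Finset.sum_congr rfl fun k _ => e k]
  simp only [Finset.sum_sub_distrib, Finset.sum_add_distrib, Complex.real_smul, ← Finset.mul_sum,
    map_neg, map_div₀, map_one, map_ofNat, Complex.ofReal_sum]
  push_cast
  ring

variable {κ : X ≃ₗᵢ⋆[ℂ] X}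

/-- The coefficients are those of squares C* C, whose Weyl arguments are differences u_q - u_p. As
R_k is linear, the value is a quadratic form, indexed by tuples p, q, of the kernel exp(-¼ ∑ ‖R_k
u_q - R_k u_p‖²). -/
theorem greenSum_nonneg (hβ : 0 < β) (hκ : ∀ x, κ (κ x) = x) (hcomm : CommutesWith a κ)
    {s : Fin n → ℝ} (hs : Monotone s) (hsβ : ∀ i j, s j - s i ≤ β) (c : Fin n → ε → ℂ)
    (u : Fin n → ε → X) (hu : ∀ i e, κ (u i e) = u i e) :
    0 ≤ greenSum h β (fun i (e : ε × ε) => star (c i e.1) * c i e.2)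
      (fun i e => u i e.2 - u i e.1) (fun i => Complex.I * s i) := by
  obtain ⟨R, hR⟩ := h.exists_gram hβ hκ hcomm hs hsβ
  have hG : ∀ v : Fin n → X, (∀ i, κ (v i) = v i) →
      greenWeyl h β v (fun i => Complex.I * s i) =
        Complex.exp (-(1 / 4) * ((∑ k, ‖R k v‖ ^ 2 : ℝ) : ℂ)) := fun v hv => by
    rw [← hR v hv, greenWeyl]
    simp only [← mul_sub]
    congr 1
    ring
  have hK := posSemidef_gaussian fun (k : Fin n) (p : Fin n → ε) => R k fun i => u i (p i)
  have h0 := hK.2 (Finsupp.equivFunOnFinite.symm fun p : Fin n → ε => ∏ i, c i (p i))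
  refine h0.trans_eq ?_
  rw [Finsupp.sum_fintype _ _ (by simp)]
  -- A tuple of pairs is a pair of tuples: the first components label the adjoint factors, the
  -- second the others.
  rw [greenSum, ← Equiv.sum_comp (Equiv.arrowProdEquivProdArrow (Fin n) (fun _ => ε) (fun _ => ε)).symm,
    Fintype.sum_prod_type]
  refine Finset.sum_congr rfl fun p _ => ?_
  rw [Finsupp.sum_fintype _ _ (by simp)]
  refine Finset.sum_congr rfl fun q _ => ?_
  rw [hG _ fun i => by rw [map_sub, hu, hu]]
  simp only [Finsupp.equivFunOnFinite_symm_apply_apply, Matrix.of_apply, ← map_sub, star_prod]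
  rw [mul_right_comm, ← Finset.prod_mul_distrib]
  rfl

theorem smoothWeyl_mul_of_fixed (hcomm : CommutesWith a κ) {x y : X} (hx : κ x = x)
    (hy : κ y = y) :
    smoothWeyl h hβ x * smoothWeyl h hβ y = smoothWeyl h hβ (x + y) := by
  rw [smoothWeyl, smoothWeyl, weyl_mul, inner_im_eq_zero_of_fixed (κ := κ)
    (by rw [h.conj_inv hcomm, hx]) (by rw [h.conj_inv hcomm, hy]), smoothWeyl, map_add]
  simp

theorem star_smoothWeyl (x : X) : star (smoothWeyl h hβ x) = smoothWeyl h hβ (-x) := by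
  rw [smoothWeyl, star_weyl, smoothWeyl, map_neg]

theorem star_weylSum_mul_self (hcomm : CommutesWith a κ) (c : ε → ℂ) {u : ε → X}
    (hu : ∀ e, κ (u e) = u e) : star (weylSum h hβ c u) * weylSum h hβ c u =
      weylSum h hβ (fun e : ε × ε => star (c e.1) * c e.2) (fun e => u e.2 - u e.1) := by
  simp only [weylSum, star_sum, star_smul, Finset.sum_mul_sum, Fintype.sum_prod_type, smul_mul_smul,
    star_smoothWeyl]
  refine Finset.sum_congr rfl fun e _ => Finset.sum_congr rfl fun f _ => ?_
  rw [smoothWeyl_mul_of_fixed h hβ hcomm (by rw [map_neg, hu]) (hu f), neg_add_eq_sub]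

end GreenSum

/-! ### The smooth Weyl algebra generates the von Neumann algebras -/

section SmoothAlgebra

variable {X : Type*} [NormedAddCommGroup X] [InnerProductSpace ℂ X] [CompleteSpace X]
variable {a : X →ₗ.[ℂ] X} {m β : ℝ} (h : IsSelfAdjointGE a m) (hβ : 0 < β)

/-- The `*`-algebra spanned by the Weyl operators `W_ω(a⁻¹ y)`, `y ∈ Y`. -/
noncomputable def smoothAlgebra (Y : AddSubgroup X) :
    StarSubalgebra ℂ (ThermalSpace h hβ →L[ℂ] ThermalSpace h hβ) where
  carrier := Submodule.span ℂ (smoothWeyl h hβ '' Y)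
  mul_mem' {A B} hA hB := by
    have : A * B ∈ Submodule.span ℂ (smoothWeyl h hβ '' Y) * Submodule.span ℂ (smoothWeyl h hβ '' Y) :=
      Submodule.mul_mem_mul hA hB
    rw [Submodule.span_mul_span] at this
    refine Submodule.span_le.2 ?_ this
    rintro _ ⟨_, ⟨x, hx, rfl⟩, _, ⟨y, hy, rfl⟩, rfl⟩
    simp only [smoothWeyl]
    rw [weyl_mul, ← map_add]
    exact Submodule.smul_mem _ _ (Submodule.subset_span ⟨x + y, Y.add_mem hx hy, rfl⟩)
  add_mem' hA hB := add_mem hA hB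
  algebraMap_mem' r := by
    have h1 : smoothWeyl h hβ 0 = 1 := by rw [smoothWeyl, map_zero, weyl_zero]
    rw [Algebra.algebraMap_eq_smul_one, ← h1]
    exact Submodule.smul_mem _ _ (Submodule.subset_span ⟨0, Y.zero_mem, rfl⟩)
  star_mem' {A} hA := by
    refine Submodule.span_induction (p := fun A _ => star A ∈ Submodule.span ℂ
      (smoothWeyl h hβ '' Y)) ?_ ?_ ?_ ?_ hA
    · rintro _ ⟨x, hx, rfl⟩
      rw [star_smoothWeyl]
      exact Submodule.subset_span ⟨-x, Y.neg_mem hx, rfl⟩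
    · simp
    · intro A B _ _ hA hB
      rw [star_add]; exact add_mem hA hB
    · intro c A _ hA
      rw [star_smul]; exact Submodule.smul_mem _ _ hA

/-- All operators are expanded over one common finite set, as `greenSum` needs a single index type
for all its factors. -/
theorem exists_eq_weylSum {Y : AddSubgroup X} {n : ℕ}
    {A : Fin n → (ThermalSpace h hβ →L[ℂ] ThermalSpace h hβ)}
    (hA : ∀ i, A i ∈ smoothAlgebra h hβ Y) :
    ∃ (S : Finset X) (c : Fin n → S → ℂ), (∀ x ∈ S, x ∈ Y) ∧
      ∀ i, A i = weylSum h hβ (c i) (fun x : S => (x : X)) := by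
  classical
  have : ∀ i, ∃ l : X →₀ ℂ, l ∈ Finsupp.supported ℂ ℂ (Y : Set X) ∧
      Finsupp.linearCombination ℂ (smoothWeyl h hβ) l = A i := fun i =>
    (Finsupp.mem_span_image_iff_linearCombination ℂ).1 (hA i)
  choose l hl hlA using this
  refine ⟨Finset.univ.biUnion fun i => (l i).support, fun i x => l i x, fun x hx => ?_, fun i => ?_⟩
  · obtain ⟨i, -, hi⟩ := Finset.mem_biUnion.1 hx
    exact hl i hi
  · rw [← hlA i, weylSum, Finsupp.linearCombination_apply, Finsupp.sum]
    rw [Finset.sum_coe_sort _ fun x => l i x • smoothWeyl h hβ x]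
    refine Finset.sum_subset (Finset.subset_biUnion_of_mem (fun i => (l i).support)
      (Finset.mem_univ i)) fun x _ hx => ?_
    rw [Finsupp.notMem_support_iff.1 hx, zero_smul]

/-- Commuting with W_ω(x) is a closed condition on x by strong continuity, and a⁻¹Y is dense in Z,
so the smoothing does not change the commutant. -/
theorem centralizer_smoothAlgebra {Y Z : AddSubgroup X} (hYZ : ∀ y ∈ Y, h.inv y ∈ Z)
    (hZ : (Z : Set X) ⊆ closure (h.inv '' Y)) :
    Set.centralizer (weyl (h.rho_nonneg hβ) '' Z ∪ star (weyl (h.rho_nonneg hβ) '' Z)) =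
      Set.centralizer (smoothAlgebra h hβ Y) := by
  ext B
  constructor
  · intro hB A hA
    refine Submodule.span_induction (p := fun A _ => A * B = B * A) ?_ ?_ ?_ ?_ hA
    · rintro _ ⟨y, hy, rfl⟩
      exact hB _ (Or.inl ⟨h.inv y, hYZ y hy, rfl⟩)
    · simp
    · intro A C _ _ hA hC
      rw [add_mul, mul_add, hA, hC]
    · intro c A _ hA
      rw [smul_mul_assoc, mul_smul_comm, hA]
  · intro hB
    have key : ∀ z ∈ Z, weyl (h.rho_nonneg hβ) z * B = B * weyl (h.rho_nonneg hβ) z := by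
      intro z hz
      ext v
      have hcl : IsClosed {x | weyl (h.rho_nonneg hβ) x (B v) = B (weyl (h.rho_nonneg hβ) x v)} :=
        isClosed_eq (continuous_weyl_apply _ _) (B.continuous.comp (continuous_weyl_apply _ _))
      refine closure_minimal ?_ hcl (hZ hz)
      rintro _ ⟨y, hy, rfl⟩
      exact congrArg (fun A : ThermalSpace h hβ →L[ℂ] ThermalSpace h hβ => A v)
        (hB _ (Submodule.subset_span ⟨y, hy, rfl⟩))
    rintro A (⟨z, hz, rfl⟩ | ⟨z, hz, hA⟩)
    · exact key z hz
    · rw [← star_star A, ← hA, star_weyl]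
      exact key _ (Z.neg_mem hz)

/-- The real subspace of fixed points of `κ`, as an additive subgroup. -/
def fixedSubgroup (κ : X ≃ₗᵢ⋆[ℂ] X) : AddSubgroup X where
  carrier := {x | κ x = x}
  add_mem' {x y} hx hy := by rw [Set.mem_ofPred_eq] at *; rw [map_add, hx, hy]
  zero_mem' := map_zero κ
  neg_mem' {x} hx := by rw [Set.mem_ofPred_eq] at *; rw [map_neg, hx]

theorem coe_fieldAlgebra : (fieldAlgebra h hβ : Set (ThermalSpace h hβ →L[ℂ] ThermalSpace h hβ)) =
    Set.centralizer (Set.centralizer (smoothAlgebra h hβ ⊤)) := by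
  have := centralizer_smoothAlgebra h hβ (Y := ⊤) (Z := ⊤) (fun _ _ => trivial)
    (by simpa using h.denseRange_inv.closure_range.ge)
  rw [fieldAlgebra, coe_vonNeumannGenerated, ← this]
  simp

/-- The projection (1+κ)/2 onto the fixed vectors commutes with a⁻¹ and carries the dense range of
a⁻¹ to the image of the fixed vectors. -/
theorem fixedSubgroup_subset_closure {κ : X ≃ₗᵢ⋆[ℂ] X} (hκ : ∀ x, κ (κ x) = x)
    (hcomm : CommutesWith a κ) :
    (fixedSubgroup κ : Set X) ⊆ closure (h.inv '' (fixedSubgroup κ)) := fun z hz => by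
  have hc : Continuous fun x => (2⁻¹ : ℂ) • (x + κ x) := by
    have := κ.continuous
    fun_prop
  have h1 := map_mem_closure hc (h.denseRange_inv z) (t := h.inv '' (fixedSubgroup κ)) ?_
  · convert h1 using 1
    have : κ z = z := hz
    rw [this, ← two_smul ℂ z, smul_smul]; simp
  · rintro _ ⟨x, rfl⟩
    refine ⟨(2⁻¹ : ℂ) • (x + κ x), ?_, ?_⟩
    · change κ _ = _
      rw [map_smulₛₗ, map_add, hκ, add_comm, map_inv₀, map_ofNat]
    · change _ = (2⁻¹ : ℂ) • (h.inv x + κ (h.inv x))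
      rw [map_smul, map_add, h.conj_inv hcomm]

theorem coe_fieldAlgebraFixed {κ : X ≃ₗᵢ⋆[ℂ] X} (hκ : ∀ x, κ (κ x) = x)
    (hcomm : CommutesWith a κ) :
    (fieldAlgebraFixed h hβ κ : Set (ThermalSpace h hβ →L[ℂ] ThermalSpace h hβ)) =
      Set.centralizer (Set.centralizer (smoothAlgebra h hβ (fixedSubgroup κ))) := by
  have := centralizer_smoothAlgebra h hβ (Y := fixedSubgroup κ) (Z := fixedSubgroup κ)
    (fun y hy => by
      change κ (h.inv y) = h.inv y
      rw [h.conj_inv hcomm]; exact congrArg _ hy) (fixedSubgroup_subset_closure h hκ hcomm)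
  rw [fieldAlgebraFixed, coe_vonNeumannGenerated, ← this]
  rfl

end SmoothAlgebra

/-! ### The dynamics, commutativity and generation -/

section Dynamics

variable {X : Type*} [NormedAddCommGroup X] [InnerProductSpace ℂ X] [CompleteSpace X]
variable {a : X →ₗ.[ℂ] X} {m β : ℝ} (h : IsSelfAdjointGE a m) (hβ : 0 < β)

/-- The unitary group `e^{itL}` as bounded operators. -/
noncomputable def liouvilleOp (t : ℝ) : ThermalSpace h hβ →L[ℂ] ThermalSpace h hβ :=
  liouvilleUnitary h hβ t

theorem liouvilleOp_coherentVec (t : ℝ) (x : X) :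
    liouvilleOp h hβ t (coherentVec (h.rho_nonneg hβ) x) =
      coherentVec (h.rho_nonneg hβ) (h.expI t x) :=
  (exists_liouvilleUnitary h hβ t).choose_spec x

theorem liouvilleOp_vacuum (t : ℝ) :
    liouvilleOp h hβ t (vacuum (h.rho_nonneg hβ)) = vacuum (h.rho_nonneg hβ) := by
  rw [vacuum, liouvilleOp_coherentVec, map_zero]

theorem norm_liouvilleOp (t : ℝ) (v : ThermalSpace h hβ) : ‖liouvilleOp h hβ t v‖ = ‖v‖ :=
  norm_apply_of_mem_unitary (liouvilleUnitary h hβ t).2 v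

theorem liouvilleOp_add (s t : ℝ) :
    liouvilleOp h hβ (s + t) = liouvilleOp h hβ s * liouvilleOp h hβ t :=
  kernelSpace_ext _ fun x => by
    refine (liouvilleOp_coherentVec h hβ (s + t) x).trans ?_
    rw [mul_apply_eq_comp]
    refine Eq.trans ?_ (congrArg (liouvilleOp h hβ s) (liouvilleOp_coherentVec h hβ t x)).symm
    rw [liouvilleOp_coherentVec, h.expI_add]
    rfl

theorem liouvilleOp_zero : liouvilleOp h hβ 0 = 1 :=
  kernelSpace_ext _ fun x => by
    refine (liouvilleOp_coherentVec h hβ 0 x).trans ?_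
    rw [h.expI_zero]; rfl

theorem star_liouvilleOp (t : ℝ) : star (liouvilleOp h hβ t) = liouvilleOp h hβ (-t) := by
  have h1 : star (liouvilleOp h hβ t) * liouvilleOp h hβ t = 1 :=
    (Unitary.mem_iff.1 (liouvilleUnitary h hβ t).2).1
  have h2 : liouvilleOp h hβ t * liouvilleOp h hβ (-t) = 1 := by
    rw [← liouvilleOp_add, add_neg_cancel, liouvilleOp_zero]
  calc _ = star (liouvilleOp h hβ t) * (liouvilleOp h hβ t * liouvilleOp h hβ (-t)) := by
        rw [h2, mul_one]
    _ = _ := by rw [← mul_assoc, h1, one_mul]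

theorem continuous_liouvilleOp (v : ThermalSpace h hβ) :
    Continuous fun t => liouvilleOp h hβ t v := by
  refine continuous_apply_toKernelSpace _ (norm_liouvilleOp h hβ) (fun x => ?_) v
  exact ((continuous_coherentVec (h.rho_nonneg hβ)).comp (h.continuous_expI x)).congr fun t =>
    (liouvilleOp_coherentVec h hβ t x).symm

theorem dynamics_eq (t : ℝ) (A : ThermalSpace h hβ →L[ℂ] ThermalSpace h hβ) :
    dynamics h hβ t A = liouvilleOp h hβ t * A * liouvilleOp h hβ (-t) := by
  rw [← star_liouvilleOp]
  exact Unitary.conjStarAlgAut_apply _ _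

theorem dynamics_apply (t : ℝ) (A : ThermalSpace h hβ →L[ℂ] ThermalSpace h hβ)
    (v : ThermalSpace h hβ) :
    dynamics h hβ t A v = liouvilleOp h hβ t (A (liouvilleOp h hβ (-t) v)) := by
  rw [dynamics_eq]; rfl

theorem norm_dynamics_apply_le (t : ℝ) (A : ThermalSpace h hβ →L[ℂ] ThermalSpace h hβ)
    (v : ThermalSpace h hβ) : ‖dynamics h hβ t A v‖ ≤ ‖A‖ * ‖v‖ := by
  rw [dynamics_apply, norm_liouvilleOp, ← norm_liouvilleOp h hβ (-t) v]
  exact A.le_opNorm _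

theorem dynamics_vacuum (t : ℝ) (A : ThermalSpace h hβ →L[ℂ] ThermalSpace h hβ) :
    dynamics h hβ t A (vacuum (h.rho_nonneg hβ)) =
      liouvilleOp h hβ t (A (vacuum (h.rho_nonneg hβ))) := by
  rw [dynamics_apply, liouvilleOp_vacuum]

theorem norm_vacuum : ‖vacuum (h.rho_nonneg hβ)‖ = 1 := by
  have h1 := inner_vacuum_weyl (h.rho_nonneg hβ) 0
  rw [weyl_zero, one_apply_eq_self] at h1
  have h2 : weylFunctional (h.rho β) 0 = 1 := by simp [weylFunctional]
  have h3 : (‖vacuum (h.rho_nonneg hβ)‖ : ℂ) ^ 2 = 1 := by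
    rw [← h2, ← h1]; exact (inner_self_eq_norm_sq_to_K (𝕜 := ℂ) (vacuum (h.rho_nonneg hβ))).symm
  have h4 : ‖vacuum (h.rho_nonneg hβ)‖ ^ 2 = 1 := by exact_mod_cast h3
  exact (pow_eq_one_iff_of_nonneg (norm_nonneg _) two_ne_zero).1 h4

theorem thermalState_one : thermalState h hβ 1 = 1 := by
  refine (inner_self_eq_norm_sq_to_K (𝕜 := ℂ) (vacuum (h.rho_nonneg hβ))).trans ?_
  rw [norm_vacuum h hβ]; simp

theorem thermalState_mul (A B : ThermalSpace h hβ →L[ℂ] ThermalSpace h hβ) :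
    thermalState h hβ (A * B) =
      ⟪star A (vacuum (h.rho_nonneg hβ)), B (vacuum (h.rho_nonneg hβ))⟫_ℂ := by
  rw [ContinuousLinearMap.star_eq_adjoint, ContinuousLinearMap.adjoint_inner_left]
  rfl

/-- If B commutes with S, hence with φ(S) ⊆ S, then φ⁻¹(B) commutes with S; the other inclusion for
φ(S) is not needed. -/
theorem map_mem_centralizer_centralizer {H : Type*} [NormedAddCommGroup H] [InnerProductSpace ℂ H]
    [CompleteSpace H] (φ : (H →L[ℂ] H) ≃⋆ₐ[ℂ] (H →L[ℂ] H)) {S : Set (H →L[ℂ] H)}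
    (hS : ∀ A ∈ S, φ A ∈ S) {A : H →L[ℂ] H} (hA : A ∈ Set.centralizer (Set.centralizer S)) :
    φ A ∈ Set.centralizer (Set.centralizer S) := by
  intro B hB
  have h1 : φ.symm B ∈ Set.centralizer S := fun C hC => EquivLike.injective φ (by
    rw [map_mul, map_mul, φ.apply_symm_apply]
    exact hB _ (hS C hC))
  have := congrArg φ (hA _ h1)
  rwa [map_mul, map_mul, φ.apply_symm_apply] at this

theorem dynamics_mem_fieldAlgebra (t : ℝ) {A : ThermalSpace h hβ →L[ℂ] ThermalSpace h hβ}
    (hA : A ∈ fieldAlgebra h hβ) : dynamics h hβ t A ∈ fieldAlgebra h hβ := by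
  rw [← SetLike.mem_coe, coe_fieldAlgebra] at hA ⊢
  refine map_mem_centralizer_centralizer _ (fun B hB => ?_) hA
  refine Submodule.span_induction
    (p := fun B _ => dynamics h hβ t B ∈ smoothAlgebra h hβ ⊤) ?_ ?_ ?_ ?_ hB
  · rintro _ ⟨x, -, rfl⟩
    have h1 : h.expI t (h.inv x) = h.inv (h.expI t x) :=
      congrArg (fun A : X →L[ℂ] X => A x) (h.commute_expI (Commute.refl _) t).eq
    rw [smoothWeyl, dynamics_weyl, h1]
    exact Submodule.subset_span ⟨h.expI t x, trivial, rfl⟩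
  · rw [map_zero]; exact zero_mem _
  · intro A B _ _ hA hB
    rw [dynamics_eq, mul_add, add_mul, ← dynamics_eq, ← dynamics_eq]
    exact add_mem hA hB
  · intro c A _ hA
    rw [dynamics_eq, mul_smul_comm, smul_mul_assoc, ← dynamics_eq]
    exact (smoothAlgebra h hβ ⊤).smul_mem hA c

theorem fieldAlgebraFixed_le {κ : X ≃ₗᵢ⋆[ℂ] X} :
    fieldAlgebraFixed h hβ κ ≤ fieldAlgebra h hβ := by
  intro A hA
  rw [← SetLike.mem_coe, fieldAlgebraFixed, coe_vonNeumannGenerated] at hA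
  rw [← SetLike.mem_coe, fieldAlgebra, coe_vonNeumannGenerated]
  have hs : weyl (h.rho_nonneg hβ) '' {x | κ x = x} ⊆ Set.range (weyl (h.rho_nonneg hβ)) :=
    Set.image_subset_range _ _
  refine Set.centralizer_subset (Set.centralizer_subset (Set.union_subset_union hs ?_)) hA
  exact fun B hB => hs hB

theorem smoothAlgebra_fixed_comm {κ : X ≃ₗᵢ⋆[ℂ] X} (hcomm : CommutesWith a κ) :
    ∀ A ∈ smoothAlgebra h hβ (fixedSubgroup κ), ∀ B ∈ smoothAlgebra h hβ (fixedSubgroup κ),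
      A * B = B * A := by
  intro A hA B hB
  refine Submodule.span_induction (p := fun A _ => A * B = B * A) ?_ ?_ ?_ ?_ hA
  · rintro _ ⟨x, hx, rfl⟩
    refine Submodule.span_induction
      (p := fun B _ => smoothWeyl h hβ x * B = B * smoothWeyl h hβ x) ?_ ?_ ?_ ?_ hB
    · rintro _ ⟨y, hy, rfl⟩
      rw [smoothWeyl_mul_of_fixed h hβ hcomm hx hy, smoothWeyl_mul_of_fixed h hβ hcomm hy hx,
        add_comm]
    · simp
    · intro A C _ _ hA hC
      rw [add_mul, mul_add, hA, hC]
    · intro c A _ hA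
      rw [smul_mul_assoc, mul_smul_comm, hA]
  · simp
  · intro A C _ _ hA hC
    rw [add_mul, mul_add, hA, hC]
  · intro c A _ hA
    rw [smul_mul_assoc, mul_smul_comm, hA]

theorem fieldAlgebraFixed_comm {κ : X ≃ₗᵢ⋆[ℂ] X} (hκ : ∀ x, κ (κ x) = x)
    (hcomm : CommutesWith a κ) : ∀ A ∈ fieldAlgebraFixed h hβ κ,
      ∀ B ∈ fieldAlgebraFixed h hβ κ, A * B = B * A := by
  intro A hA B hB
  rw [← SetLike.mem_coe, coe_fieldAlgebraFixed h hβ hκ hcomm] at hA hB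
  refine hB A (Set.centralizer_subset (fun C hC D hD => ?_) hA)
  exact smoothAlgebra_fixed_comm h hβ hcomm D hD C hC

/-- Since X = X_κ + iX_κ and t = 0 gives X_κ, only iX_κ is at stake. Difference quotients of orbits
converge to i a⁻¹y, and such vectors are dense in iX_κ. -/
theorem mem_of_isClosed_addSubgroup {κ : X ≃ₗᵢ⋆[ℂ] X} (hκ : ∀ x, κ (κ x) = x)
    (hcomm : CommutesWith a κ) {V : AddSubgroup X} (hV : IsClosed (V : Set X))
    (hVx : ∀ t x, κ x = x → h.expI t x ∈ V) (x : X) : x ∈ V := by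
  have hfix : ∀ x, κ x = x → x ∈ V := fun x hx => by
    have := hVx 0 x hx
    rwa [h.expI_zero] at this
  have hinv : ∀ y, κ y = y → Complex.I • h.inv y ∈ V := fun y hy => by
    have h0 : κ (h.inv y) = h.inv y := by rw [h.conj_inv hcomm, hy]
    have h1 : κ (h.inv (h.inv y)) = h.inv (h.inv y) := by rw [h.conj_inv hcomm, h0]
    -- V is only an additive subgroup; the factor N + 1 of the difference quotient is absorbed into
    -- the fixed vector, which stays fixed because N + 1 is real.
    have hmem : ∀ N : ℕ, (N + 1 : ℂ) • (h.expI (1 / (N + 1)) (h.inv (h.inv y)) -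
        h.inv (h.inv y)) ∈ V := fun N => by
      have hf : κ ((N + 1 : ℂ) • h.inv (h.inv y)) = (N + 1 : ℂ) • h.inv (h.inv y) := by
        rw [map_smulₛₗ, h1, map_add, map_natCast, map_one]
      rw [smul_sub, ← map_smul]
      exact V.sub_mem (hVx _ _ hf) (hfix _ hf)
    refine hV.mem_of_tendsto ?_ (Filter.Eventually.of_forall hmem) (b := Filter.atTop)
    rw [tendsto_iff_norm_sub_tendsto_zero]
    have hlim : Filter.Tendsto (fun N : ℕ => 3 * ‖y‖ * (1 / ((N : ℝ) + 1))) Filter.atTop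
        (nhds (3 * ‖y‖ * 0)) := tendsto_one_div_add_atTop_nhds_zero_nat.const_mul _
    rw [mul_zero] at hlim
    refine squeeze_zero (fun _ => norm_nonneg _) (fun N => ?_) hlim
    have h2 := h.norm_expI_sub_sub_le (1 / ((N : ℝ) + 1)) y
    have hN : (0 : ℝ) < N + 1 := by positivity
    have hN' : (N + 1 : ℂ) ≠ 0 := by exact_mod_cast hN.ne'
    have e : (N + 1 : ℂ) • (h.expI (1 / (N + 1)) (h.inv (h.inv y)) - h.inv (h.inv y)) -
        Complex.I • h.inv y = (N + 1 : ℂ) • (h.expI (1 / (N + 1)) (h.inv (h.inv y)) -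
          h.inv (h.inv y) - (((1 / ((N : ℝ) + 1) : ℝ) : ℂ) * Complex.I) • h.inv y) := by
      rw [smul_sub _ (_ - _), smul_smul, ← mul_assoc]
      push_cast
      rw [mul_one_div_cancel hN', one_mul]
    rw [e, norm_smul, show ‖(N + 1 : ℂ)‖ = N + 1 by
      rw [show (N + 1 : ℂ) = ((N + 1 : ℝ) : ℂ) by push_cast; rfl, Complex.norm_real,
        Real.norm_of_nonneg hN.le]]
    refine (mul_le_mul_of_nonneg_left h2 hN.le).trans_eq ?_
    field_simp
  have hI : ∀ y, κ y = y → Complex.I • y ∈ V := fun y hy => by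
    have hcl : IsClosed {y : X | Complex.I • y ∈ V} :=
      hV.preimage (continuous_const_smul Complex.I)
    refine closure_minimal ?_ hcl (fixedSubgroup_subset_closure h hκ hcomm hy)
    rintro _ ⟨z, hz, rfl⟩
    exact hinv z hz
  have e : x = (2⁻¹ : ℂ) • (x + κ x) + Complex.I • ((-Complex.I * 2⁻¹) • (x - κ x)) := by
    rw [smul_smul, ← mul_assoc, mul_neg, Complex.I_mul_I, neg_neg, one_mul, ← smul_add]
    rw [add_add_sub_cancel, ← two_smul ℂ x, smul_smul]
    simp
  rw [e]
  refine V.add_mem (hfix _ ?_) (hI _ ?_)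
  · rw [map_smulₛₗ, map_add, hκ, add_comm, map_inv₀, map_ofNat]
  · rw [map_smulₛₗ, map_sub, hκ, map_mul, map_neg, Complex.conj_I, map_inv₀, map_ofNat,
      ← neg_sub x, smul_neg, ← neg_smul]
    congr 1
    ring

/-- If B commutes with all the evolved algebras, the x for which B commutes with W_ω(x) form an
additive subgroup by the Weyl relations, closed by strong continuity and containing every
e^{ita}X_κ; hence it is X. -/
theorem vonNeumannGenerated_iUnion_dynamics {κ : X ≃ₗᵢ⋆[ℂ] X} (hκ : ∀ x, κ (κ x) = x)
    (hcomm : CommutesWith a κ) :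
    vonNeumannGenerated (⋃ t, dynamics h hβ t '' (fieldAlgebraFixed h hβ κ :
      Set (ThermalSpace h hβ →L[ℂ] ThermalSpace h hβ))) = fieldAlgebra h hβ := by
  set S := ⋃ t, dynamics h hβ t '' (fieldAlgebraFixed h hβ κ :
      Set (ThermalSpace h hβ →L[ℂ] ThermalSpace h hβ)) with hS
  apply SetLike.coe_injective
  apply Set.Subset.antisymm
  · have h1 : S ⊆ (fieldAlgebra h hβ : Set (ThermalSpace h hβ →L[ℂ] ThermalSpace h hβ)) := by
      refine Set.iUnion_subset fun t => ?_
      rintro _ ⟨A, hA, rfl⟩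
      exact dynamics_mem_fieldAlgebra h hβ t (fieldAlgebraFixed_le h hβ hA)
    rw [coe_vonNeumannGenerated, ← (fieldAlgebra h hβ).centralizer_centralizer]
    refine Set.centralizer_subset (Set.centralizer_subset (Set.union_subset h1 fun A hA => ?_))
    have := star_mem (h1 hA)
    rwa [star_star] at this
  · rw [coe_vonNeumannGenerated, fieldAlgebra, coe_vonNeumannGenerated]
    refine Set.centralizer_subset fun B hB => ?_
    have key : ∀ x, weyl (h.rho_nonneg hβ) x * B = B * weyl (h.rho_nonneg hβ) x := by
      let V : AddSubgroup X :=
        { carrier := {x | weyl (h.rho_nonneg hβ) x * B = B * weyl (h.rho_nonneg hβ) x}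
          add_mem' := fun {x y} hx hy => by
            rw [Set.mem_ofPred_eq] at *
            have h1 := weyl_mul (h.rho_nonneg hβ) x y
            have h2 : weyl (h.rho_nonneg hβ) (x + y) = (Complex.exp
                (-(Complex.I / 2 * ((⟪x, y⟫_ℂ).im : ℂ))))⁻¹ •
                  (weyl (h.rho_nonneg hβ) x * weyl (h.rho_nonneg hβ) y) := by
              rw [h1, smul_smul, inv_mul_cancel₀ (Complex.exp_ne_zero _), one_smul]
            rw [h2, smul_mul_assoc, mul_smul_comm, mul_assoc, hy, ← mul_assoc, hx, mul_assoc]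
          zero_mem' := by rw [Set.mem_ofPred_eq, weyl_zero, one_mul, mul_one]
          neg_mem' := fun {x} hx => by
            rw [Set.mem_ofPred_eq] at *
            have h1 := Unitary.mem_iff.1 (weyl_mem_unitary (h.rho_nonneg hβ) x)
            rw [star_weyl] at h1
            calc _ = weyl (h.rho_nonneg hβ) (-x) * B *
                  (weyl (h.rho_nonneg hβ) x * weyl (h.rho_nonneg hβ) (-x)) := by
                  rw [h1.2, mul_one]
              _ = weyl (h.rho_nonneg hβ) (-x) * (B * weyl (h.rho_nonneg hβ) x) *
                  weyl (h.rho_nonneg hβ) (-x) := by simp only [mul_assoc]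
              _ = _ := by rw [← hx, ← mul_assoc, h1.1, one_mul] }
      refine mem_of_isClosed_addSubgroup h hκ hcomm (V := V) ?_ fun t x hx => ?_
      · have e : (V : Set X) = ⋂ v, {x | weyl (h.rho_nonneg hβ) x (B v) =
            B (weyl (h.rho_nonneg hβ) x v)} := by
          ext x
          rw [Set.mem_iInter]
          exact ⟨fun hx v => congrArg (fun A : ThermalSpace h hβ →L[ℂ] ThermalSpace h hβ => A v) hx,
            fun hx => ContinuousLinearMap.ext hx⟩
        rw [e]
        exact isClosed_iInter fun v => isClosed_eq (continuous_weyl_apply _ _)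
          (B.continuous.comp (continuous_weyl_apply _ _))
      · refine hB _ (Or.inl ?_)
        rw [hS, Set.mem_iUnion]
        refine ⟨t, weyl (h.rho_nonneg hβ) x, ?_, dynamics_weyl h hβ t x⟩
        rw [fieldAlgebraFixed, coe_vonNeumannGenerated]
        exact Set.subset_centralizer_centralizer (Or.inl ⟨x, hx, rfl⟩)
    rintro A (⟨x, rfl⟩ | ⟨x, hx⟩)
    · exact key x
    · rw [← star_star A, ← hx, star_weyl]
      exact key _

end Dynamics

/-! ### Limits of holomorphic functions controlled over the vertices -/

section Limit

open Filter Topology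

variable {β : ℝ} {n : ℕ}

/-- The Gaussian weight `z ↦ exp(∑ (Re zᵢ)²)`. -/
noncomputable def gaussWeight (z : Fin n → ℂ) : ℝ := Real.exp (∑ i, (z i).re ^ 2)

theorem continuous_gaussWeight : Continuous (gaussWeight (n := n)) := by
  unfold gaussWeight
  have : ∀ i, Continuous fun z : Fin n → ℂ => (z i).re := fun i =>
    Complex.continuous_re.comp (continuous_apply i)
  fun_prop

theorem norm_exp_neg_sum_sq (z : Fin n → ℂ) :
    ‖Complex.exp (-∑ i, z i ^ 2)‖ = Real.exp (∑ i, (z i).im ^ 2) * (gaussWeight z)⁻¹ := by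
  rw [Complex.norm_exp, gaussWeight, ← Real.exp_neg, ← Real.exp_add, Complex.neg_re, Complex.re_sum]
  congr 1
  simp only [sq, Complex.mul_re, Finset.sum_sub_distrib]
  ring

/-- Subtracting the first imaginary part normalizes a point of the closed tube; translation
invariant functions do not notice. -/
theorem exists_translate_mem_timeSimplex {z : Fin n → ℂ} (hz : z ∈ closedTube β n) :
    ∃ r : ℝ, (fun i => (z i + Complex.I * r).im) ∈ timeSimplex β n := by
  rcases n with _ | n
  · exact ⟨0, fun i => i.elim0, fun i => i.elim0⟩
  · refine ⟨-(z 0).im, fun i j hij => ?_, fun i => ?_⟩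
    · simpa using (hz i j hij).1
    · have := hz 0 i (Fin.zero_le i)
      simp only [Complex.add_im, Complex.mul_im, Complex.I_re, Complex.I_im, Complex.ofReal_re,
        Complex.ofReal_im, zero_mul, one_mul, zero_add]
      constructor <;> linarith

/-- Multiplication by exp(-∑ zᵢ²) turns a vertex bound that grows like the Gaussian weight into a
constant one, to which the maximum principle applies. The loss e^{nβ²} bounds exp(∑ (Im zᵢ)²) after
normalization. -/
theorem norm_le_gaussWeight_of_timeVertex (hβ : 0 < β) {D : (Fin n → ℂ) → ℂ}
    (hD : DifferentiableOn ℂ D (closedTube β n)) {M C : ℝ}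
    (hM : ∀ z ∈ closedTube β n, ‖D z‖ ≤ M) (hT : ∀ z w, D (fun i => z i + w) = D z)
    (hC : ∀ k ≤ n, ∀ z, (∀ i, (z i).im = timeVertex β n k i) → ‖D z‖ ≤ C * gaussWeight z)
    {z : Fin n → ℂ} (hz : z ∈ closedTube β n) :
    ‖D z‖ ≤ Real.exp (n * β ^ 2) * C * gaussWeight z := by
  have hC0 : 0 ≤ C := by
    have h0 := hC 0 (Nat.zero_le _) (fun i => Complex.I * timeVertex β n 0 i) fun i => by simp
    exact nonneg_of_mul_nonneg_left ((norm_nonneg _).trans h0) (Real.exp_pos _)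
  have hM0 : 0 ≤ M := (norm_nonneg _).trans (hM z hz)
  have hsq : ∀ w : Fin n → ℂ, (fun i => (w i).im) ∈ timeSimplex β n →
      Real.exp (∑ i, (w i).im ^ 2) ≤ Real.exp (n * β ^ 2) := fun w hw => by
    refine Real.exp_le_exp.2 ((Finset.sum_le_card_nsmul _ _ (β ^ 2) fun i _ => ?_).trans_eq (by simp))
    exact pow_le_pow_left₀ (hw.2 i).1 (hw.2 i).2 2
  obtain ⟨r, hr⟩ := exists_translate_mem_timeSimplex hz
  have h1 := norm_le_of_timeVertex hβ (G := fun w => D w * Complex.exp (-∑ i, w i ^ 2))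
    (M := M * Real.exp (n * β ^ 2)) (C := C * Real.exp (n * β ^ 2)) ?_ ?_ ?_ _ hr
  · rw [norm_mul, hT z (Complex.I * r), norm_exp_neg_sum_sq] at h1
    have e : gaussWeight (fun i => z i + Complex.I * r) = gaussWeight z := by simp [gaussWeight]
    rw [e, ← mul_assoc, ← div_eq_mul_inv, div_le_iff₀ (show 0 < gaussWeight z from Real.exp_pos _),
      mul_comm C] at h1
    refine le_trans (le_mul_of_one_le_right (norm_nonneg _) (Real.one_le_exp ?_)) h1
    positivity
  · refine (hD.mono fun w hw => mem_closedTube_of_timeSimplex hw).mul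
      (Differentiable.differentiableOn ?_)
    fun_prop
  · intro w hw
    rw [norm_mul, norm_exp_neg_sum_sq]
    refine mul_le_mul (hM w (mem_closedTube_of_timeSimplex hw)) ?_ (norm_nonneg _ |>.trans_eq
      (norm_exp_neg_sum_sq w)) hM0
    refine (mul_le_of_le_one_right (Real.exp_pos _).le (inv_le_one_of_one_le₀
      (Real.one_le_exp (by positivity)))).trans (hsq w hw)
  · intro k hk w hw
    have hw' : (fun i => (w i).im) ∈ timeSimplex β n := by
      rw [funext hw]; exact timeVertex_mem hβ.le n k
    rw [norm_mul, norm_exp_neg_sum_sq]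
    calc _ ≤ C * gaussWeight w * (Real.exp (∑ i, (w i).im ^ 2) * (gaussWeight w)⁻¹) :=
          mul_le_mul_of_nonneg_right (hC k hk w hw)
            (mul_nonneg (Real.exp_pos _).le (inv_nonneg.2 (Real.exp_pos _).le))
      _ = C * Real.exp (∑ i, (w i).im ^ 2) := by
          have : gaussWeight w ≠ 0 := (Real.exp_pos _).ne'
          field_simp
      _ ≤ _ := mul_le_mul_of_nonneg_left (hsq w hw') hC0

/-- Convergence jointly in the index and the point is uniform on compact sets. -/
theorem eventually_forall_isCompact {ι Y : Type*} [TopologicalSpace Y] {l : Filter ι} {K : Set Y}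
    (hK : IsCompact K) {P : ι → Y → Prop} (hP : ∀ y ∈ K, ∀ᶠ z in l ×ˢ 𝓝 y, P z.1 z.2) :
    ∀ᶠ x in l, ∀ y ∈ K, P x y := by
  have : ∀ᶠ z in l ×ˢ 𝓝ˢ K, P z.1 z.2 := by
    rw [hK.prod_nhdsSet_eq_biSup]
    simpa only [eventually_iSup] using hP
  exact this.curry.mono fun _ h => h.self_of_nhdsSet

/-- The open sublevel sets of the Gaussian weight cover everything, and on each of them the weighted
Cauchy condition is uniform; both holomorphy and continuity survive locally uniform limits. -/
theorem exists_tendsto_of_cauchy (hβ : 0 < β) {ι : Type*} {l : Filter ι} [l.NeBot] {D : ι → (Fin n → ℂ) → ℂ}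
    (hD : ∀ α, DifferentiableOn ℂ (D α) (closedTube β n))
    (hc : ∀ ε > 0, ∀ᶠ p in l ×ˢ l, ∀ z ∈ closedTube β n,
      ‖D p.1 z - D p.2 z‖ ≤ ε * gaussWeight z) :
    ∃ G : (Fin n → ℂ) → ℂ, (∀ z ∈ closedTube β n, Tendsto (fun α => D α z) l (𝓝 (G z))) ∧
      DifferentiableOn ℂ G (tube β n) ∧ ContinuousOn G (closedTube β n) := by
  have hcs : ∀ R : ℝ, 0 < R →
      UniformCauchySeqOn D l (closedTube β n ∩ {z | gaussWeight z < R}) := by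
    intro R hR u hu
    obtain ⟨ε, hε, hεu⟩ := Metric.mem_uniformity_dist.1 hu
    filter_upwards [hc (ε / R) (by positivity)] with p hp z hz
    refine hεu ?_
    rw [dist_eq_norm]
    refine (hp z hz.1).trans_lt ?_
    calc ε / R * gaussWeight z < ε / R * R := by
          have : gaussWeight z < R := hz.2
          gcongr
      _ = ε := by field_simp
  have hlim : ∀ z ∈ closedTube β n, ∃ L, Tendsto (fun α => D α z) l (𝓝 L) := fun z hz =>
    CompleteSpace.complete ((hcs (gaussWeight z + 1)
      (add_pos (Real.exp_pos _) one_pos)).cauchy_map ⟨hz, lt_add_one (gaussWeight z)⟩)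
  choose! G hG using hlim
  have hu : ∀ R : ℝ, 0 < R →
      TendstoUniformlyOn D G l (closedTube β n ∩ {z | gaussWeight z < R}) := fun R hR =>
    (hcs R hR).tendstoUniformlyOn_of_tendsto fun z hz => hG z hz.1
  have hnhds : ∀ z : Fin n → ℂ, {w | gaussWeight w < gaussWeight z + 1} ∈ 𝓝 z := fun z =>
    (isOpen_lt continuous_gaussWeight continuous_const).mem_nhds (lt_add_one (gaussWeight z))
  have hsub : tube β n ⊆ closedTube β n := fun z hz i j hij => by
    rcases hij.eq_or_lt with rfl | hij
    · exact ⟨le_rfl, by simpa using hβ.le⟩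
    · exact ⟨(hz i j hij).1.le, (hz i j hij).2.le⟩
  refine ⟨G, hG, ?_, ?_⟩
  · refine differentiableOn_of_locally_tendstoUniformlyOn (isOpen_tube β n) (l := l)
      (fun α => (hD α).mono hsub) fun z hz => ⟨tube β n ∩ {w | gaussWeight w < gaussWeight z + 1},
        inter_mem ((isOpen_tube β n).mem_nhds hz) (hnhds z), ?_⟩
    exact (hu _ (add_pos (Real.exp_pos _) one_pos)).mono (Set.inter_subset_inter_left _ hsub)
  · refine TendstoLocallyUniformlyOn.continuousOn (F := D) (p := l) ?_
      (Eventually.frequently (Eventually.of_forall fun α => (hD α).continuousOn))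
    intro u hu' z hz
    refine ⟨closedTube β n ∩ {w | gaussWeight w < gaussWeight z + 1}, ?_,
      hu (gaussWeight z + 1) (add_pos (Real.exp_pos _) one_pos) u hu'⟩
    exact inter_mem_nhdsWithin _ (hnhds z)

/-- Over the vertices the differences are small uniformly on a large ball of real times, by
compactness, and at most 2M outside, where the Gaussian weight is large. This is a weighted vertex
bound, which extends to the tube. -/
theorem exists_tendsto_of_timeVertex (hβ : 0 < β) {ι : Type*} {l : Filter ι} [l.NeBot]
    {D : ι → (Fin n → ℂ) → ℂ} (hD : ∀ α, DifferentiableOn ℂ (D α) (closedTube β n))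
    (hb : ∀ α, ∃ C, ∀ z ∈ closedTube β n, ‖D α z‖ ≤ C)
    (hT : ∀ α z w, D α (fun i => z i + w) = D α z) {M : ℝ}
    (hM : ∀ α, ∀ k ≤ n, ∀ t : Fin n → ℝ, ‖D α fun i => t i + Complex.I * timeVertex β n k i‖ ≤ M)
    (hc : ∀ k ≤ n, ∀ t₀ : Fin n → ℝ, ∃ L, Tendsto (fun p : ι × (Fin n → ℝ) =>
      D p.1 fun i => p.2 i + Complex.I * timeVertex β n k i) (l ×ˢ 𝓝 t₀) (𝓝 L)) :
    ∃ G : (Fin n → ℂ) → ℂ, (∀ z ∈ closedTube β n, Tendsto (fun α => D α z) l (𝓝 (G z))) ∧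
      DifferentiableOn ℂ G (tube β n) ∧ ContinuousOn G (closedTube β n) := by
  refine exists_tendsto_of_cauchy hβ hD fun ε hε => ?_
  obtain ⟨α₀, -⟩ : ∃ α : ι, True := (Filter.Eventually.of_forall fun _ => trivial).exists (f := l)
  have hM0 : 0 ≤ M := (norm_nonneg _).trans (hM α₀ 0 (Nat.zero_le _) 0)
  set η := ε / Real.exp (n * β ^ 2) with hη
  have hη0 : 0 < η := by positivity
  -- Chosen so that ηR ≥ 2M and R ≥ 1; outside the ball some |Re wᵢ| > R, hence the weight is at
  -- least R² ≥ R.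
  set R : ℝ := 2 * M / η + 1 with hR
  have hR1 : 1 ≤ R := by
    have : 0 ≤ 2 * M / η := by positivity
    linarith
  have hK : IsCompact (Metric.closedBall (0 : Fin n → ℝ) R) := isCompact_closedBall _ _
  have hev : ∀ k ≤ n, ∀ᶠ p in l ×ˢ l, ∀ t ∈ Metric.closedBall (0 : Fin n → ℝ) R,
      ‖D p.1 (fun i => t i + Complex.I * timeVertex β n k i) -
        D p.2 (fun i => t i + Complex.I * timeVertex β n k i)‖ < η := by
    intro k hk
    refine eventually_forall_isCompact hK fun t₀ _ => ?_
    obtain ⟨L, hL⟩ := hc k hk t₀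
    have h1 : Tendsto (fun q : (ι × ι) × (Fin n → ℝ) => (q.1.1, q.2)) ((l ×ˢ l) ×ˢ 𝓝 t₀)
        (l ×ˢ 𝓝 t₀) := (tendsto_fst.comp tendsto_fst).prodMk tendsto_snd
    have h2 : Tendsto (fun q : (ι × ι) × (Fin n → ℝ) => (q.1.2, q.2)) ((l ×ˢ l) ×ˢ 𝓝 t₀)
        (l ×ˢ 𝓝 t₀) := (tendsto_snd.comp tendsto_fst).prodMk tendsto_snd
    have h3 := ((hL.comp h1).sub (hL.comp h2)).norm
    rw [sub_self, norm_zero] at h3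
    exact h3.eventually_lt_const hη0
  have hev' : ∀ᶠ p in l ×ˢ l, ∀ k ∈ Set.Iic n, ∀ t ∈ Metric.closedBall (0 : Fin n → ℝ) R,
      ‖D p.1 (fun i => t i + Complex.I * timeVertex β n k i) -
        D p.2 (fun i => t i + Complex.I * timeVertex β n k i)‖ < η :=
    (eventually_all_finite (Set.finite_Iic n)).2 hev
  filter_upwards [hev'] with p hp z hz
  obtain ⟨C1, hC1⟩ := hb p.1
  obtain ⟨C2, hC2⟩ := hb p.2
  have := norm_le_gaussWeight_of_timeVertex hβ (D := fun z => D p.1 z - D p.2 z) (C := η)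
    (M := C1 + C2) ((hD p.1).sub (hD p.2))
    (fun w hw => (norm_sub_le _ _).trans (add_le_add (hC1 w hw) (hC2 w hw)))
    (fun w v => by rw [hT, hT]) ?_ hz
  · refine this.trans_eq ?_
    rw [hη, mul_div_cancel₀ _ (Real.exp_pos _).ne']
  intro k hk w hw
  have ew : w = fun i => (((w i).re : ℝ) : ℂ) + Complex.I * timeVertex β n k i := by
    funext i
    rw [← hw i, mul_comm, Complex.re_add_im]
  have hg1 : 1 ≤ gaussWeight w := Real.one_le_exp (by positivity)
  by_cases ht : (fun i => (w i).re) ∈ Metric.closedBall (0 : Fin n → ℝ) R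
  · have := (hp k hk _ ht).le
    rw [← ew] at this
    exact this.trans (le_mul_of_one_le_right hη0.le hg1)
  · have h1 : ‖D p.1 w - D p.2 w‖ ≤ M + M := by
      rw [ew]
      exact (norm_sub_le _ _).trans (add_le_add (hM _ k hk _) (hM _ k hk _))
    refine h1.trans ?_
    have h2 : R ≤ gaussWeight w := by
      rw [mem_closedBall_zero_iff, pi_norm_le_iff_of_nonneg (by linarith)] at ht
      push Not at ht
      obtain ⟨i, hi⟩ := ht
      have h3 : R ^ 2 ≤ ∑ i, (w i).re ^ 2 := by
        refine le_trans ?_ (Finset.single_le_sum (fun j _ => sq_nonneg (w j).re)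
          (Finset.mem_univ i))
        rw [← sq_abs (w i).re]
        exact pow_le_pow_left₀ (by linarith) hi.le 2
      have h4 := Real.add_one_le_exp (∑ i, (w i).re ^ 2)
      unfold gaussWeight
      nlinarith
    calc M + M = η * (2 * M / η) := by field_simp; ring
      _ ≤ η * R := by gcongr; rw [hR]; linarith
      _ ≤ _ := by gcongr

end Limit

/-! ### Green's functions of the smooth algebra and their limits -/

section Green

open Filter Topology

variable {X : Type*} [NormedAddCommGroup X] [InnerProductSpace ℂ X] [CompleteSpace X]
variable {a : X →ₗ.[ℂ] X} {m β : ℝ} (h : IsSelfAdjointGE a m) (hβ : 0 < β) {n : ℕ}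

/-- The time ordered correlation functions of `A₁, …, Aₙ`, with the operators rotated by `σ`. -/
noncomputable def correlation (A : Fin n → (ThermalSpace h hβ →L[ℂ] ThermalSpace h hβ))
    (σ : Fin n → Fin n) (t : Fin n → ℝ) : ℂ :=
  thermalState h hβ (List.ofFn fun i => dynamics h hβ (t (σ i)) (A (σ i))).prod

/-- `D` is the Green's function of `A₁, …, Aₙ`: it is holomorphic up to the boundary of the tube,
bounded, translation invariant, and has the correlation functions as boundary values. -/
structure IsSmoothGreen (A : Fin n → (ThermalSpace h hβ →L[ℂ] ThermalSpace h hβ))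
    (D : (Fin n → ℂ) → ℂ) : Prop where
  differentiableOn : DifferentiableOn ℂ D (closedTube β n)
  exists_norm_le : ∃ C, ∀ z ∈ closedTube β n, ‖D z‖ ≤ C
  add_const : ∀ z w, D (fun i => z i + w) = D z
  vertex : ∀ (k : ℕ) (hk : k ≤ n) (t : Fin n → ℝ),
    D (fun i => t i + Complex.I * timeVertex β n k i) = correlation h hβ A (rotation hk) t

theorem isSmoothGreen_greenSum {ε : Type*} [Fintype ε] (c : Fin n → ε → ℂ) (u : Fin n → ε → X) :
    IsSmoothGreen h hβ (fun i => weylSum h hβ (c i) (u i)) (greenSum h β c u) where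
  differentiableOn := differentiableOn_greenSum h hβ c u
  exists_norm_le := exists_norm_greenSum_le h hβ c u
  add_const := greenSum_add_const h c u
  vertex k hk t := by
    rw [greenSum_eq_of_timeVertex h hβ hk c u fun i => by simp]
    simp [correlation]

theorem exists_isSmoothGreen {Y : AddSubgroup X}
    {A : Fin n → (ThermalSpace h hβ →L[ℂ] ThermalSpace h hβ)}
    (hA : ∀ i, A i ∈ smoothAlgebra h hβ Y) : ∃ D, IsSmoothGreen h hβ A D := by
  obtain ⟨S, c, -, hc⟩ := exists_eq_weylSum h hβ hA
  rw [funext hc]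
  exact ⟨_, isSmoothGreen_greenSum h hβ c _⟩

theorem exists_isSmoothGreen_nonneg {κ : X ≃ₗᵢ⋆[ℂ] X} (hκ : ∀ x, κ (κ x) = x)
    (hcomm : CommutesWith a κ) {C : Fin n → (ThermalSpace h hβ →L[ℂ] ThermalSpace h hβ)}
    (hC : ∀ i, C i ∈ smoothAlgebra h hβ (fixedSubgroup κ)) :
    ∃ D, IsSmoothGreen h hβ (fun i => star (C i) * C i) D ∧
      ∀ s : Fin n → ℝ, Monotone s → (∀ i j, s j - s i ≤ β) →
        0 ≤ D (fun i => Complex.I * (s i : ℂ)) := by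
  obtain ⟨S, c, hS, hc⟩ := exists_eq_weylSum h hβ hC
  have hu : ∀ x : S, κ (x : X) = x := fun x => hS x x.2
  refine ⟨greenSum h β (fun i (e : S × S) => star (c i e.1) * c i e.2)
    (fun _ e => (e.2 : X) - (e.1 : X)), ?_, fun s hs hsβ =>
      greenSum_nonneg h hβ hκ hcomm hs hsβ c (fun _ x => (x : X)) fun _ => hu⟩
  have e : ∀ i, star (C i) * C i = weylSum h hβ
      (fun e : S × S => star (c i e.1) * c i e.2) (fun e => (e.2 : X) - (e.1 : X)) := fun i => by
    rw [hc i, star_weylSum_mul_self h hβ hcomm (c i) hu]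
  simp only [e]
  exact isSmoothGreen_greenSum h hβ _ _

/-- All hypotheses on convergence concern real times; the values of the limit over the vertices
follow from pointwise convergence there. -/
theorem exists_tendsto_isSmoothGreen {ι : Type*} {l : Filter ι} [l.NeBot]
    {A : ι → Fin n → (ThermalSpace h hβ →L[ℂ] ThermalSpace h hβ)}
    {A₀ : Fin n → (ThermalSpace h hβ →L[ℂ] ThermalSpace h hβ)} {D : ι → (Fin n → ℂ) → ℂ}
    (hD : ∀ α, IsSmoothGreen h hβ (A α) (D α)) {M : ℝ}
    (hM : ∀ α (σ : Equiv.Perm (Fin n)) t, ‖correlation h hβ (A α) σ t‖ ≤ M)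
    (hc : ∀ (σ : Equiv.Perm (Fin n)) t₀, Tendsto (fun p : ι × (Fin n → ℝ) =>
      correlation h hβ (A p.1) σ p.2) (l ×ˢ 𝓝 t₀) (𝓝 (correlation h hβ A₀ σ t₀))) :
    ∃ G : (Fin n → ℂ) → ℂ, (∀ z ∈ closedTube β n, Tendsto (fun α => D α z) l (𝓝 (G z))) ∧
      DifferentiableOn ℂ G (tube β n) ∧ ContinuousOn G (closedTube β n) ∧
      ∀ (k : ℕ) (hk : k ≤ n) (t : Fin n → ℝ),
        G (fun i => t i + Complex.I * timeVertex β n k i) =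
          correlation h hβ A₀ (rotation hk) t := by
  obtain ⟨G, hG, hG1, hG2⟩ := exists_tendsto_of_timeVertex hβ (l := l) (D := D) (M := M)
    (fun α => (hD α).differentiableOn) (fun α => (hD α).exists_norm_le)
    (fun α => (hD α).add_const) (fun α k hk t => by rw [(hD α).vertex k hk]; exact hM α _ t)
    (fun k hk t₀ => ⟨_, (hc (rotation hk) t₀).congr fun p => ((hD p.1).vertex k hk p.2).symm⟩)
  refine ⟨G, hG, hG1, hG2, fun k hk t => tendsto_nhds_unique (hG _ ?_) ?_ (l := l)⟩
  · refine mem_closedTube_of_timeSimplex ?_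
    simpa using timeVertex_mem hβ.le n k
  · have h1 : Tendsto (fun α : ι => (α, t)) l (l ×ˢ 𝓝 t) :=
      tendsto_id.prodMk (tendsto_const_nhds)
    exact ((hc (rotation hk) t).comp h1).congr fun α => ((hD α).vertex k hk t).symm

/-! ### The KMS condition -/

theorem tendsto_liouvilleOp {P : Type*} {l : Filter P} {t : P → ℝ} {t₀ : ℝ}
    {v : P → ThermalSpace h hβ} {v₀ : ThermalSpace h hβ} (ht : Tendsto t l (𝓝 t₀))
    (hv : Tendsto v l (𝓝 v₀)) :
    Tendsto (fun p => liouvilleOp h hβ (t p) (v p)) l (𝓝 (liouvilleOp h hβ t₀ v₀)) := by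
  have h1 := ((continuous_liouvilleOp h hβ v₀).tendsto t₀).comp ht
  refine h1.congr_dist ?_
  have h2 := tendsto_iff_dist_tendsto_zero.1 hv
  refine h2.congr fun p => ?_
  rw [Function.comp_apply, dist_eq_norm, dist_eq_norm, ← map_sub, norm_liouvilleOp, norm_sub_rev]

theorem thermalState_dynamics_mul (s t : ℝ) (A B : ThermalSpace h hβ →L[ℂ] ThermalSpace h hβ) :
    thermalState h hβ (dynamics h hβ s A * dynamics h hβ t B) =
      ⟪liouvilleOp h hβ s (star A (vacuum (h.rho_nonneg hβ))),
        liouvilleOp h hβ t (B (vacuum (h.rho_nonneg hβ)))⟫_ℂ := by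
  have e : star (dynamics h hβ s A) = dynamics h hβ s (star A) := by
    rw [dynamics_eq, dynamics_eq, star_mul, star_mul, star_liouvilleOp, star_liouvilleOp, neg_neg,
      mul_assoc]
  rw [thermalState_mul, e, dynamics_vacuum, dynamics_vacuum]

/-- Two-point correlations see the operators only through A*Ω and BΩ, so approximating these vectors
is enough and no norm bound on the approximants is needed. -/
theorem correlation_two (A : Fin 2 → (ThermalSpace h hβ →L[ℂ] ThermalSpace h hβ))
    (σ : Fin 2 → Fin 2) (t : Fin 2 → ℝ) : correlation h hβ A σ t =
      ⟪liouvilleOp h hβ (t (σ 0)) (star (A (σ 0)) (vacuum (h.rho_nonneg hβ))),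
        liouvilleOp h hβ (t (σ 1)) (A (σ 1) (vacuum (h.rho_nonneg hβ)))⟫_ℂ := by
  rw [← thermalState_dynamics_mul, correlation]
  simp [List.ofFn_succ]

theorem exists_kms {A B : ThermalSpace h hβ →L[ℂ] ThermalSpace h hβ} (hA : A ∈ fieldAlgebra h hβ)
    (hB : B ∈ fieldAlgebra h hβ) : ∃ F : ℂ → ℂ,
      DifferentiableOn ℂ F {z | 0 < z.im ∧ z.im < β} ∧
      ContinuousOn F {z | 0 ≤ z.im ∧ z.im ≤ β} ∧
      ∀ t : ℝ, F t = thermalState h hβ (A * dynamics h hβ t B) ∧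
        F (t + Complex.I * β) = thermalState h hβ (dynamics h hβ t B * A) := by
  set Ω := vacuum (h.rho_nonneg hβ)
  let C₀ : Fin 2 → (ThermalSpace h hβ →L[ℂ] ThermalSpace h hβ) := ![A, B]
  have hC₀ : ∀ i, C₀ i ∈ Set.centralizer (Set.centralizer (smoothAlgebra h hβ ⊤ :
      Set (ThermalSpace h hβ →L[ℂ] ThermalSpace h hβ))) := by
    rw [← coe_fieldAlgebra]
    intro i
    fin_cases i
    · exact hA
    · exact hB
  choose C hC hC1 hC2 using fun (N : ℕ) (i : Fin 2) =>
    exists_mem_norm_sub_apply_lt_star (smoothAlgebra h hβ ⊤) (hC₀ i) Ω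
      (Nat.one_div_pos_of_nat (α := ℝ) (n := N))
  have ht1 : ∀ i, Tendsto (fun N => C N i Ω) atTop (𝓝 (C₀ i Ω)) := fun i =>
    tendsto_iff_norm_sub_tendsto_zero.2 (squeeze_zero (fun _ => norm_nonneg _)
      (fun N => (hC1 N i).le) tendsto_one_div_add_atTop_nhds_zero_nat)
  have ht2 : ∀ i, Tendsto (fun N => star (C N i) Ω) atTop (𝓝 (star (C₀ i) Ω)) := fun i =>
    tendsto_iff_norm_sub_tendsto_zero.2 (squeeze_zero (fun _ => norm_nonneg _)
      (fun N => (hC2 N i).le) tendsto_one_div_add_atTop_nhds_zero_nat)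
  have hb1 : ∀ N i, ‖C N i Ω‖ ≤ ∑ j, (‖C₀ j Ω‖ + 1 + ‖star (C₀ j) Ω‖) := fun N i => by
    refine le_trans ?_ (Finset.single_le_sum (fun j _ => by positivity) (Finset.mem_univ i))
    have h1 := norm_sub_norm_le (C N i Ω) (C₀ i Ω)
    have h2 := hC1 N i
    have h3 := Nat.one_div_le_one_div (α := ℝ) (Nat.zero_le N)
    have h4 := norm_nonneg (star (C₀ i) Ω)
    rw [one_div] at h2
    norm_num at h3
    linarith
  have hb2 : ∀ N i, ‖star (C N i) Ω‖ ≤ ∑ j, (‖C₀ j Ω‖ + 1 + ‖star (C₀ j) Ω‖) := fun N i => by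
    refine le_trans ?_ (Finset.single_le_sum (fun j _ => by positivity) (Finset.mem_univ i))
    have h1 := norm_sub_norm_le (star (C N i) Ω) (star (C₀ i) Ω)
    have h2 := hC2 N i
    have h3 := Nat.one_div_le_one_div (α := ℝ) (Nat.zero_le N)
    have h4 := norm_nonneg (C₀ i Ω)
    rw [one_div] at h2
    norm_num at h3
    linarith
  choose D hD using fun N => exists_isSmoothGreen h hβ (hC N)
  obtain ⟨G, -, hG1, hG2, hG3⟩ := exists_tendsto_isSmoothGreen h hβ (l := atTop) (A₀ := C₀) hD
    (M := (∑ j, (‖C₀ j Ω‖ + 1 + ‖star (C₀ j) Ω‖)) * ∑ j, (‖C₀ j Ω‖ + 1 + ‖star (C₀ j) Ω‖))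
    (fun N σ t => by
      rw [correlation_two]
      refine (norm_inner_le_norm _ _).trans ?_
      rw [norm_liouvilleOp, norm_liouvilleOp]
      exact mul_le_mul (hb2 _ _) (hb1 _ _) (norm_nonneg _) ((norm_nonneg _).trans (hb2 N 0)))
    (fun σ t₀ => by
      simp only [correlation_two]
      have hs : ∀ i, Tendsto (fun p : ℕ × (Fin 2 → ℝ) => p.2 i) (atTop ×ˢ 𝓝 t₀) (𝓝 (t₀ i)) :=
        fun i => ((continuous_apply i).tendsto t₀).comp tendsto_snd
      exact (tendsto_liouvilleOp h hβ (hs _) ((ht2 _).comp tendsto_fst)).inner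
        (tendsto_liouvilleOp h hβ (hs _) ((ht1 _).comp tendsto_fst)))
  -- The slice z = (0, ζ) maps the strip into the tube. The vertex k = 2 gives the real edge with
  -- the operators in order, the vertex k = 1 the edge Im ζ = β with the two exchanged.
  refine ⟨fun ζ => G ![0, ζ], hG1.comp (f := fun ζ : ℂ => ![0, ζ]) ?_ ?_,
    hG2.comp (f := fun ζ : ℂ => ![0, ζ]) ?_ ?_, fun t => ⟨?_, ?_⟩⟩
  · refine (differentiable_pi.2 fun i => ?_).differentiableOn
    fin_cases i
    · exact differentiable_const _
    · exact differentiable_id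
  · rintro ζ ⟨h1, h2⟩ i j hij
    fin_cases i <;> fin_cases j <;> simp_all
  · refine (continuous_pi fun i => ?_).continuousOn
    fin_cases i
    · exact continuous_const
    · exact continuous_id
  · rintro ζ ⟨h1, h2⟩ i j hij
    fin_cases i <;> fin_cases j <;> simp_all [hβ.le]
  · have h1 := hG3 2 le_rfl ![0, t]
    have e : (fun i => ((![0, t] : Fin 2 → ℝ) i : ℂ) + Complex.I * timeVertex β 2 2 i) =
        ![0, (t : ℂ)] := by
      funext i
      fin_cases i <;> simp [timeVertex]
    rw [e] at h1
    refine h1.trans ?_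
    rw [rotation_self, correlation_two]
    have := thermalState_dynamics_mul h hβ 0 t A B
    rw [dynamics_eq h hβ 0, neg_zero, liouvilleOp_zero, one_mul, mul_one] at this
    rw [this]
    simp [C₀, liouvilleOp_zero]
  · have h1 := hG3 1 one_le_two ![0, t]
    have e : (fun i => ((![0, t] : Fin 2 → ℝ) i : ℂ) + Complex.I * timeVertex β 2 1 i) =
        ![0, (t : ℂ) + Complex.I * β] := by
      funext i
      fin_cases i <;> simp [timeVertex]
    rw [e] at h1
    refine h1.trans ?_
    have h3 : rotation one_le_two (0 : Fin 2) = 1 := rfl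
    have h4 : rotation one_le_two (1 : Fin 2) = 0 := rfl
    rw [correlation_two, h3, h4]
    have := thermalState_dynamics_mul h hβ t 0 B A
    rw [dynamics_eq h hβ 0, neg_zero, liouvilleOp_zero, one_mul, mul_one] at this
    rw [this]
    simp [C₀, liouvilleOp_zero]

end Green

/-! ### Approximation by squares and the main properties -/

section Positivity

open Filter Topology

theorem tendsto_apply_of_norm_le {P H : Type*} [NormedAddCommGroup H] [NormedSpace ℂ H]
    {l : Filter P} {A : P → H →L[ℂ] H} {A₀ : H →L[ℂ] H} {M : ℝ} (hM : ∀ p, ‖A p‖ ≤ M) {v : P → H}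
    {v₀ : H} (hA : Tendsto (fun p => A p v₀) l (𝓝 (A₀ v₀))) (hv : Tendsto v l (𝓝 v₀)) :
    Tendsto (fun p => A p (v p)) l (𝓝 (A₀ v₀)) := by
  have h1 : Tendsto (fun p => A p (v p - v₀)) l (𝓝 0) := by
    refine squeeze_zero_norm (fun p => (A p).le_of_opNorm_le (hM p) _) ?_
    have := (tendsto_iff_norm_sub_tendsto_zero.1 hv).const_mul M
    rwa [mul_zero] at this
  have h2 := h1.add hA
  rw [zero_add] at h2
  exact h2.congr fun p => by rw [map_sub, sub_add_cancel]

theorem norm_star_apply_of_commute {H : Type*} [NormedAddCommGroup H] [InnerProductSpace ℂ H]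
    [CompleteSpace H] {A : H →L[ℂ] H} (hA : Commute (star A) A) (v : H) : ‖star A v‖ = ‖A v‖ :=
  ((ContinuousLinearMap.isStarNormal_iff_norm_eq_adjoint (T := A)).1 ⟨hA⟩ v).symm

/-- Positive elements of the double commutant of a commutative `*`-algebra are strong limits of
bounded nets of squares `C* C` from the algebra. -/
theorem exists_tendsto_star_mul_self {H : Type*} [NormedAddCommGroup H] [InnerProductSpace ℂ H]
    [CompleteSpace H] (𝔄 : StarSubalgebra ℂ (H →L[ℂ] H)) (hcomm : ∀ A ∈ 𝔄, ∀ B ∈ 𝔄, A * B = B * A)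
    {A : H →L[ℂ] H} (hA : A ∈ Set.centralizer (Set.centralizer (𝔄 : Set (H →L[ℂ] H))))
    (hA0 : 0 ≤ A) : ∃ (C : Finset H × ℕ → H →L[ℂ] H) (M : ℝ), (∀ α, C α ∈ 𝔄) ∧
      (∀ α, ‖star (C α) * C α‖ ≤ M) ∧
      ∀ v, Tendsto (fun α => (star (C α) * C α) v) atTop (𝓝 (A v)) := by
  classical
  have hsa : IsSelfAdjoint A := IsSelfAdjoint.of_nonneg hA0
  have hle : (𝔄 : Set (H →L[ℂ] H)) ⊆ Set.centralizer 𝔄 := fun A hA B hB => hcomm B hB A hA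
  have hcc : ∀ A ∈ Set.centralizer (Set.centralizer (𝔄 : Set (H →L[ℂ] H))),
      ∀ B ∈ Set.centralizer (Set.centralizer (𝔄 : Set (H →L[ℂ] H))), Commute A B :=
    fun A hA B hB => hB A (Set.centralizer_subset hle hA)
  have hsub : (𝔄 : Set (H →L[ℂ] H)) ⊆ Set.centralizer (Set.centralizer 𝔄) :=
    Set.subset_centralizer_centralizer
  set S := cfc Real.sqrt A with hS
  have hSsa : IsSelfAdjoint S := cfc_predicate _ _
  have hSS : S * S = A := by
    rw [hS, ← cfc_mul _ _ _ (by fun_prop) (by fun_prop)]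
    refine Eq.trans (cfc_congr fun x hx => ?_) (cfc_id' ℝ A)
    exact Real.mul_self_sqrt (spectrum_nonneg_of_nonneg hA0 hx)
  have hSm : S ∈ Set.centralizer (Set.centralizer (𝔄 : Set (H →L[ℂ] H))) := fun B hB =>
    (IsSelfAdjoint.commute_cfc hsa (show Commute A B from (hA B hB).symm) _).eq.symm
  -- Scales √A to norm at most 1, as the bounded density lemma requires; the 1 avoids dividing by
  -- zero when A = 0.
  set r : ℝ := ‖S‖ + 1 with hr
  have hr0 : 0 < r := by positivity
  set S' : H →L[ℂ] H := (r⁻¹ : ℂ) • S with hS'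
  have hSr : (r : ℂ) • S' = S := by
    rw [hS', smul_smul, mul_inv_cancel₀ (by exact_mod_cast hr0.ne'), one_smul]
  have hS'sa : IsSelfAdjoint S' := by
    rw [hS', ← Complex.ofReal_inv]
    exact IsSelfAdjoint.smul (Complex.conj_ofReal _) hSsa
  have hS'm : S' ∈ Set.centralizer (Set.centralizer (𝔄 : Set (H →L[ℂ] H))) := fun B hB => by
    rw [hS', mul_smul_comm, smul_mul_assoc, hSm B hB]
  have hS'1 : ‖S'‖ ≤ 1 := by
    rw [hS', norm_smul, norm_inv, Complex.norm_real, Real.norm_of_nonneg hr0.le, inv_mul_le_iff₀ hr0]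
    rw [hr]; linarith
  -- The net is indexed by the vectors tested and the precision 1/(N+1); every vector eventually
  -- belongs to the tested set.
  choose B hB hB2 hBv using fun α : Finset H × ℕ =>
    exists_mem_norm_le_norm_sub_apply_lt 𝔄 hcomm hS'm hS'sa hS'1 (fun v : α.1 => (v : H))
      (Nat.one_div_pos_of_nat (α := ℝ) (n := α.2))
  have hBn : ∀ α v, ‖star (B α - S') v‖ = ‖(B α - S') v‖ := fun α v => by
    refine norm_star_apply_of_commute ?_ v
    rw [star_sub, hS'sa.star_eq]
    have h1 := hcc _ (hsub (hB α)) _ hS'm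
    have h2 := hcc _ (hsub (star_mem (hB α))) _ hS'm
    have h3 := hcc _ (hsub (star_mem (hB α))) _ (hsub (hB α))
    exact (h3.sub_right h2).sub_left (h1.symm.sub_right (Commute.refl _))
  have hlim : ∀ v, Tendsto (fun α => ‖(B α - S') v‖) atTop (𝓝 0) := fun v => by
    rw [Metric.tendsto_nhds]
    intro ε hε
    obtain ⟨N, hN⟩ := exists_nat_one_div_lt hε
    filter_upwards [eventually_ge_atTop (({v}, N) : Finset H × ℕ)] with α hα
    rw [Real.dist_eq, sub_zero, abs_of_nonneg (norm_nonneg _)]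
    have hv : v ∈ α.1 := hα.1 (Finset.mem_singleton_self v)
    refine (hBv α ⟨v, hv⟩).trans_le ((Nat.one_div_le_one_div hα.2).trans hN.le)
  have hlim1 : ∀ v, Tendsto (fun α => B α v) atTop (𝓝 (S' v)) := fun v =>
    tendsto_iff_norm_sub_tendsto_zero.2 (hlim v)
  have hlim2 : ∀ v, Tendsto (fun α => star (B α) v) atTop (𝓝 (S' v)) := fun v => by
    refine tendsto_iff_norm_sub_tendsto_zero.2 ((hlim v).congr fun α => ?_)
    rw [← hBn, star_sub, hS'sa.star_eq]; rfl
  have hB2' : ∀ α, ‖star (B α)‖ ≤ 2 := fun α => by rw [norm_star]; exact hB2 α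
  have e : ∀ α, star ((r : ℂ) • B α) * ((r : ℂ) • B α) = ((r : ℂ) * r) • (star (B α) * B α) :=
    fun α => by rw [star_smul, smul_mul_smul_comm, Complex.star_def, Complex.conj_ofReal]
  refine ⟨fun α => (r : ℂ) • B α, ‖(r : ℂ) * r‖ * (2 * 2), fun α => 𝔄.smul_mem (hB α) _,
    fun α => ?_, fun v => ?_⟩
  · rw [e, norm_smul]
    refine mul_le_mul_of_nonneg_left ?_ (norm_nonneg _)
    exact (norm_mul_le _ _).trans (mul_le_mul (hB2' α) (hB2 α) (norm_nonneg _) zero_le_two)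
  · simp only [e]
    have h1 : A v = ((r : ℂ) * r) • S' (S' v) := by
      rw [← hSS, ← hSr]
      simp only [mul_apply_eq_comp, FunLike.coe_smul, Pi.smul_apply, map_smul, smul_smul]
    rw [h1]
    exact (tendsto_apply_of_norm_le hB2' (hlim2 (S' v)) (hlim1 v)).const_smul _

variable {X : Type*} [NormedAddCommGroup X] [InnerProductSpace ℂ X] [CompleteSpace X]
variable {a : X →ₗ.[ℂ] X} {m β : ℝ} (h : IsSelfAdjointGE a m) (hβ : 0 < β) {n : ℕ}

theorem norm_prod_dynamics_apply_le {A : Fin n → (ThermalSpace h hβ →L[ℂ] ThermalSpace h hβ)}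
    {M : ℝ} (hM : ∀ i, ‖A i‖ ≤ M) (hM0 : 0 ≤ M) (t : Fin n → ℝ) (L : List (Fin n))
    (v : ThermalSpace h hβ) :
    ‖(L.map fun i => dynamics h hβ (t i) (A i)).prod v‖ ≤ M ^ L.length * ‖v‖ := by
  induction L with
  | nil => simp
  | cons i L ih =>
    rw [List.map_cons, List.prod_cons, mul_apply_eq_comp, List.length_cons, pow_succ', mul_assoc]
    exact (norm_dynamics_apply_le h hβ _ _ _).trans
      (mul_le_mul (hM i) ih (norm_nonneg _) hM0)

/-- Multiplication is jointly strongly continuous on bounded sets and the time evolution is strongly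
continuous, so products converge jointly in the net and the times. -/
theorem tendsto_prod_dynamics_apply {ι : Type*} {l : Filter ι}
    {A : ι → Fin n → (ThermalSpace h hβ →L[ℂ] ThermalSpace h hβ)}
    {A₀ : Fin n → (ThermalSpace h hβ →L[ℂ] ThermalSpace h hβ)} {M : ℝ}
    (hM : ∀ α i, ‖A α i‖ ≤ M) (hA : ∀ i v, Tendsto (fun α => A α i v) l (𝓝 (A₀ i v)))
    (t₀ : Fin n → ℝ) (L : List (Fin n)) (v : ThermalSpace h hβ) :
    Tendsto (fun p : ι × (Fin n → ℝ) => (L.map fun i => dynamics h hβ (p.2 i) (A p.1 i)).prod v)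
      (l ×ˢ 𝓝 t₀) (𝓝 ((L.map fun i => dynamics h hβ (t₀ i) (A₀ i)).prod v)) := by
  induction L with
  | nil => exact tendsto_const_nhds
  | cons i L ih =>
    simp only [List.map_cons, List.prod_cons, mul_apply_eq_comp]
    have hs : Tendsto (fun p : ι × (Fin n → ℝ) => p.2 i) (l ×ˢ 𝓝 t₀) (𝓝 (t₀ i)) :=
      ((continuous_apply i).tendsto t₀).comp tendsto_snd
    rw [dynamics_apply]
    refine Tendsto.congr (fun p => (dynamics_apply h hβ (p.2 i) (A p.1 i) _).symm) ?_
    exact tendsto_liouvilleOp h hβ hs (tendsto_apply_of_norm_le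
      (A := fun p : ι × (Fin n → ℝ) => A p.1 i) (fun p => hM p.1 i)
      ((hA i _).comp tendsto_fst) (tendsto_liouvilleOp h hβ hs.neg ih))

/-- Bounded nets of squares replace the Aᵢ; correlations of every order converge locally uniformly
in time, so the nonnegative Euclidean functions of the squares converge to that of the Aᵢ. -/
theorem exists_isGreenContinuation {κ : X ≃ₗᵢ⋆[ℂ] X} (hκ : ∀ x, κ (κ x) = x)
    (hcomm : CommutesWith a κ) {A : Fin n → (ThermalSpace h hβ →L[ℂ] ThermalSpace h hβ)}
    (hA : ∀ i, A i ∈ fieldAlgebraFixed h hβ κ ∧ 0 ≤ A i) :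
    ∃ G : (Fin n → ℂ) → ℂ, IsGreenContinuation β (dynamics h hβ) (thermalState h hβ) A G ∧
      ∀ s : Fin n → ℝ, Monotone s → (∀ i j, s j - s i ≤ β) →
        0 ≤ G (fun i => Complex.I * (s i : ℂ)) := by
  classical
  have hA' : ∀ i, A i ∈ Set.centralizer (Set.centralizer (smoothAlgebra h hβ (fixedSubgroup κ) :
      Set (ThermalSpace h hβ →L[ℂ] ThermalSpace h hβ))) := by
    rw [← coe_fieldAlgebraFixed h hβ hκ hcomm]
    exact fun i => (hA i).1
  choose C M hC hM hCA using fun i => exists_tendsto_star_mul_self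
    (smoothAlgebra h hβ (fixedSubgroup κ)) (smoothAlgebra_fixed_comm h hβ hcomm) (hA' i) (hA i).2
  have hM0 : ∀ i, 0 ≤ M i := fun i => (norm_nonneg _).trans (hM i (∅, 0))
  have hM' : ∀ α i, ‖star (C i α) * C i α‖ ≤ ∑ j, M j := fun α i =>
    (hM i α).trans (Finset.single_le_sum (fun j _ => hM0 j) (Finset.mem_univ i))
  have hcor : ∀ (B : Fin n → (ThermalSpace h hβ →L[ℂ] ThermalSpace h hβ)) (σ : Fin n → Fin n) t,
      correlation h hβ B σ t = ⟪vacuum (h.rho_nonneg hβ), ((List.ofFn σ).map fun i =>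
        dynamics h hβ (t i) (B i)).prod (vacuum (h.rho_nonneg hβ))⟫_ℂ := fun B σ t => by
    rw [List.map_ofFn]; rfl
  choose D hD hD0 using fun α => exists_isSmoothGreen_nonneg h hβ hκ hcomm fun i => hC i α
  obtain ⟨G, hG, hG1, hG2, hG3⟩ := exists_tendsto_isSmoothGreen h hβ (l := atTop) (A₀ := A) hD
    (M := (∑ j, M j) ^ n) (fun α σ t => by
      rw [hcor]
      refine (norm_inner_le_norm _ _).trans ?_
      have := norm_prod_dynamics_apply_le h hβ (hM' α) (Finset.sum_nonneg fun j _ => hM0 j) t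
        (List.ofFn σ) (vacuum (h.rho_nonneg hβ))
      rw [norm_vacuum h hβ, mul_one, List.length_ofFn] at this
      rwa [norm_vacuum h hβ, one_mul])
    (fun σ t₀ => by
      simp only [hcor]
      exact tendsto_const_nhds.inner
        (tendsto_prod_dynamics_apply h hβ hM' (fun i v => hCA i v) t₀ (List.ofFn σ) _))
  refine ⟨G, ⟨hG1, hG2.mono (closure_tube_subset hβ.le n), fun t => ?_⟩, fun s hs hsβ => ?_⟩
  · have h1 := hG3 n le_rfl t
    have e : (fun i => (t i : ℂ) + Complex.I * timeVertex β n n i) = fun i => (t i : ℂ) := by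
      funext i
      simp [timeVertex]
    rw [e, rotation_self] at h1
    exact h1
  · have := Complex.orderClosedTopology
    refine ge_of_tendsto (hG _ fun i j hij => ?_) (Eventually.of_forall fun α => hD0 α s hs hsβ)
    simpa [add_comm] using And.intro (hs hij) (hsβ i j)

theorem isKMSSystem : IsKMSSystem β (fieldAlgebra h hβ) (dynamics h hβ) (thermalState h hβ) where
  dynamics_mem t _ hA := dynamics_mem_fieldAlgebra h hβ t hA
  dynamics_zero A _ := by
    rw [dynamics_eq, neg_zero, liouvilleOp_zero, one_mul, mul_one]
  dynamics_add s t A _ := by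
    rw [dynamics_eq, dynamics_eq, dynamics_eq, neg_add_rev, liouvilleOp_add, liouvilleOp_add]
    simp only [mul_assoc]
  state_one := thermalState_one h hβ
  state_nonneg A _ := by
    rw [thermalState_mul, star_star]
    refine le_of_le_of_eq ?_
      (inner_self_eq_norm_sq_to_K (𝕜 := ℂ) (A (vacuum (h.rho_nonneg hβ)))).symm
    rw [← RCLike.ofReal_pow]
    exact Complex.zero_le_real.2 (sq_nonneg _)
  kms _ hA _ hB := exists_kms h hβ hA hB

end Positivity

end QuasiFree

theorem theorem4p5 {X : Type*} [NormedAddCommGroup X] [InnerProductSpace ℂ X] [CompleteSpace X]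
    (κ : X ≃ₗᵢ⋆[ℂ] X) (hκ : ∀ x, κ (κ x) = x)
    (a : X →ₗ.[ℂ] X) (m : ℝ) (h : QuasiFree.IsSelfAdjointGE a m)
    (hcomm : QuasiFree.CommutesWith a κ) (β : ℝ) (hβ : 0 < β) :
    QuasiFree.IsStochasticallyPositive β
      (QuasiFree.fieldAlgebra h hβ) (QuasiFree.fieldAlgebraFixed h hβ κ)
      (QuasiFree.dynamics h hβ) (QuasiFree.thermalState h hβ) where
  isKMSSystem := QuasiFree.isKMSSystem h hβ
  le := QuasiFree.fieldAlgebraFixed_le h hβ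
  abelian := QuasiFree.fieldAlgebraFixed_comm h hβ hκ hcomm
  generates := QuasiFree.vonNeumannGenerated_iUnion_dynamics h hβ hκ hcomm
  positive _ _ hA := QuasiFree.exists_isGreenContinuation h hβ hκ hcomm hA
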